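/- Let $n\ge 1$, and write points of $\mathbb H^n\cong\mathbb R^{4n}$ as $q=(q_0,\dots,q_{n-1})$ with $q_l=x_{4l}+\mathbf i x_{4l+1}+\mathbf j x_{4l+2}+\mathbf k x_{4l+3}$. **Operators.** For $l=0,\dots,n-1$ put $$\nabla_{(2l)0}=\partial_{x_{4l}}+\mathbf i\partial_{x_{4l+1}},\quad \nabla_{(2l)1}=-\partial_{x_{4l+2}}-\mathbf i\partial_{x_{4l+3}},\quad \nabla_{(2l+1)0}=\partial_{x_{4l+2}}-\mathbf i\partial_{x_{4l+3}},\quad \nabla_{(2l+1)1}=\partial_{x_{4l}}-\mathbf i\partial_{x_{4l+1}}.$$ Let $\omega^0,\dots,\omega^{2n-1}$ be a basis of $\mathbb C^{2n}$ and $\Omega_{2n}=\omega^0\wedge\dots\wedge\omega^{2n-1}$. For a smooth $\wedge^p\mathbb C^{2n}$-valued function $F=\sum_I f_I\,\omega^I$ set $d_\alpha F=\sum_{k,I}\nabla_{k\alpha}f_I\,\omega^k\wedge\omega^I$ ($\alpha=0,1$) and $\triangle F=d_0d_1F$. For $F=f\,\Omega_{2n}$ put $\int_\Omega F=\int_\Omega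 f\,dV$ with Lebesgue measure $dV$. A $p$-current on an open set $\Omega$ is a functional on the smooth compactly supported $\wedge^{2n-p}\mathbb C^{2n}$-valued functions on $\Omega$ (test forms). **PSH functions.** A function on $\Omega$ is PSH if it is upper semicontinuous and subharmonic on each right quaternionic line $\{a+vq:q\in\mathbb H\}$ intersected with $\Omega$; it is strictly PSH if moreover, locally, it remains PSH after subtracting $\varepsilon\|q\|^2$ for some $\varepsilon>0$. A quaternionic strictly pseudoconvex domain is a domain $\Omega\subseteq\mathbb H^n$ having a strictly PSH exhaustion function $\rho$, i.e. $\{\rho<c\}\Subset\Omega$ for all $c\in\mathbb R$. **Products.** For locally bounded PSH functions $u_1,\dots,u_p$ on $\Omega$, $p\le n$, the current $\triangle u_1\wedge\dots\wedge\triangle u_p$ is defined inductively by $$(\triangle u_1\wedge\dots\wedge\triangle u_p)(\eta)=(u_1\,\triangle u_2\wedge\dots\wedge\triangle u_p)(\triangle\eta)$$ for test forms $\eta$, starting from the empty product $\eta\mapsto\int_\Omega\eta$; here $\triangle u_2\wedge\dots\wedge\triangle u_p$ has complex Radon measures as coefficients, and these are multiplied by $u_1$. For $p=n$ the product is $\triangle_n(u_1,\dots,u_n)\,\Omega_{2n}$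 with a nonnegative Radon measure $\triangle_n(u_1,\dots,u_n)$ on $\Omega$, and integrals against it are integrals against this measure; $\triangle_nu:=\triangle_n(u,\dots,u)$. **Theorem (Lelong–Jensen type formula).** Let $\Omega\subseteq\mathbb H^n$ be a quaternionic strictly pseudoconvex domain, $\varphi$ a continuous (real-valued) PSH function on $\Omega$, and $V$ a locally bounded PSH function on $\Omega$. For $t\in\mathbb R$ put $B_\varphi(t)=\{q\in\Omega:\varphi(q)<t\}$. Let $r\in\mathbb R$ be such that $B_\varphi(r)$ is relatively compact in $\Omega$, and let $$\mu_{\varphi,r}=\triangle_n(\max\{\varphi,r\})-\chi_{\Omega\setminus B_\varphi(r)}\triangle_n\varphi$$ be the quaternionic boundary measure. Then the products $(\triangle\varphi)^n$, $(\triangle\max\{\varphi,r\})^n$ and $\triangle V\wedge(\triangle\varphi)^{n-1}$ are well defined as above, $\mu_{\varphi,r}$ is a nonnegative measure, all integrals below are finite, and $$\mu_{\varphi,r}(V)-\int_{B_\varphi(r)}V(\triangle\varphi)^n=\int_{B_\varphi(r)}(r-\varphi)\,\triangle V\wedge(\triangle\varphi)^{n-1}=\int_{-\infty}^r dt\int_{B_\varphi(t)}\triangle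 V\wedge(\triangle\varphi)^{n-1},$$ where $\mu_{\varphi,r}(V)=\int V\,d\mu_{\varphi,r}$. -/

import Mathlib

open MeasureTheory Set Filter Topology
open scoped Quaternion ContDiff

namespace QuatPluri

noncomputable section

/-- The flat quaternionic space `ℍⁿ ≅ ℝ⁴ⁿ`; the coordinate `x (l, k)` is the real coordinate
`x_{4l+k}`, so that the `l`-th quaternionic coordinate is
`x (l,0) + 𝐢 x (l,1) + 𝐣 x (l,2) + 𝐤 x (l,3)`. -/
abbrev HSpace (n : ℕ) : Type := EuclideanSpace ℝ (Fin n × Fin 4)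

/-- The `l`-th quaternionic coordinate of a point of `ℍⁿ`. -/
def coord {n : ℕ} (x : HSpace n) (l : Fin n) : ℍ[ℝ] :=
  ⟨x (l, 0), x (l, 1), x (l, 2), x (l, 3)⟩

/-- The parametrization `q ↦ a + v q` of a right quaternionic line, where `q` runs over
`ℍ ≅ ℝ⁴`. -/
def rightLine {n : ℕ} (a v : HSpace n) (q : EuclideanSpace ℝ (Fin 4)) : HSpace n :=
  a + WithLp.toLp 2 fun p : Fin n × Fin 4 =>
    Quaternion.linearIsometryEquivTuple
      (coord v p.1 * Quaternion.linearIsometryEquivTuple.symm q) p.2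

/-- A real valued function on an open subset `U` of `ℝ⁴` is subharmonic: it is upper
semicontinuous and satisfies the sub-mean value inequality on balls. (For a real valued
function the mean value is then finite, whence the integrability.) -/
def IsSubharmonicOn (f : EuclideanSpace ℝ (Fin 4) → ℝ) (U : Set (EuclideanSpace ℝ (Fin 4))) :
    Prop :=
  UpperSemicontinuousOn f U ∧
    ∀ (c : EuclideanSpace ℝ (Fin 4)) (R : ℝ), 0 < R → Metric.closedBall c R ⊆ U →
      IntegrableOn f (Metric.ball c R) ∧ f c ≤ ⨍ q in Metric.ball c R, f q

/-- Quaternionic plurisubharmonic (PSH) functions on `Ω`, real valued: upper semicontinuous and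
subharmonic on each right quaternionic line. -/
def IsPSH {n : ℕ} (Ω : Set (HSpace n)) (u : HSpace n → ℝ) : Prop :=
  UpperSemicontinuousOn u Ω ∧
    ∀ a v : HSpace n, v ≠ 0 →
      IsSubharmonicOn (fun q => u (rightLine a v q)) (rightLine a v ⁻¹' Ω)

/-- Strictly PSH functions: PSH functions which, locally, remain PSH after subtracting some
positive multiple of `‖q‖²`. -/
def IsStrictlyPSH {n : ℕ} (Ω : Set (HSpace n)) (u : HSpace n → ℝ) : Prop :=
  IsPSH Ω u ∧ ∀ x ∈ Ω, ∃ U : Set (HSpace n), IsOpen U ∧ x ∈ U ∧ U ⊆ Ω ∧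
    ∃ ε : ℝ, 0 < ε ∧ IsPSH U (fun q => u q - ε * ‖q‖ ^ 2)

/-- `A ⋐ Ω`. -/
def RelativelyCompactIn {n : ℕ} (A Ω : Set (HSpace n)) : Prop :=
  IsCompact (closure A) ∧ closure A ⊆ Ω

/-- The open sublevel set `B_φ(r) = {q ∈ Ω : φ(q) < r}`. -/
def sublevel {n : ℕ} (Ω : Set (HSpace n)) (φ : HSpace n → ℝ) (r : ℝ) : Set (HSpace n) :=
  {q ∈ Ω | φ q < r}

/-- A quaternionic strictly pseudoconvex domain: a domain (connected open set) which has a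
strictly PSH exhaustion function. -/
def IsStrictlyPseudoconvexDomain {n : ℕ} (Ω : Set (HSpace n)) : Prop :=
  IsOpen Ω ∧ IsConnected Ω ∧
    ∃ ρ : HSpace n → ℝ, IsStrictlyPSH Ω ρ ∧ ∀ c : ℝ, RelativelyCompactIn (sublevel Ω ρ c) Ω

/-- `u` is locally bounded on `Ω`. -/
def IsLocallyBoundedOn {n : ℕ} (Ω : Set (HSpace n)) (u : HSpace n → ℝ) : Prop :=
  ∀ x ∈ Ω, ∃ C : ℝ, ∀ᶠ y in 𝓝[Ω] x, |u y| ≤ C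

/-! ### Forms, the operators `d₀`, `d₁` and the Baston operator -/

/-- A form `F = ∑_I f_I ω^I` with values in `⋀ ℂ²ⁿ`, given by its coefficients `f_I = F · I`.
Here `I` runs over the subsets of `{0, …, 2n-1}`, and `ω^I` is the wedge product of the
`ω^i`, `i ∈ I`, in increasing order. Forms of all degrees are treated at once: `p`-forms are those
whose only coefficients are at sets `I` of cardinality `p`. -/
abbrev QForm (n : ℕ) : Type := HSpace n → Finset (Fin (n * 2)) → ℂ

/-- The partial derivative `∂/∂x_{4l+k}`. -/
def partialX {n : ℕ} (l : Fin n) (k : Fin 4) (f : HSpace n → ℂ) (x : HSpace n) : ℂ :=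
  fderiv ℝ f x (EuclideanSpace.single (l, k) 1)

/-- The first-order operators `∇_{jα}`; with `j = 2l` or `j = 2l+1` they are
`∇_{(2l)0} = ∂_{4l} + 𝐢 ∂_{4l+1}`, `∇_{(2l)1} = -∂_{4l+2} - 𝐢 ∂_{4l+3}`,
`∇_{(2l+1)0} = ∂_{4l+2} - 𝐢 ∂_{4l+3}`, `∇_{(2l+1)1} = ∂_{4l} - 𝐢 ∂_{4l+1}`. -/
def nabla {n : ℕ} (j : Fin (n * 2)) (α : Fin 2) (f : HSpace n → ℂ) (x : HSpace n) : ℂ :=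
  if j.modNat = 0 then
    if α = 0 then partialX j.divNat 0 f x + Complex.I * partialX j.divNat 1 f x
    else -partialX j.divNat 2 f x - Complex.I * partialX j.divNat 3 f x
  else
    if α = 0 then partialX j.divNat 2 f x - Complex.I * partialX j.divNat 3 f x
    else partialX j.divNat 0 f x - Complex.I * partialX j.divNat 1 f x

/-- `d_α F = ∑_{k,I} ∇_{kα} f_I ω^k ∧ ω^I`. The coefficient at `ω^J` collects the pairs
`(k, I)` with `k ∈ J` and `I = J \ {k}`, for which `ω^k ∧ ω^I = (-1)^{#{j ∈ J, j < k}} ω^J`. -/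
def dOp {n : ℕ} (α : Fin 2) (F : QForm n) : QForm n := fun x J =>
  ∑ k ∈ J, (-1 : ℂ) ^ (J.filter (· < k)).card * nabla k α (fun y => F y (J.erase k)) x

/-- The Baston operator `△ = d₀ d₁`. -/
def baston {n : ℕ} (F : QForm n) : QForm n := dOp 0 (dOp 1 F)

/-- Test forms on `Ω`: smooth with compact support contained in `Ω`. -/
def IsTestForm {n : ℕ} (Ω : Set (HSpace n)) (η : QForm n) : Prop :=
  ContDiff ℝ ∞ η ∧ HasCompactSupport η ∧ tsupport η ⊆ Ω

/-! ### Currents and the Bedford–Taylor product -/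

/-- Functionals on test forms. A `p`-current acts on test forms of degree `2n - p`; it is extended
by zero to the other degrees. Only the values on test forms matter. -/
abbrev QCurrent (n : ℕ) : Type := QForm n → ℂ

/-- `μ` is finite on the compact subsets of `Ω`. -/
def IsRadonOn {n : ℕ} (Ω : Set (HSpace n)) (μ : Measure (HSpace n)) : Prop :=
  ∀ K : Set (HSpace n), IsCompact K → K ⊆ Ω → μ K < ⊤

/-- The current `T` has the complex Radon measures `g_I μ` as coefficients (up to the
signs of the duality between `ω^I` and its complement): `T(η) = ∑_I ∫ η_I g_I dμ`. -/
def HasDensity {n : ℕ} (Ω : Set (HSpace n)) (T : QCurrent n) (μ : Measure (HSpace n))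
    (g : QForm n) : Prop :=
  IsRadonOn Ω μ ∧ LocallyIntegrableOn g Ω μ ∧
    ∀ η : QForm n, IsTestForm Ω η → T η = ∫ x in Ω, ∑ I, g x I * η x I ∂μ

/-- The current `T` has (complex Radon) measure coefficients, i.e. is of order zero. -/
def HasMeasureCoefficients {n : ℕ} (Ω : Set (HSpace n)) (T : QCurrent n) : Prop :=
  ∃ (μ : Measure (HSpace n)) (g : QForm n), HasDensity Ω T μ g

open Classical in
/-- The product `u T` of a locally bounded Borel function with a current `T` with measure
coefficients: each coefficient measure is multiplied by `u`. (The result does not depend on the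
way the coefficients are written as `g_I μ`; the value is `0` if `T` is not of order zero.) -/
def mulCurrent {n : ℕ} (Ω : Set (HSpace n)) (u : HSpace n → ℝ) (T : QCurrent n) : QCurrent n :=
  fun η =>
    if h : HasMeasureCoefficients Ω T then
      ∫ x in Ω, (u x : ℂ) * ∑ I, h.choose_spec.choose x I * η x I ∂h.choose
    else 0

/-- `△u ∧ T := △(u T)`, that is, `(△u ∧ T)(η) = (u T)(△η)`. -/
def bastonWedge {n : ℕ} (Ω : Set (HSpace n)) (u : HSpace n → ℝ) (T : QCurrent n) : QCurrent n :=
  fun η => mulCurrent Ω u T (baston η)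

/-- The current `△u₁ ∧ … ∧ △u_p`, defined inductively by
`△u₁ ∧ … ∧ △u_p = △(u₁ △u₂ ∧ … ∧ △u_p)`; the empty product is the `0`-current `1`, i.e.
`η ↦ ∫_Ω η`, the integral of a form being that of its coefficient at
`Ω_{2n} = ω⁰ ∧ … ∧ ω^{2n-1}`. -/
def bastonProduct {n : ℕ} (Ω : Set (HSpace n)) : List (HSpace n → ℝ) → QCurrent n
  | [] => fun η => ∫ x in Ω, η x Finset.univ
  | u :: us => bastonWedge Ω u (bastonProduct Ω us)

/-- The `2n`-current `T` is `m Ω_{2n}` for the (nonnegative) Radon measure `m` on `Ω`. -/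
def IsCoefficientMeasure {n : ℕ} (Ω : Set (HSpace n)) (T : QCurrent n)
    (m : Measure (HSpace n)) : Prop :=
  m Ωᶜ = 0 ∧ IsRadonOn Ω m ∧
    ∀ η : QForm n, IsTestForm Ω η → T η = ∫ x, η x ∅ ∂m

open Classical in
/-- The measure `△_n(u₁, …, u_n)`, the coefficient of `△u₁ ∧ … ∧ △u_n`. -/
def mongeAmpere {n : ℕ} (Ω : Set (HSpace n)) (us : List (HSpace n → ℝ)) :
    Measure (HSpace n) :=
  if h : ∃ m, IsCoefficientMeasure Ω (bastonProduct Ω us) m then h.choose else 0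

/-- The product `△u₁ ∧ … ∧ △u_n` is well defined: each of the partial products entering its
inductive definition has measure coefficients, and the product itself is a nonnegative Radon
measure times `Ω_{2n}`. -/
def MongeAmpereDefined {n : ℕ} (Ω : Set (HSpace n)) (us : List (HSpace n → ℝ)) : Prop :=
  (∀ vs : List (HSpace n → ℝ), vs <:+ us → HasMeasureCoefficients Ω (bastonProduct Ω vs)) ∧
    IsCoefficientMeasure Ω (bastonProduct Ω us) (mongeAmpere Ω us)

/-- The measure `△_n u`, the coefficient of `(△u)ⁿ`. -/
def mongeAmpereSelf {n : ℕ} (Ω : Set (HSpace n)) (u : HSpace n → ℝ) : Measure (HSpace n) :=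
  mongeAmpere Ω (List.replicate n u)

/-- The truncation `φ_r = max {φ, r}`. -/
def truncation {n : ℕ} (φ : HSpace n → ℝ) (r : ℝ) : HSpace n → ℝ := fun q => max (φ q) r

/-- The quaternionic boundary measure `μ_{φ,r} = △_n φ_r - χ_{Ω \ B_φ(r)} △_n φ`. -/
def boundaryMeasure {n : ℕ} (Ω : Set (HSpace n)) (φ : HSpace n → ℝ) (r : ℝ) :
    Measure (HSpace n) :=
  mongeAmpereSelf Ω (truncation φ r) - (mongeAmpereSelf Ω φ).restrict (Ω \ sublevel Ω φ r)

end

end QuatPluri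

open QuatPluri

namespace QuatPluri

noncomputable section

/-! Put ψ = max{φ, r} and B = B_φ(r). The formula is integration by parts applied to a telescoping
sum. Test V (△ψ)^j ∧ (△φ)^(n-j) against a cutoff θ that equals 1 near the closure of B. Passing from
j to j+1 replaces one factor △φ by △ψ. Since θ = 1 near every point where ψ ≠ φ, moving △ onto V
turns the difference into ∫ θ (ψ - φ) △V ∧ (△ψ)^j ∧ (△φ)^(n-1-j), see
`IsClosedPositive.integration_by_parts`. Here ψ - φ vanishes off B, while on B the function ψ is the
constant r, so every remaining factor △ψ kills the term. Only j = 0 survives and gives the integral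
of r - φ over B (`lelong_jensen_cutoff`). Off the closure of B the Monge–Ampère measures of ψ and φ
agree, so the cutoff disappears, and on the closure the remaining mass is the boundary measure
(`boundaryMeasure_add`). The second equality is the layer cake formula.

All this rests on the products being positive currents that behave well under limits. The algebraic
part concerns forms with constant coefficients. Right multiplication by q acts on the pair (d₀ℓ,
d₁ℓ) by a 2×2 matrix of determinant |q|², so averaging a quadratic form over right multiplications
changes its 2-form only by a factor. Hence nonnegativity on right lines makes the 2-form a sum of
elementary forms d₀ℓ ∧ d₁ℓ (`exists_hessForm_eq_sum_elemPos`). A product of n elementary forms is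
nonnegative by Gaussian elimination over ℍ (`prod_elemPos_omega_firstIdx`). Their m-fold products
span the forms of degree 2m, so a closed positive current is given by finitely many positive
measures (`exists_measureRep`).

The analytic part approximates a locally bounded PSH function, near a compact set, by a bounded
pointwise convergent sequence of smooth functions with nonnegative Hessians
(`IsPSH.exists_smooth_approx`). Thus △u ∧ T is closed and positive whenever T is
(`IsClosedPositive.bastonWedge`). Continuity of φ enters through `tendsto_mulCurrent_of_weak`:
weakly convergent positive currents may be multiplied by locally uniformly convergent functions with
continuous limit. This gives commutativity of the factors and, by comparison with max{φ + ε, r},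
nonnegativity of the boundary measure (`restrict_mongeAmpereSelf_le`). -/

/-! ### Exterior multiplication on coefficient vectors -/

/-- The exterior algebra `⋀ ℂ²ⁿ`, by coefficients. -/
abbrev Lam (n : ℕ) : Type := Finset (Fin (n * 2)) → ℂ

/-- The basis element `ω^I`. -/
def omega {n : ℕ} (I : Finset (Fin (n * 2))) : Lam n := Pi.single I 1

/-- Exterior multiplication by `ω^k`. -/
def extMul {n : ℕ} (k : Fin (n * 2)) : Module.End ℂ (Lam n) where
  toFun f J := if k ∈ J then (-1 : ℂ) ^ (J.filter (· < k)).card * f (J.erase k) else 0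
  map_add' f g := by
    funext J
    by_cases h : k ∈ J <;> simp [h, mul_add]
  map_smul' c f := by
    funext J
    by_cases h : k ∈ J <;> simp [h, mul_left_comm]

theorem extMul_apply {n : ℕ} (k : Fin (n * 2)) (f : Lam n) (J : Finset (Fin (n * 2))) :
    extMul k f J = if k ∈ J then (-1 : ℂ) ^ (J.filter (· < k)).card * f (J.erase k) else 0 := rfl

/-- Removing j from J lowers by one the number of elements below k, whereas removing k does not
affect those below j. The two orders therefore differ by exactly one sign. -/
theorem extMul_mul_of_lt {n : ℕ} {j k : Fin (n * 2)} (h : j < k) :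
    extMul j * extMul k = -(extMul k * extMul j) := by
  refine LinearMap.ext fun f => funext fun J => ?_
  simp only [Module.End.mul_apply, LinearMap.neg_apply, Pi.neg_apply, extMul_apply,
    Finset.mem_erase]
  by_cases hj : j ∈ J
  · by_cases hk : k ∈ J
    · have h1 : ((J.erase j).filter (· < k)).card + 1 = (J.filter (· < k)).card := by
        rw [Finset.filter_erase]
        exact Finset.card_erase_add_one (by simp [hj, h])
      have h2 : ((J.erase k).filter (· < j)) = J.filter (· < j) := by
        rw [Finset.filter_erase]
        exact Finset.erase_eq_of_notMem (by simp [h.le])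
      simp only [hj, hk, if_true, h.ne, h.ne', ne_eq, not_false_eq_true, and_self, h2, ← h1,
        Finset.erase_right_comm (a := j) (b := k), pow_succ]
      ring
    · simp [hk]
  · simp [hj]

theorem extMul_mul_self {n : ℕ} (k : Fin (n * 2)) : extMul k * extMul k = 0 := by
  refine LinearMap.ext fun f => funext fun J => ?_
  simp [extMul_apply]

theorem extMul_anticomm {n : ℕ} (j k : Fin (n * 2)) :
    extMul j * extMul k = -(extMul k * extMul j) := by
  rcases lt_trichotomy j k with h | rfl | h
  · exact extMul_mul_of_lt h
  · simp [extMul_mul_self]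
  · rw [extMul_mul_of_lt h, neg_neg]

theorem extMul_omega_of_mem {n : ℕ} {k : Fin (n * 2)} {I : Finset (Fin (n * 2))} (h : k ∈ I) :
    extMul k (omega I) = 0 := by
  funext J
  rw [extMul_apply]
  split_ifs with hk
  · have : J.erase k ≠ I := fun e => by simp [← e] at h
    simp [omega, this]
  · rfl

theorem extMul_omega_of_notMem {n : ℕ} {k : Fin (n * 2)} {I : Finset (Fin (n * 2))} (h : k ∉ I) :
    extMul k (omega I) = (-1 : ℂ) ^ (I.filter (· < k)).card • omega (insert k I) := by
  funext J
  rw [extMul_apply]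
  by_cases hJ : J = insert k I
  · subst hJ
    have : (insert k I).filter (· < k) = I.filter (· < k) := by
      simp [Finset.filter_insert]
    simp [omega, this, h]
  · simp only [omega, Pi.smul_apply, Pi.single_eq_of_ne hJ, smul_zero]
    split_ifs with hk
    · have : J.erase k ≠ I := fun e => hJ (by rw [← e, Finset.insert_erase hk])
      simp [this]
    · rfl

/-! ### Coefficients of the operators `∇_{jα}` -/

/-- The index set of the real coordinates. -/
abbrev RIdx (n : ℕ) : Type := Fin n × Fin 4

/-- The coefficients of `∇_{jα}` in one quaternionic variable. -/
def blockCoeff (α m : Fin 2) : Fin 4 → ℂ :=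
  if m = 0 then
    if α = 0 then ![1, Complex.I, 0, 0] else ![0, 0, -1, -Complex.I]
  else
    if α = 0 then ![0, 0, 1, -Complex.I] else ![1, -Complex.I, 0, 0]

/-- The coefficient of `∂_p` in `∇_{jα}`. -/
def nablaCoeff {n : ℕ} (α : Fin 2) (j : Fin (n * 2)) (p : RIdx n) : ℂ :=
  if j.divNat = p.1 then blockCoeff α j.modNat p.2 else 0

theorem nabla_eq_sum {n : ℕ} (j : Fin (n * 2)) (α : Fin 2) (f : HSpace n → ℂ) (x : HSpace n) :
    nabla j α f x = ∑ p : RIdx n, nablaCoeff α j p * partialX p.1 p.2 f x := by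
  simp only [nablaCoeff, ite_mul, zero_mul]
  rw [Fintype.sum_prod_type]
  simp only [Fin.sum_univ_four]
  rw [Finset.sum_eq_single j.divNat]
  · simp only [if_true, nabla, blockCoeff]
    split_ifs <;> simp <;> ring
  · intro b _ hb
    simp [hb.symm]
  · simp

/-- The operator `∑_j c_{jαp} ω^j ∧`, i.e. exterior multiplication by `d_α x_p`. -/
def dx {n : ℕ} (α : Fin 2) (p : RIdx n) : Module.End ℂ (Lam n) :=
  ∑ j, nablaCoeff α j p • extMul j

/-- Only the anticommutation of the ω^j is used, so it holds for equal and for different α, β. It is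
the source of the sign rules for d₀, d₁ and of the commutation of all 2-forms below. -/
theorem dx_anticomm {n : ℕ} (α β : Fin 2) (p q : RIdx n) :
    dx α p * dx β q = -(dx β q * dx α p) := by
  simp only [dx, Finset.sum_mul_sum, ← Finset.sum_neg_distrib]
  rw [Finset.sum_comm]
  refine Finset.sum_congr rfl fun j _ => Finset.sum_congr rfl fun i _ => ?_
  rw [smul_mul_smul_comm, smul_mul_smul_comm, extMul_anticomm i j, smul_neg,
    mul_comm (nablaCoeff α i p)]

/-- Exterior multiplication by `d_α ℓ` for the linear function `ℓ` with complex coefficients `b`. -/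
def dLin {n : ℕ} (α : Fin 2) (b : RIdx n → ℂ) : Module.End ℂ (Lam n) :=
  ∑ p, b p • dx α p

theorem dLin_add {n : ℕ} (α : Fin 2) (b c : RIdx n → ℂ) :
    dLin α (b + c) = dLin α b + dLin α c := by
  simp [dLin, add_smul, Finset.sum_add_distrib]

theorem dLin_smul {n : ℕ} (α : Fin 2) (a : ℂ) (b : RIdx n → ℂ) :
    dLin α (a • b) = a • dLin α b := by
  simp [dLin, mul_smul, Finset.smul_sum]

theorem dLin_anticomm {n : ℕ} (α β : Fin 2) (b c : RIdx n → ℂ) :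
    dLin α b * dLin β c = -(dLin β c * dLin α b) := by
  simp only [dLin, Finset.sum_mul_sum, ← Finset.sum_neg_distrib]
  rw [Finset.sum_comm]
  refine Finset.sum_congr rfl fun j _ => Finset.sum_congr rfl fun i _ => ?_
  rw [smul_mul_smul_comm, smul_mul_smul_comm, dx_anticomm α β i j, smul_neg, mul_comm (b i)]

theorem dLin_mul_self {n : ℕ} (α : Fin 2) (b : RIdx n → ℂ) : dLin α b * dLin α b = 0 := by
  have h := dLin_anticomm α α b b
  have h2 : (2 : ℂ) • (dLin α b * dLin α b) = 0 := by
    rw [two_smul]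
    nth_rewrite 1 [h]
    simp
  simpa using h2

theorem dLin_eq_sum_extMul {n : ℕ} (α : Fin 2) (b : RIdx n → ℂ) :
    dLin α b = ∑ j, (∑ p, nablaCoeff α j p * b p) • extMul j := by
  simp only [dLin, dx, Finset.smul_sum, Finset.sum_smul]
  rw [Finset.sum_comm]
  refine Finset.sum_congr rfl fun j _ => Finset.sum_congr rfl fun i _ => ?_
  rw [smul_smul, mul_comm (b i)]

/-- The real vector `b` as a complex vector. -/
def cpx {n : ℕ} (b : RIdx n → ℝ) : RIdx n → ℂ := fun p => (b p : ℂ)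

/-- The elementary positive form `d₀ℓ ∧ d₁ℓ`, as a multiplication operator. -/
def elemPos {n : ℕ} (b : RIdx n → ℝ) : Module.End ℂ (Lam n) := dLin 0 (cpx b) * dLin 1 (cpx b)

/-- Multiplication by the 2-form `∑ H_{pq} d₀x_p ∧ d₁x_q`. -/
def hessForm {n : ℕ} (H : Matrix (RIdx n) (RIdx n) ℝ) : Module.End ℂ (Lam n) :=
  ∑ p, ∑ q, (H p q : ℂ) • (dx 0 p * dx 1 q)

theorem commute_mul_of_anticomm {R : Type*} [Ring R] {a b c : R} (hac : a * c = -(c * a))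
    (hbc : b * c = -(c * b)) : Commute (a * b) c := by
  unfold Commute SemiconjBy
  rw [mul_assoc, hbc, mul_neg, ← mul_assoc, hac, neg_mul, neg_neg, mul_assoc]

theorem dx_mul_dx_commute {n : ℕ} (α β γ δ : Fin 2) (p q r s : RIdx n) :
    Commute (dx α p * dx β q) (dx γ r * dx δ s) :=
  (commute_mul_of_anticomm (dx_anticomm _ _ _ _) (dx_anticomm _ _ _ _)).mul_right
    (commute_mul_of_anticomm (dx_anticomm _ _ _ _) (dx_anticomm _ _ _ _))

theorem hessForm_commute {n : ℕ} (H G : Matrix (RIdx n) (RIdx n) ℝ) :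
    Commute (hessForm H) (hessForm G) := by
  unfold hessForm
  refine Commute.sum_left _ _ _ fun p _ => Commute.sum_left _ _ _ fun q _ =>
    Commute.sum_right _ _ _ fun r _ => Commute.sum_right _ _ _ fun s _ => ?_
  exact ((dx_mul_dx_commute 0 1 0 1 p q r s).smul_left _).smul_right _

theorem elemPos_eq_hessForm {n : ℕ} (b : RIdx n → ℝ) :
    elemPos b = hessForm (Matrix.vecMulVec b b) := by
  simp only [elemPos, hessForm, dLin, Finset.sum_mul_sum, Matrix.vecMulVec_apply]
  refine Finset.sum_congr rfl fun j _ => Finset.sum_congr rfl fun i _ => ?_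
  rw [smul_mul_smul_comm]
  simp [cpx]

theorem elemPos_commute {n : ℕ} (b c : RIdx n → ℝ) : Commute (elemPos b) (elemPos c) := by
  rw [elemPos_eq_hessForm, elemPos_eq_hessForm]; exact hessForm_commute _ _

theorem hessForm_add {n : ℕ} (H G : Matrix (RIdx n) (RIdx n) ℝ) :
    hessForm (H + G) = hessForm H + hessForm G := by
  simp only [hessForm, Matrix.add_apply, Complex.ofReal_add, add_smul, Finset.sum_add_distrib]

theorem hessForm_smul {n : ℕ} (a : ℝ) (H : Matrix (RIdx n) (RIdx n) ℝ) :
    hessForm (a • H) = (a : ℂ) • hessForm H := by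
  simp only [hessForm, Matrix.smul_apply, smul_eq_mul, Complex.ofReal_mul, mul_smul,
    Finset.smul_sum]

theorem hessForm_sum {n : ℕ} {ι : Type*} (s : Finset ι) (H : ι → Matrix (RIdx n) (RIdx n) ℝ) :
    hessForm (∑ i ∈ s, H i) = ∑ i ∈ s, hessForm (H i) := by
  classical
  induction s using Finset.induction_on with
  | empty => simp [hessForm]
  | insert a s ha ih => rw [Finset.sum_insert ha, Finset.sum_insert ha, hessForm_add, ih]

/-! ### Right multiplication by quaternions -/

/-- The matrix of the right multiplication by a quaternion on `ℍ`. -/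
def rmulMatrix (q : Fin 4 → ℝ) : Matrix (Fin 4) (Fin 4) ℝ :=
  !![q 0, -q 1, -q 2, -q 3;
     q 1, q 0, q 3, -q 2;
     q 2, -q 3, q 0, q 1;
     q 3, q 2, -q 1, q 0]

/-- Right multiplication by a quaternion on `ℍⁿ`. -/
def rmul {n : ℕ} (q : Fin 4 → ℝ) (b : RIdx n → ℝ) : RIdx n → ℝ :=
  fun p => ∑ k, rmulMatrix q p.2 k * b (p.1, k)

theorem rightLine_apply {n : ℕ} (a v : HSpace n) (q : EuclideanSpace ℝ (Fin 4)) (p : RIdx n) :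
    rightLine a v q p = a p + rmul q v p := by
  obtain ⟨l, k⟩ := p
  simp only [rightLine, rmul, PiLp.add_apply, coord, Fin.sum_univ_four]
  congr 1
  have h1 : Quaternion.linearIsometryEquivTuple.symm q = (⟨q 0, q 1, q 2, q 3⟩ : ℍ[ℝ]) := rfl
  have h2 : ∀ a : ℍ[ℝ], Quaternion.linearIsometryEquivTuple a = !₂[a.re, a.imI, a.imJ, a.imK] :=
    fun _ => rfl
  rw [h1, h2]
  erw [QuaternionAlgebra.mk_mul_mk]
  fin_cases k <;> simp [rmulMatrix] <;> ring

theorem sum_nablaCoeff_mul {n : ℕ} (α : Fin 2) (j : Fin (n * 2)) (c : RIdx n → ℂ) :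
    ∑ p, nablaCoeff α j p * c p = ∑ k, blockCoeff α j.modNat k * c (j.divNat, k) := by
  rw [Fintype.sum_prod_type, Finset.sum_eq_single j.divNat]
  · simp [nablaCoeff]
  · intro b _ hb
    simp [nablaCoeff, hb.symm]
  · simp

/-- The action of a right multiplication on `(d₀ℓ, d₁ℓ)`; it has determinant `|q|²`. -/
def rmulCoeff (q : Fin 4 → ℝ) : Matrix (Fin 2) (Fin 2) ℂ :=
  !![q 0 + Complex.I * q 1, q 2 - Complex.I * q 3;
     -q 2 - Complex.I * q 3, q 0 - Complex.I * q 1]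

/-- After collecting the coefficients of ω^j this is an identity in a single quaternionic variable,
checked for each α and each parity of j. Right multiplication acts on the index α alone, and so
preserves the span of d₀ℓ and d₁ℓ. -/
theorem dLin_rmul {n : ℕ} (q : Fin 4 → ℝ) (α : Fin 2) (b : RIdx n → ℝ) :
    dLin α (cpx (rmul q b)) =
      rmulCoeff q α 0 • dLin 0 (cpx b) + rmulCoeff q α 1 • dLin 1 (cpx b) := by
  simp only [dLin_eq_sum_extMul, Finset.smul_sum, smul_smul, ← Finset.sum_add_distrib, ← add_smul]
  refine Finset.sum_congr rfl fun j _ => ?_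
  congr 1
  simp only [sum_nablaCoeff_mul, cpx, rmul, Fin.sum_univ_four]
  generalize j.modNat = m
  have hI : Complex.I ^ 2 = -1 := Complex.I_sq
  fin_cases α <;> fin_cases m <;>
    simp [blockCoeff, rmulCoeff, rmulMatrix] <;> ring_nf <;> simp only [hI] <;> ring

theorem rmulCoeff_det (q : Fin 4 → ℝ) :
    rmulCoeff q 0 0 * rmulCoeff q 1 1 - rmulCoeff q 0 1 * rmulCoeff q 1 0 =
      ((∑ k, q k ^ 2 : ℝ) : ℂ) := by
  simp [rmulCoeff, Fin.sum_univ_four]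
  ring_nf
  simp only [Complex.I_sq]
  ring

theorem hessForm_antisymm_zero {n : ℕ} (α : Fin 2) {H : Matrix (RIdx n) (RIdx n) ℝ}
    (hH : H.IsSymm) : ∑ p, ∑ q, (H p q : ℂ) • (dx α p * dx α q) = 0 := by
  have h : ∑ p, ∑ q, (H p q : ℂ) • (dx α p * dx α q) =
      -∑ p, ∑ q, (H p q : ℂ) • (dx α p * dx α q) := by
    conv_lhs => rw [Finset.sum_comm]
    simp only [← Finset.sum_neg_distrib]
    refine Finset.sum_congr rfl fun j _ => Finset.sum_congr rfl fun i _ => ?_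
    rw [dx_anticomm, smul_neg, hH.apply]
  have h2 : (2 : ℂ) • ∑ p, ∑ q, (H p q : ℂ) • (dx α p * dx α q) = 0 := by
    rw [two_smul]
    nth_rewrite 1 [h]
    simp
  simpa using h2

theorem hessForm_swap {n : ℕ} {H : Matrix (RIdx n) (RIdx n) ℝ} (hH : H.IsSymm) :
    ∑ p, ∑ q, (H p q : ℂ) • (dx 1 p * dx 0 q) = -hessForm H := by
  rw [Finset.sum_comm]
  simp only [hessForm, ← Finset.sum_neg_distrib]
  refine Finset.sum_congr rfl fun j _ => Finset.sum_congr rfl fun i _ => ?_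
  rw [dx_anticomm, smul_neg, hH.apply]

/-- The matrix of the right multiplication by a quaternion on `ℍⁿ`. -/
def rmulMat (n : ℕ) (q : Fin 4 → ℝ) : Matrix (RIdx n) (RIdx n) ℝ :=
  Matrix.of fun p a => if p.1 = a.1 then rmulMatrix q p.2 a.2 else 0

theorem rmulMat_mulVec {n : ℕ} (q : Fin 4 → ℝ) (b : RIdx n → ℝ) :
    (rmulMat n q).mulVec b = rmul q b := by
  funext p
  simp only [Matrix.mulVec, dotProduct, rmulMat, Matrix.of_apply, rmul, ite_mul, zero_mul]
  rw [Fintype.sum_prod_type, Finset.sum_eq_single p.1]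
  · simp
  · intro b _ hb
    simp [hb.symm]
  · simp

/-- Quaternionic conjugation. -/
def qconj (q : Fin 4 → ℝ) : Fin 4 → ℝ := ![q 0, -q 1, -q 2, -q 3]

/-- The adjoint of right multiplication by q is right multiplication by its conjugate. This form
lets `dLin_rmul` be applied to the rows that appear in a congruence of quadratic forms. -/
theorem rmulMat_row {n : ℕ} (q : Fin 4 → ℝ) (p : RIdx n) :
    rmulMat n q p = rmul (qconj q) (Pi.single p 1) := by
  funext a
  obtain ⟨l, k⟩ := p
  obtain ⟨l', k'⟩ := a
  simp only [rmulMat, Matrix.of_apply, rmul, Pi.single_apply, Prod.mk.injEq, Fin.sum_univ_four]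
  by_cases h : l = l'
  · subst h
    fin_cases k <;> fin_cases k' <;> simp [rmulMatrix, qconj]
  · simp [h, Ne.symm h]

theorem dLin_single {n : ℕ} (α : Fin 2) (p : RIdx n) :
    dLin α (cpx (Pi.single p 1)) = dx α p := by
  rw [dLin, Finset.sum_eq_single p]
  · simp [cpx]
  · intro b _ hb
    simp [cpx, hb]
  · simp

/-- Expanding by `dLin_rmul`, the terms of type (0,0) and (1,1) vanish because H is symmetric while
the dx anticommute. The two mixed terms combine into the determinant of the 2×2 matrix, which is
|q|². -/
theorem hessForm_rmul {n : ℕ} {H : Matrix (RIdx n) (RIdx n) ℝ} (hH : H.IsSymm) (q : Fin 4 → ℝ) :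
    hessForm ((rmulMat n q).transpose * H * rmulMat n q) =
      ((∑ k, q k ^ 2 : ℝ) : ℂ) • hessForm H := by
  have h1 : hessForm ((rmulMat n q).transpose * H * rmulMat n q) =
      ∑ p, ∑ r, (H p r : ℂ) • (dLin 0 (cpx (rmulMat n q p)) * dLin 1 (cpx (rmulMat n q r))) := by
    have : (rmulMat n q).transpose * H * rmulMat n q =
        ∑ p, ∑ r, H p r • Matrix.vecMulVec (rmulMat n q p) (rmulMat n q r) := by
      ext a b
      simp only [Matrix.mul_apply, Matrix.transpose_apply, Matrix.sum_apply, Matrix.smul_apply,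
        Matrix.vecMulVec_apply, Finset.sum_mul, smul_eq_mul]
      rw [Finset.sum_comm]
      refine Finset.sum_congr rfl fun j _ => Finset.sum_congr rfl fun i _ => ?_
      ring
    rw [this, hessForm_sum]
    refine Finset.sum_congr rfl fun p _ => ?_
    rw [hessForm_sum]
    refine Finset.sum_congr rfl fun r _ => ?_
    rw [hessForm_smul]
    congr 1
    simp only [hessForm, dLin, Finset.sum_mul_sum, Matrix.vecMulVec_apply]
    refine Finset.sum_congr rfl fun j _ => Finset.sum_congr rfl fun i _ => ?_
    rw [smul_mul_smul_comm]
    simp [cpx]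
  rw [h1]
  simp only [rmulMat_row, dLin_rmul, dLin_single]
  set g := rmulCoeff (qconj q) with hg
  have h2 : ∀ p r, (H p r : ℂ) • ((g 0 0 • dx 0 p + g 0 1 • dx 1 p) *
        (g 1 0 • dx 0 r + g 1 1 • dx 1 r)) =
      (g 0 0 * g 1 0) • ((H p r : ℂ) • (dx 0 p * dx 0 r)) +
      (g 0 0 * g 1 1) • ((H p r : ℂ) • (dx 0 p * dx 1 r)) +
      (g 0 1 * g 1 0) • ((H p r : ℂ) • (dx 1 p * dx 0 r)) +
      (g 0 1 * g 1 1) • ((H p r : ℂ) • (dx 1 p * dx 1 r)) := by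
    intro p r
    simp only [add_mul, mul_add, smul_mul_smul_comm, smul_add]
    module
  simp only [h2, Finset.sum_add_distrib, ← Finset.smul_sum, hessForm_antisymm_zero _ hH,
    hessForm_swap hH]
  have h3 := rmulCoeff_det (qconj q)
  rw [← hg] at h3
  have h4 : (∑ k, qconj q k ^ 2 : ℝ) = ∑ k, q k ^ 2 := by
    simp [qconj, Fin.sum_univ_four]
  rw [h4] at h3
  rw [← h3]
  change _ + (g 0 0 * g 1 1) • hessForm H + _ + _ = _
  module

/-! ### Nonnegative quaternionic Hessians -/

/-- The real quadratic form `H` is nonnegative in the mean on every right quaternionic line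
through the origin. -/
def LineNonneg {n : ℕ} (H : Matrix (RIdx n) (RIdx n) ℝ) : Prop :=
  ∀ w : RIdx n → ℝ, 0 ≤ ∫ q in Metric.ball (0 : EuclideanSpace ℝ (Fin 4)) 1,
    dotProduct (rmul q w) (H.mulVec (rmul q w))

theorem integrableOn_ball_of_continuous {E : Type*} [NormedAddCommGroup E]
    {f : EuclideanSpace ℝ (Fin 4) → E} (hf : Continuous f)
    (c : EuclideanSpace ℝ (Fin 4)) (R : ℝ) : IntegrableOn f (Metric.ball c R) :=
  (hf.continuousOn.integrableOn_compact (isCompact_closedBall c R)).mono_set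
    Metric.ball_subset_closedBall

theorem continuous_rmulMat_apply {n : ℕ} (p a : RIdx n) :
    Continuous fun q : EuclideanSpace ℝ (Fin 4) => rmulMat n q p a := by
  obtain ⟨l, k⟩ := p
  obtain ⟨l', k'⟩ := a
  simp only [rmulMat, Matrix.of_apply]
  by_cases h : l = l'
  · simp only [h, if_true]
    fin_cases k <;> fin_cases k' <;> simp [rmulMatrix] <;> fun_prop
  · simp only [h, if_false]
    exact continuous_const

theorem integral_normSq_ball_pos :
    0 < ∫ q in Metric.ball (0 : EuclideanSpace ℝ (Fin 4)) 1, ∑ k, q k ^ 2 := by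
  have hc : Continuous fun q : EuclideanSpace ℝ (Fin 4) => ∑ k, q k ^ 2 := by fun_prop
  rw [setIntegral_pos_iff_support_of_nonneg_ae]
  · refine (IsOpen.measure_pos volume (hc.isOpen_support.inter Metric.isOpen_ball) ?_)
    refine ⟨EuclideanSpace.single 0 (1 / 2), ?_, ?_⟩
    · simp [Fin.sum_univ_four]
    · simp
      norm_num
  · exact Eventually.of_forall fun q => Finset.sum_nonneg fun k _ => sq_nonneg _
  · exact integrableOn_ball_of_continuous hc 0 1

-- Let M be the integral of the congruent forms of H over all right multiplications in the unit
-- ball. Its 2-form is κ > 0 times that of H, and line nonnegativity of H says exactly that M is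
-- positive semidefinite. Writing M = RᵀR, the rows of R divided by √κ are the required linear
-- functions.
open scoped MatrixOrder in
theorem exists_hessForm_eq_sum_elemPos {n : ℕ} {H : Matrix (RIdx n) (RIdx n) ℝ} (hH : H.IsSymm)
    (hpos : LineNonneg H) : ∃ bs : RIdx n → RIdx n → ℝ, hessForm H = ∑ i, elemPos (bs i) := by
  classical
  let B := Metric.ball (0 : EuclideanSpace ℝ (Fin 4)) 1
  let Q : EuclideanSpace ℝ (Fin 4) → Matrix (RIdx n) (RIdx n) ℝ :=
    fun q => (rmulMat n q).transpose * H * rmulMat n q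
  have hQc : ∀ a b, Continuous fun q => Q q a b := by
    intro a b
    simp only [Q, Matrix.mul_apply, Matrix.transpose_apply]
    have := @continuous_rmulMat_apply n
    fun_prop
  have hQi : ∀ a b, IntegrableOn (fun q => Q q a b) B := fun a b =>
    integrableOn_ball_of_continuous (hQc a b) 0 1
  let M : Matrix (RIdx n) (RIdx n) ℝ := Matrix.of fun a b => ∫ q in B, Q q a b
  set κ : ℝ := ∫ q in B, ∑ k, q k ^ 2 with hκ
  have hκpos : 0 < κ := integral_normSq_ball_pos
  have hM : hessForm M = (κ : ℂ) • hessForm H := by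
    refine LinearMap.ext fun f => funext fun J => ?_
    have e1 : ∀ G : Matrix (RIdx n) (RIdx n) ℝ, hessForm G f J =
        ∑ p, ∑ q, (G p q : ℂ) * (dx 0 p * dx 1 q) f J := by
      intro G
      simp [hessForm, LinearMap.sum_apply, Finset.sum_apply]
    have e2 : ∀ q, hessForm (Q q) f J = ((∑ k, q k ^ 2 : ℝ) : ℂ) * hessForm H f J := by
      intro q
      rw [hessForm_rmul hH]
      rfl
    rw [e1]
    have e3 : ∀ a b, ((M a b : ℝ) : ℂ) * (dx 0 a * dx 1 b) f J =
        ∫ q in B, (Q q a b : ℂ) * (dx 0 a * dx 1 b) f J := by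
      intro a b
      rw [integral_mul_const, integral_complex_ofReal]
      rfl
    simp only [e3]
    have hi : ∀ a b, Integrable (fun q => (Q q a b : ℂ) * (dx 0 a * dx 1 b) f J)
        (volume.restrict B) := fun a b => ((hQi a b).ofReal).mul_const _
    simp_rw [← integral_finsetSum Finset.univ fun b _ => hi _ b]
    rw [← integral_finsetSum Finset.univ fun a _ => integrable_finsetSum _ fun b _ => hi a b]
    simp_rw [← e1, e2]
    rw [integral_mul_const, integral_complex_ofReal]
    rfl
  have hMpsd : M.PosSemidef := by
    refine Matrix.PosSemidef.of_dotProduct_mulVec_nonneg ?_ ?_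
    · ext a b
      simp only [Matrix.conjTranspose_apply, M, Matrix.of_apply, star_trivial]
      refine integral_congr_ae (Eventually.of_forall fun q => ?_)
      have : (Q q).transpose = Q q := by
        simp only [Q, Matrix.transpose_mul, Matrix.transpose_transpose, hH.eq, Matrix.mul_assoc]
      exact congrFun (congrFun this a) b
    · intro w
      have e : dotProduct (star w) (M.mulVec w) =
          ∫ q in B, dotProduct (rmul q w) (H.mulVec (rmul q w)) := by
        have e4 : ∀ q : EuclideanSpace ℝ (Fin 4), dotProduct (rmul q w) (H.mulVec (rmul q w)) =
            ∑ a, ∑ b, w a * (Q q a b * w b) := by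
          intro q
          have e5 : dotProduct (rmul q w) (H.mulVec (rmul q w)) =
              dotProduct w ((Q q).mulVec w) := by
            simp only [Q]
            rw [← rmulMat_mulVec, ← Matrix.mulVec_mulVec, ← Matrix.mulVec_mulVec,
              Matrix.dotProduct_mulVec w, Matrix.vecMul_transpose]
          rw [e5]
          simp [dotProduct, Matrix.mulVec, Finset.mul_sum]
        simp_rw [e4]
        have hi : ∀ a b, Integrable (fun q => w a * (Q q a b * w b)) (volume.restrict B) :=
          fun a b => ((hQi a b).mul_const _).const_mul _
        rw [integral_finsetSum Finset.univ fun a _ => integrable_finsetSum _ fun b _ => hi a b]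
        simp_rw [integral_finsetSum Finset.univ fun b _ => hi _ b, integral_const_mul,
          integral_mul_const]
        simp [dotProduct, Matrix.mulVec, Finset.mul_sum, M]
      rw [e]
      exact hpos w
  obtain ⟨R, hR⟩ := CStarAlgebra.nonneg_iff_eq_star_mul_self.mp hMpsd.nonneg
  refine ⟨fun i => (Real.sqrt κ)⁻¹ • R i, ?_⟩
  have hH2 : hessForm H = hessForm (κ⁻¹ • M) := by
    rw [hessForm_smul, hM, smul_smul]
    have : (κ : ℂ) ≠ 0 := by exact_mod_cast hκpos.ne'
    simp [this]
  rw [hH2]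
  simp only [elemPos_eq_hessForm]
  rw [← hessForm_sum]
  congr 1
  ext a b
  simp only [hR, Matrix.smul_apply, Matrix.mul_apply, Matrix.star_eq_conjTranspose,
    Matrix.conjTranspose_apply, star_trivial,
    smul_eq_mul, Finset.mul_sum, Matrix.sum_apply, Matrix.vecMulVec_apply, Pi.smul_apply]
  refine Finset.sum_congr rfl fun i _ => ?_
  have hs : (Real.sqrt κ)⁻¹ * (Real.sqrt κ)⁻¹ = κ⁻¹ := by
    rw [← mul_inv, Real.mul_self_sqrt hκpos.le]
  rw [← hs]
  ring

/-! ### Positivity of products of elementary positive forms -/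

theorem cpx_sub {n : ℕ} (b c : RIdx n → ℝ) : cpx (b - c) = cpx b + (-1 : ℂ) • cpx c := by
  funext p
  simp [cpx, sub_eq_add_neg]

theorem elemPos_commute_dLin {n : ℕ} (b : RIdx n → ℝ) (α : Fin 2) (c : RIdx n → ℂ) :
    Commute (elemPos b) (dLin α c) :=
  commute_mul_of_anticomm (dLin_anticomm _ _ _ _) (dLin_anticomm _ _ _ _)

theorem mul_mul_self_of_anticomm {R : Type*} [Ring R] {a b : R} (hba : b * a = -(a * b))
    (haa : a * a = 0) : a * b * a = 0 := by
  rw [mul_assoc, hba, mul_neg, ← mul_assoc, haa, zero_mul, neg_zero]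

theorem elemPos_mul_dLin_self {n : ℕ} (b : RIdx n → ℝ) (α : Fin 2) :
    elemPos b * dLin α (cpx b) = 0 := by
  fin_cases α
  · change dLin 0 (cpx b) * dLin 1 (cpx b) * dLin 0 (cpx b) = 0
    exact mul_mul_self_of_anticomm (dLin_anticomm _ _ _ _) (dLin_mul_self _ _)
  · change dLin 0 (cpx b) * dLin 1 (cpx b) * dLin 1 (cpx b) = 0
    rw [mul_assoc, dLin_mul_self, mul_zero]

/-- The subtracted term lies in the span of d₀ℓ and d₁ℓ for the linear function ℓ with coefficients
b, and the factor d₀ℓ ∧ d₁ℓ annihilates both. This is the elimination step: right multiples of a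
pivot may be subtracted from the other factors. -/
theorem elemPos_mul_dLin_sub_rmul {n : ℕ} (b x : RIdx n → ℝ) (q : Fin 4 → ℝ) (α : Fin 2) :
    elemPos b * dLin α (cpx (x - rmul q b)) = elemPos b * dLin α (cpx x) := by
  rw [cpx_sub, dLin_add, dLin_smul, dLin_rmul]
  simp only [mul_add, mul_smul_comm, elemPos_mul_dLin_self, smul_zero, add_zero]

theorem elemPos_mul_elemPos_sub_rmul {n : ℕ} (b x : RIdx n → ℝ) (q : Fin 4 → ℝ) :
    elemPos b * elemPos (x - rmul q b) = elemPos b * elemPos x := by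
  conv_lhs => rw [elemPos.eq_def (x - rmul q b)]
  rw [← mul_assoc, elemPos_mul_dLin_sub_rmul, (elemPos_commute_dLin _ _ _).eq, mul_assoc,
    elemPos_mul_dLin_sub_rmul, ← mul_assoc, ← (elemPos_commute_dLin _ _ _).eq, mul_assoc]
  rfl

theorem elemPos_mul_prod_sub_rmul {n : ℕ} (b : RIdx n → ℝ) (q : (RIdx n → ℝ) → Fin 4 → ℝ)
    (bs : List (RIdx n → ℝ)) :
    elemPos b * ((bs.map fun x => x - rmul (q x) b).map elemPos).prod =
      elemPos b * (bs.map elemPos).prod := by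
  induction bs with
  | nil => rfl
  | cons x xs ih =>
    simp only [List.map_cons, List.prod_cons]
    rw [← mul_assoc, elemPos_mul_elemPos_sub_rmul, (elemPos_commute b x).eq, mul_assoc, ih,
      ← mul_assoc, ← (elemPos_commute b x).eq, mul_assoc]

theorem exists_rmul_eq {n : ℕ} (b x : RIdx n → ℝ) (l : Fin n) (hb : ∃ m, b (l, m) ≠ 0) :
    ∃ q, ∀ m, rmul q b (l, m) = x (l, m) := by
  set N := ∑ m, b (l, m) ^ 2 with hN
  have hN0 : N ≠ 0 := by
    obtain ⟨m, hm⟩ := hb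
    have : 0 < N := Finset.sum_pos' (fun _ _ => sq_nonneg _) ⟨m, Finset.mem_univ _, by positivity⟩
    exact this.ne'
  rw [Fin.sum_univ_four] at hN
  -- The components of q = b̄ₗ xₗ / |bₗ|², the solution of bₗ q = xₗ.
  refine ⟨fun k => (![b (l, 0) * x (l, 0) + b (l, 1) * x (l, 1) + b (l, 2) * x (l, 2) +
        b (l, 3) * x (l, 3),
      b (l, 0) * x (l, 1) - b (l, 1) * x (l, 0) - b (l, 2) * x (l, 3) + b (l, 3) * x (l, 2),
      b (l, 0) * x (l, 2) + b (l, 1) * x (l, 3) - b (l, 2) * x (l, 0) - b (l, 3) * x (l, 1),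
      b (l, 0) * x (l, 3) - b (l, 1) * x (l, 2) + b (l, 2) * x (l, 1) - b (l, 3) * x (l, 0)] :
        Fin 4 → ℝ) k / N, fun m => ?_⟩
  simp only [rmul, Fin.sum_univ_four]
  fin_cases m <;> simp [rmulMatrix] <;> field_simp <;> rw [hN] <;> ring

/-- The first `2k` indices. -/
def firstIdx (n k : ℕ) : Finset (Fin (n * 2)) := Finset.univ.filter fun j => j.val < 2 * k

theorem even_card_firstIdx {n k : ℕ} (hk : k ≤ n) : Even (firstIdx n k).card := by
  have : (firstIdx n k).card = 2 * k := by
    rw [firstIdx, Fin.card_filter_val_lt]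
    omega
  rw [this]
  exact even_two_mul k

/-- The forms ω^j with j < 2k are already present, and those with j ≥ 2k + 2 do not occur in dℓ.
Only the 2×2 determinant of the coefficients of ω^(2k), ω^(2k+1) remains, and it equals the squared
norm of the k-th quaternionic coordinate of b. -/
theorem elemPos_omega_firstIdx {n k : ℕ} (hk : k < n) (b : RIdx n → ℝ)
    (hb : ∀ p : RIdx n, k < p.1.val → b p = 0) :
    elemPos b (omega (firstIdx n k)) =
      ((∑ m, b (⟨k, hk⟩, m) ^ 2 : ℝ) : ℂ) • omega (firstIdx n (k + 1)) := by
  let j₀ : Fin (n * 2) := ⟨2 * k, by omega⟩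
  let j₁ : Fin (n * 2) := ⟨2 * k + 1, by omega⟩
  let ξ : Fin 2 → Fin (n * 2) → ℂ := fun α j => ∑ p, nablaCoeff α j p * cpx b p
  have hne : j₀ ≠ j₁ := by simp [j₀, j₁]
  have hξ : ∀ α j, 2 * k + 2 ≤ j.val → ξ α j = 0 := by
    intro α j hj
    simp only [ξ, sum_nablaCoeff_mul, cpx]
    refine Finset.sum_eq_zero fun m _ => ?_
    rw [hb]
    · simp
    · simp only [Fin.coe_divNat]; omega
  have hkill : ∀ j : Fin (n * 2), j.val < 2 * k → extMul j (omega (firstIdx n k)) = 0 :=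
    fun j hj => extMul_omega_of_mem (by simp [firstIdx, hj])
  have hd : ∀ α, ∀ v : Lam n, (∀ j : Fin (n * 2), j.val < 2 * k → extMul j v = 0) →
      dLin α (cpx b) v = ξ α j₀ • extMul j₀ v + ξ α j₁ • extMul j₁ v := by
    intro α v hv
    rw [dLin_eq_sum_extMul, LinearMap.sum_apply]
    simp only [LinearMap.smul_apply]
    rw [← Finset.sum_subset (Finset.subset_univ {j₀, j₁}), Finset.sum_pair hne]
    intro j _ hj
    simp only [Finset.mem_insert, Finset.mem_singleton, not_or, Fin.ext_iff, j₀, j₁] at hj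
    rcases lt_or_ge j.val (2 * k) with h | h
    · rw [hv j h, smul_zero]
    · change ξ α j • _ = 0
      rw [hξ α j (by omega), zero_smul]
  have hanti : ∀ i j : Fin (n * 2), ∀ v : Lam n, extMul i (extMul j v) = -extMul j (extMul i v) :=
    fun i j v => LinearMap.congr_fun (extMul_anticomm i j) v
  have hkill2 : ∀ i, ∀ j : Fin (n * 2), j.val < 2 * k →
      extMul j (extMul i (omega (firstIdx n k))) = 0 := by
    intro i j hj
    rw [hanti, hkill j hj, map_zero, neg_zero]
  have hself : ∀ i : Fin (n * 2), ∀ v : Lam n, extMul i (extMul i v) = 0 :=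
    fun i v => LinearMap.congr_fun (extMul_mul_self i) v
  have hvol : extMul j₀ (extMul j₁ (omega (firstIdx n k))) = omega (firstIdx n (k + 1)) := by
    have h1 : (firstIdx n k).filter (· < j₁) = firstIdx n k := by
      refine Finset.filter_true_of_mem fun j hj => ?_
      simp only [firstIdx, Finset.mem_filter] at hj
      simp only [Fin.lt_def, j₁]; omega
    have h2 : (insert j₁ (firstIdx n k)).filter (· < j₀) = firstIdx n k := by
      ext j
      simp only [firstIdx, Finset.mem_filter, Finset.mem_insert, Finset.mem_univ, true_and,
        Fin.lt_def, Fin.ext_iff, j₀, j₁]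
      omega
    have h3 : insert j₀ (insert j₁ (firstIdx n k)) = firstIdx n (k + 1) := by
      ext j
      simp only [firstIdx, Finset.mem_filter, Finset.mem_insert, Finset.mem_univ, true_and,
        Fin.ext_iff, j₀, j₁]
      omega
    rw [extMul_omega_of_notMem (by simp [firstIdx, j₁]), map_smul,
      extMul_omega_of_notMem (by simp [firstIdx, j₁, j₀]), h1, h2, h3,
      (even_card_firstIdx hk.le).neg_one_pow, one_smul, one_smul]
  rw [elemPos, Module.End.mul_apply, hd 1 _ hkill, map_add, map_smul, map_smul,
    hd 0 _ (hkill2 j₀), hd 0 _ (hkill2 j₁), hself, hself, hanti j₁ j₀, hvol]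
  have hdiv0 : j₀.divNat = ⟨k, hk⟩ := by ext; simp [j₀]
  have hdiv1 : j₁.divNat = ⟨k, hk⟩ := by ext; simp only [j₁, Fin.coe_divNat]; omega
  have hmod0 : j₀.modNat = 0 := by ext; simp [j₀]
  have hmod1 : j₁.modNat = 1 := by ext; simp [j₁, Nat.add_mod]
  have hcoef : ξ 0 j₀ * ξ 1 j₁ - ξ 0 j₁ * ξ 1 j₀ = ((∑ m, b (⟨k, hk⟩, m) ^ 2 : ℝ) : ℂ) := by
    simp only [ξ, sum_nablaCoeff_mul, hdiv0, hdiv1, hmod0, hmod1, cpx, Fin.sum_univ_four]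
    simp [blockCoeff]
    ring_nf
    simp only [Complex.I_sq]
    ring
  rw [← hcoef]
  module

/-- Gaussian elimination over ℍ, by induction on the number of quaternionic variables involved. A
factor with nonzero last coordinate serves as pivot: subtracting right multiples of it clears the
last variable from the other factors without changing the product. The rest is covered by induction,
and the pivot contributes a nonnegative factor. -/
theorem prod_elemPos_omega_firstIdx {n : ℕ} (k : ℕ) (hk : k ≤ n) (bs : List (RIdx n → ℝ))
    (hlen : bs.length = k) (hbs : ∀ b ∈ bs, ∀ p : RIdx n, k ≤ p.1.val → b p = 0) :
    ∃ c : ℝ, 0 ≤ c ∧ (bs.map elemPos).prod (omega ∅) = (c : ℂ) • omega (firstIdx n k) := by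
  induction k generalizing bs with
  | zero =>
    refine ⟨1, zero_le_one, ?_⟩
    rw [List.length_eq_zero_iff.mp hlen]
    simp [firstIdx]
  | succ k ih =>
    have hkn : k < n := hk
    -- it suffices to treat a list whose tail does not involve the last coordinate
    have key : ∀ b : RIdx n → ℝ, ∀ rest : List (RIdx n → ℝ), rest.length = k →
        (∀ p : RIdx n, k < p.1.val → b p = 0) →
        (∀ x ∈ rest, ∀ p : RIdx n, k ≤ p.1.val → x p = 0) →
        ∃ c : ℝ, 0 ≤ c ∧ (elemPos b * (rest.map elemPos).prod) (omega ∅) =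
          (c : ℂ) • omega (firstIdx n (k + 1)) := by
      intro b rest hl hb hrest
      obtain ⟨c, hc, h⟩ := ih hkn.le rest hl hrest
      refine ⟨c * ∑ m, b (⟨k, hkn⟩, m) ^ 2,
        mul_nonneg hc (Finset.sum_nonneg fun _ _ => sq_nonneg _), ?_⟩
      rw [Module.End.mul_apply, h, map_smul, elemPos_omega_firstIdx hkn b hb, smul_smul,
        Complex.ofReal_mul]
    -- Without a pivot any factor may be split off; it then contributes the factor 0.
    by_cases hz : ∀ b ∈ bs, ∀ m, b (⟨k, hkn⟩, m) = 0
    · obtain ⟨b, rest, rfl⟩ := List.exists_cons_of_length_eq_add_one hlen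
      rw [List.map_cons, List.prod_cons]
      refine key b rest (by simpa using hlen) (fun p hp => hbs b (by simp) p hp) ?_
      intro x hx p hp
      rcases hp.eq_or_lt with h | h
      · have := hz x (by simp [hx]) p.2
        rwa [show (⟨k, hkn⟩ : Fin n) = p.1 from Fin.ext h] at this
      · exact hbs x (by simp [hx]) p h
    · push Not at hz
      obtain ⟨b, hb, m, hm⟩ := hz
      classical
      have hperm := List.perm_cons_erase hb
      have hprod : (bs.map elemPos).prod = elemPos b * ((bs.erase b).map elemPos).prod := by
        rw [← List.prod_cons, ← List.map_cons]
        refine (hperm.map elemPos).prod_eq' ?_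
        refine List.pairwise_map.mpr (List.pairwise_of_forall fun x y => ?_)
        exact elemPos_commute x y
      choose q hq using fun x => exists_rmul_eq b x ⟨k, hkn⟩ ⟨m, hm⟩
      rw [hprod, ← elemPos_mul_prod_sub_rmul b q]
      refine key b _ ?_ (fun p hp => hbs b hb p hp) ?_
      · rw [List.length_map, List.length_erase_of_mem hb, hlen]; rfl
      · intro y hy p hp
        obtain ⟨x, hx, rfl⟩ := List.mem_map.mp hy
        rcases hp.eq_or_lt with h | h
        · have := hq x p.2
          rw [show (⟨k, hkn⟩ : Fin n) = p.1 from Fin.ext h] at this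
          simp [this]
        · have h1 := hbs x (List.mem_of_mem_erase hx) p h
          have h2 : rmul (q x) b p = 0 := by
            refine Finset.sum_eq_zero fun m _ => ?_
            rw [hbs b hb (p.1, m) h, mul_zero]
          simp [h1, h2]

theorem prod_elemPos_nonneg {n : ℕ} (bs : List (RIdx n → ℝ)) (hlen : bs.length = n) :
    ∃ c : ℝ, 0 ≤ c ∧ (bs.map elemPos).prod (omega ∅) Finset.univ = c := by
  obtain ⟨c, hc, h⟩ := prod_elemPos_omega_firstIdx n le_rfl bs hlen
    (fun b _ p hp => absurd p.1.2 (not_lt.mpr hp))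
  refine ⟨c, hc, ?_⟩
  have : firstIdx n n = Finset.univ := by
    refine Finset.filter_true_of_mem fun j _ => ?_
    have := j.2
    omega
  rw [h, this]
  simp [omega]

/-- The general factors are converted one at a time into sums of elementary ones. The list `bs` of
factors already converted is carried along so that the induction closes. -/
theorem prod_hessForm_mul_prod_elemPos_nonneg {n : ℕ} (Hs : List (Matrix (RIdx n) (RIdx n) ℝ))
    (hHs : ∀ H ∈ Hs, H.IsSymm ∧ LineNonneg H) (bs : List (RIdx n → ℝ))
    (hlen : Hs.length + bs.length = n) :
    ∃ c : ℝ, 0 ≤ c ∧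
      ((Hs.map hessForm).prod * (bs.map elemPos).prod) (omega ∅) Finset.univ = c := by
  induction Hs generalizing bs with
  | nil => simpa using prod_elemPos_nonneg bs (by simpa using hlen)
  | cons H Hs ih =>
    obtain ⟨b, hb⟩ := exists_hessForm_eq_sum_elemPos (hHs H (by simp)).1 (hHs H (by simp)).2
    choose c hc hceq using fun i => ih (fun H hH => hHs H (by simp [hH])) (b i :: bs)
      (by simp only [List.length_cons] at hlen ⊢; omega)
    refine ⟨∑ i, c i, Finset.sum_nonneg fun i _ => hc i, ?_⟩
    have hcomm : Commute (hessForm H) (Hs.map hessForm).prod :=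
      Commute.list_prod_right _ _ fun x hx => by
        obtain ⟨G, _, rfl⟩ := List.mem_map.mp hx
        exact hessForm_commute H G
    rw [List.map_cons, List.prod_cons, hcomm.eq, mul_assoc, hb, Finset.sum_mul, Finset.mul_sum,
      LinearMap.sum_apply, Finset.sum_apply, Complex.ofReal_sum]
    refine Finset.sum_congr rfl fun i _ => ?_
    rw [← hceq i, List.map_cons, List.prod_cons]

/-- The product of `n` nonnegative 2-forms is nonnegative. -/
theorem prod_hessForm_nonneg {n : ℕ} (Hs : List (Matrix (RIdx n) (RIdx n) ℝ))
    (hHs : ∀ H ∈ Hs, H.IsSymm ∧ LineNonneg H) (hlen : Hs.length = n) :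
    ∃ c : ℝ, 0 ≤ c ∧ (Hs.map hessForm).prod (omega ∅) Finset.univ = c := by
  simpa using prod_hessForm_mul_prod_elemPos_nonneg Hs hHs [] (by simpa using hlen)

/-! ### Elementary positive forms span -/

/-- Polarization of the quadratic map b ↦ `elemPos b`. -/
theorem dx_mul_add_mem_span {n : ℕ} (p q : RIdx n) :
    dx 0 p * dx 1 q + dx 0 q * dx 1 p ∈
      Submodule.span ℂ (Set.range (elemPos : (RIdx n → ℝ) → Module.End ℂ (Lam n))) := by
  have h : dx 0 p * dx 1 q + dx 0 q * dx 1 p =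
      elemPos (Pi.single p 1 + Pi.single q 1) - elemPos (Pi.single p 1) -
        elemPos (Pi.single q 1) := by
    have : cpx (Pi.single p 1 + Pi.single q 1 : RIdx n → ℝ) =
        cpx (Pi.single p 1) + cpx (Pi.single q 1) := by
      funext r; simp [cpx]
    simp only [elemPos, this, dLin_add, dLin_single]
    noncomm_ring
  rw [h]
  exact Submodule.sub_mem _ (Submodule.sub_mem _ (Submodule.subset_span ⟨_, rfl⟩)
    (Submodule.subset_span ⟨_, rfl⟩)) (Submodule.subset_span ⟨_, rfl⟩)

-- In one quaternionic variable the four covectors `blockCoeff α m` form a basis of ℂ⁴. The explicit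
-- vectors in the proof are the dual basis, supported in the block containing j.
set_option linter.unnecessarySeqFocus false in
theorem exists_dLin_eq_extMul {n : ℕ} (j : Fin (n * 2)) :
    (∃ z : RIdx n → ℂ, dLin 0 z = extMul j ∧ dLin 1 z = 0) ∧
      (∃ z : RIdx n → ℂ, dLin 1 z = extMul j ∧ dLin 0 z = 0) := by
  have hext : ∀ c : Fin (n * 2) → ℂ, (∀ i, c i = if i = j then 1 else 0) →
      ∑ i, c i • extMul i = extMul j := by
    intro c hc
    simp [hc]
  have hzero : ∀ c : Fin (n * 2) → ℂ, (∀ i, c i = 0) →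
      ∑ i, c i • (extMul i : Module.End ℂ (Lam n)) = 0 := by
    intro c hc
    simp [hc]
  have hval : ∀ (α : Fin 2) (i : Fin (n * 2)) (v : Fin 4 → ℂ),
      ∑ p : RIdx n, nablaCoeff α i p * (if p.1 = j.divNat then v p.2 else 0) =
        if i.divNat = j.divNat then ∑ k, blockCoeff α i.modNat k * v k else 0 := by
    intro α i v
    rw [sum_nablaCoeff_mul]
    split_ifs <;> simp_all
  have hij : ∀ i : Fin (n * 2), i = j ↔ i.divNat = j.divNat ∧ i.modNat = j.modNat := by
    intro i
    simp only [Fin.ext_iff, Fin.coe_divNat, Fin.coe_modNat]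
    omega
  have main : ∀ (α : Fin 2) (v : Fin 4 → ℂ),
      (∀ m, ∑ k, blockCoeff α m k * v k = if m = j.modNat then 1 else 0) →
      (∀ β m, β ≠ α → ∑ k, blockCoeff β m k * v k = 0) →
      ∃ z : RIdx n → ℂ, dLin α z = extMul j ∧ ∀ β ≠ α, dLin β z = 0 := by
    intro α v h1 h2
    refine ⟨fun p => if p.1 = j.divNat then v p.2 else 0, ?_, fun β hβ => ?_⟩
    · rw [dLin_eq_sum_extMul]
      refine hext _ fun i => ?_
      rw [hval, h1]
      simp only [hij]
      split_ifs <;> simp_all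
    · rw [dLin_eq_sum_extMul]
      refine hzero _ fun i => ?_
      rw [hval, h2 β _ hβ, ite_self]
  generalize hm : j.modNat = m at main
  constructor
  · obtain ⟨z, h1, h2⟩ : ∃ z : RIdx n → ℂ, dLin 0 z = extMul j ∧ ∀ β ≠ 0, dLin β z = 0 := by
      fin_cases m
      · refine main 0 ![1 / 2, -Complex.I / 2, 0, 0] ?_ ?_
        · intro m
          fin_cases m <;> simp [blockCoeff, Fin.sum_univ_four] <;> ring_nf <;>
            simp <;> norm_num
        · intro β m hβ
          fin_cases β <;> fin_cases m <;> simp [blockCoeff, Fin.sum_univ_four] at hβ ⊢ <;>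
            ring_nf <;> simp
      · refine main 0 ![0, 0, 1 / 2, Complex.I / 2] ?_ ?_
        · intro m
          fin_cases m <;> simp [blockCoeff, Fin.sum_univ_four] <;> ring_nf <;>
            simp <;> norm_num
        · intro β m hβ
          fin_cases β <;> fin_cases m <;> simp [blockCoeff, Fin.sum_univ_four] at hβ ⊢ <;>
            ring_nf <;> simp
    exact ⟨z, h1, h2 1 (by simp)⟩
  · obtain ⟨z, h1, h2⟩ : ∃ z : RIdx n → ℂ, dLin 1 z = extMul j ∧ ∀ β ≠ 1, dLin β z = 0 := by
      fin_cases m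
      · refine main 1 ![0, 0, -1 / 2, Complex.I / 2] ?_ ?_
        · intro m
          fin_cases m <;> simp [blockCoeff, Fin.sum_univ_four] <;> ring_nf <;>
            simp <;> norm_num
        · intro β m hβ
          fin_cases β <;> fin_cases m <;> simp [blockCoeff, Fin.sum_univ_four] at hβ ⊢ <;>
            ring_nf <;> simp
      · refine main 1 ![1 / 2, Complex.I / 2, 0, 0] ?_ ?_
        · intro m
          fin_cases m <;> simp [blockCoeff, Fin.sum_univ_four] <;> ring_nf <;>
            simp <;> norm_num
        · intro β m hβ
          fin_cases β <;> fin_cases m <;> simp [blockCoeff, Fin.sum_univ_four] at hβ ⊢ <;>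
            ring_nf <;> simp
    exact ⟨z, h1, h2 0 (by simp)⟩

/-- Choose complex linear functions z, w with d₀z = ω^j, d₁z = 0 and d₁w = ω^k. In the symmetrized
product the term d₀w ∧ d₁z vanishes, so ω^j ∧ ω^k is a combination of the symmetric expressions of
`dx_mul_add_mem_span`. -/
theorem extMul_mul_extMul_mem_span {n : ℕ} (j k : Fin (n * 2)) :
    extMul j * extMul k ∈
      Submodule.span ℂ (Set.range (elemPos : (RIdx n → ℝ) → Module.End ℂ (Lam n))) := by
  obtain ⟨z, hz0, hz1⟩ := (exists_dLin_eq_extMul j).1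
  obtain ⟨w, hw1, hw0⟩ := (exists_dLin_eq_extMul k).2
  have h : extMul j * extMul k =
      ∑ p, ∑ q, (z p * w q) • (dx 0 p * dx 1 q + dx 0 q * dx 1 p) := by
    have h1 : ∑ p, ∑ q, (z p * w q) • (dx 0 p * dx 1 q) = dLin 0 z * dLin 1 w := by
      simp only [dLin, Finset.sum_mul_sum, smul_mul_smul_comm]
    have h2 : ∑ p, ∑ q, (z p * w q) • (dx 0 q * dx 1 p) = dLin 0 w * dLin 1 z := by
      rw [Finset.sum_comm]
      simp only [dLin, Finset.sum_mul_sum, smul_mul_smul_comm]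
      refine Finset.sum_congr rfl fun p _ => Finset.sum_congr rfl fun q _ => ?_
      rw [mul_comm (z q)]
    simp only [smul_add, Finset.sum_add_distrib, h1, h2, hz0, hz1, hw1]
    simp
  rw [h]
  exact Submodule.sum_mem _ fun p _ => Submodule.sum_mem _ fun q _ =>
    Submodule.smul_mem _ _ (dx_mul_add_mem_span p q)

/-- The products of `m` elementary positive forms. -/
def elemProducts (n m : ℕ) : Set (Lam n) :=
  {v | ∃ bs : List (RIdx n → ℝ), bs.length = m ∧ v = (bs.map elemPos).prod (omega ∅)}

theorem omega_mem_span_elemProducts {n : ℕ} (m : ℕ) (I : Finset (Fin (n * 2)))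
    (hI : I.card = 2 * m) : omega I ∈ Submodule.span ℂ (elemProducts n m) := by
  induction m generalizing I with
  | zero =>
    rw [Finset.card_eq_zero.mp hI]
    exact Submodule.subset_span ⟨[], rfl, rfl⟩
  | succ m ih =>
    obtain ⟨j, hj⟩ : I.Nonempty := Finset.card_pos.mp (by omega)
    have h1 : (I.erase j).card = 2 * m + 1 := by rw [Finset.card_erase_of_mem hj]; omega
    obtain ⟨k, hk⟩ : (I.erase j).Nonempty := Finset.card_pos.mp (by omega)
    have h2 : ((I.erase j).erase k).card = 2 * m := by rw [Finset.card_erase_of_mem hk]; omega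
    have step : ∀ A ∈ Submodule.span ℂ
        (Set.range (elemPos : (RIdx n → ℝ) → Module.End ℂ (Lam n))),
        ∀ v ∈ Submodule.span ℂ (elemProducts n m),
        A v ∈ Submodule.span ℂ (elemProducts n (m + 1)) := by
      intro A hA v hv
      induction hA using Submodule.span_induction with
      | mem A hA =>
        obtain ⟨b, rfl⟩ := hA
        induction hv using Submodule.span_induction with
        | mem v hv =>
          obtain ⟨bs, hl, rfl⟩ := hv
          exact Submodule.subset_span ⟨b :: bs, by simp [hl], by simp⟩
        | zero => simp
        | add x y _ _ hx hy => rw [map_add]; exact Submodule.add_mem _ hx hy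
        | smul a x _ hx => rw [map_smul]; exact Submodule.smul_mem _ _ hx
      | zero => simp
      | add x y _ _ hx hy => exact Submodule.add_mem _ hx hy
      | smul a x _ hx => exact Submodule.smul_mem _ _ hx
    have h3 := step _ (extMul_mul_extMul_mem_span j k) _ (ih _ h2)
    have h4 : (extMul j * extMul k) (omega ((I.erase j).erase k)) =
        ((-1 : ℂ) ^ (((I.erase j).erase k).filter (· < k)).card *
          (-1) ^ ((I.erase j).filter (· < j)).card) • omega I := by
      rw [Module.End.mul_apply, extMul_omega_of_notMem (by simp), Finset.insert_erase hk,
        map_smul, extMul_omega_of_notMem (by simp), Finset.insert_erase hj, smul_smul]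
    rw [h4] at h3
    refine (Submodule.smul_mem_iff _ ?_).mp h3
    exact mul_ne_zero (pow_ne_zero _ (by norm_num)) (pow_ne_zero _ (by norm_num))

/-- Every form of degree `2m` is a combination of products of elementary positive forms, with
coefficients which are multiples of the coefficients of the form. -/
theorem exists_elemProducts_decomposition (n m : ℕ) :
    ∃ (ι : Type) (_ : Fintype ι) (idx : ι → Finset (Fin (n * 2))) (c : ι → ℂ)
      (bs : ι → List (RIdx n → ℝ)), (∀ s, (bs s).length = m) ∧ (∀ s, (idx s).card = 2 * m) ∧
      ∀ v : Lam n, (∀ I, I.card ≠ 2 * m → v I = 0) →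
        v = ∑ s, (c s * v (idx s)) • ((bs s).map elemPos).prod (omega ∅) := by
  have hex : ∀ I : {I : Finset (Fin (n * 2)) // I.card = 2 * m}, ∃ (N : ℕ) (f : Fin N → ℂ)
      (g : Fin N → List (RIdx n → ℝ)), (∀ i, (g i).length = m) ∧
      omega I.1 = ∑ i, f i • ((g i).map elemPos).prod (omega ∅) := by
    intro I
    obtain ⟨N, f, g, h⟩ :=
      Submodule.mem_span_set'.mp (omega_mem_span_elemProducts m I.1 I.2)
    choose b hb hb2 using fun i => (g i).2
    exact ⟨N, f, b, hb, by rw [← h]; exact Finset.sum_congr rfl fun i _ => by rw [hb2]⟩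
  choose N f g hg h using hex
  refine ⟨Σ I : {I : Finset (Fin (n * 2)) // I.card = 2 * m}, Fin (N I), inferInstance,
    fun s => s.1.1, fun s => f s.1 s.2, fun s => g s.1 s.2, fun s => hg s.1 s.2,
    fun s => s.1.2, fun v hv => ?_⟩
  rw [Fintype.sum_sigma]
  have h1 : ∀ I : {I : Finset (Fin (n * 2)) // I.card = 2 * m},
      ∑ i, (f I i * v I.1) • ((g I i).map elemPos).prod (omega ∅) = v I.1 • omega I.1 := by
    intro I
    rw [h I, Finset.smul_sum]
    refine Finset.sum_congr rfl fun i _ => ?_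
    rw [smul_smul, mul_comm (f I i)]
  simp only [h1]
  have h2 : v = ∑ I, v I • omega I := by
    funext J
    simp [omega, Finset.sum_apply, Pi.single_apply]
  conv_lhs => rw [h2]
  rw [← Finset.sum_filter_of_ne (p := fun I : Finset (Fin (n * 2)) => I.card = 2 * m)]
  · exact Finset.sum_subtype _ (by simp) _
  · intro I _ hI
    by_contra hc
    exact hI (by rw [hv I hc, zero_smul])

/-! ### Partial derivatives of vector valued functions -/

section Partial

variable {n : ℕ} {E : Type*} [NormedAddCommGroup E] [NormedSpace ℝ E]

/-- The partial derivative `∂_p F`. -/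
def pd (p : RIdx n) (F : HSpace n → E) (x : HSpace n) : E :=
  fderiv ℝ F x (EuclideanSpace.single p 1)

theorem ContDiff.pd {F : HSpace n → E} (hF : ContDiff ℝ ∞ F) (p : RIdx n) :
    ContDiff ℝ ∞ (pd p F) := by
  unfold QuatPluri.pd
  exact (hF.fderiv_right (m := ∞) le_rfl).clm_apply contDiff_const

theorem pd_comm {F : HSpace n → E} (hF : ContDiff ℝ ∞ F) (p q : RIdx n) (x : HSpace n) :
    pd p (pd q F) x = pd q (pd p F) x := by
  have hd : DifferentiableAt ℝ (fderiv ℝ F) x :=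
    ((hF.fderiv_right (m := ∞) le_rfl).differentiable (by simp)).differentiableAt
  have h : ∀ p q : RIdx n, pd p (pd q F) x =
      fderiv ℝ (fderiv ℝ F) x (EuclideanSpace.single p 1) (EuclideanSpace.single q 1) := by
    intro p q
    unfold pd
    rw [fderiv_clm_apply hd (differentiableAt_const _)]
    simp
  rw [h, h]
  have := (hF.contDiffAt (x := x)).isSymmSndFDerivAt (by simpa using ENat.LEInfty.out)
  exact this _ _

theorem pd_sum {ι : Type*} (s : Finset ι) (F : ι → HSpace n → E)
    (hF : ∀ i, ContDiff ℝ ∞ (F i)) (p : RIdx n) (x : HSpace n) :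
    pd p (fun y => ∑ i ∈ s, F i y) x = ∑ i ∈ s, pd p (F i) x := by
  unfold pd
  rw [fderiv_fun_sum fun i _ => ((hF i).differentiable (by simp)).differentiableAt]
  simp

theorem pd_add {F G : HSpace n → E} (hF : ContDiff ℝ ∞ F) (hG : ContDiff ℝ ∞ G) (p : RIdx n)
    (x : HSpace n) : pd p (fun y => F y + G y) x = pd p F x + pd p G x := by
  unfold pd
  rw [fderiv_fun_add (hF.differentiable (by simp)).differentiableAt
    (hG.differentiable (by simp)).differentiableAt]
  rfl

theorem pd_smul {u : HSpace n → ℝ} {F : HSpace n → E} (hu : ContDiff ℝ ∞ u)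
    (hF : ContDiff ℝ ∞ F) (p : RIdx n) (x : HSpace n) :
    pd p (fun y => u y • F y) x = pd p u x • F x + u x • pd p F x := by
  unfold pd
  rw [fderiv_fun_smul (hu.differentiable (by simp)).differentiableAt
    (hF.differentiable (by simp)).differentiableAt]
  simp [add_comm]

theorem pd_const (p : RIdx n) (c : E) (x : HSpace n) : pd p (fun _ => c) x = 0 := by
  simp [pd]

theorem tsupport_pd_subset (p : RIdx n) (F : HSpace n → E) : tsupport (pd p F) ⊆ tsupport F :=
  tsupport_fderiv_apply_subset ℝ _

theorem pd_congr {F G : HSpace n → E} {x : HSpace n} (h : F =ᶠ[𝓝 x] G) (p : RIdx n) :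
    pd p F =ᶠ[𝓝 x] pd p G := by
  filter_upwards [h.fderiv (𝕜 := ℝ)] with y hy
  simp [pd, hy]

end Partial

/-- An operator on `⋀ ℂ²ⁿ` as a continuous real linear map. -/
def endCLM {n : ℕ} (A : Module.End ℂ (Lam n)) : Lam n →L[ℝ] Lam n :=
  (A.restrictScalars ℝ).toContinuousLinearMap

theorem end_map_real_smul {n : ℕ} (A : Module.End ℂ (Lam n)) (a : ℝ) (v : Lam n) :
    A (a • v) = a • A v := (A.restrictScalars ℝ).map_smul a v

theorem contDiff_end {n : ℕ} (A : Module.End ℂ (Lam n)) {F : QForm n} (hF : ContDiff ℝ ∞ F) :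
    ContDiff ℝ ∞ fun x => A (F x) := (endCLM A).contDiff.comp hF

theorem pd_end {n : ℕ} (A : Module.End ℂ (Lam n)) {F : QForm n} (hF : ContDiff ℝ ∞ F)
    (p : RIdx n) (x : HSpace n) : pd p (fun y => A (F y)) x = A (pd p F x) := by
  have := (endCLM A).hasFDerivAt.comp x (hF.differentiable (by simp) x).hasFDerivAt
  unfold pd
  rw [show (fun y => A (F y)) = endCLM A ∘ F from rfl, this.fderiv]
  rfl

/-! ### The operators `d_α` and the Baston operator -/

/-- This rewrites d_α as the sum of the operators d_αx_p ∧ ∂_p. The calculus of d₀ and d₁ then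
follows from `dx_anticomm` and the symmetry of second derivatives. -/
theorem dOp_eq_sum {n : ℕ} (α : Fin 2) {F : QForm n} (hF : ContDiff ℝ ∞ F) (x : HSpace n) :
    dOp α F x = ∑ p, dx α p (pd p F x) := by
  have hc : ∀ p I, partialX p.1 p.2 (fun y => F y I) x = pd p F x I := by
    intro p I
    have h := (hasFDerivAt_pi'.mp (hF.differentiable (by simp) x).hasFDerivAt) I
    unfold partialX pd
    rw [h.fderiv]
    rfl
  funext J
  have h1 : ∀ k, nabla k α (fun y => F y (J.erase k)) x =
      ∑ p, nablaCoeff α k p * pd p F x (J.erase k) := by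
    intro k
    rw [nabla_eq_sum]
    exact Finset.sum_congr rfl fun p _ => by rw [hc]
  simp only [dOp, h1]
  simp only [dx, LinearMap.sum_apply, LinearMap.smul_apply, Finset.sum_apply, Pi.smul_apply,
    extMul_apply, smul_eq_mul, mul_ite, mul_zero]
  rw [Finset.sum_comm]
  rw [← Finset.sum_filter_add_sum_filter_not Finset.univ (fun k => k ∈ J)]
  have h2 : ∑ k ∈ Finset.univ.filter (fun k => ¬ k ∈ J), ∑ p, (if k ∈ J then nablaCoeff α k p *
      ((-1) ^ (J.filter (· < k)).card * pd p F x (J.erase k)) else 0) = 0 :=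
    Finset.sum_eq_zero fun k hk => by simp [(Finset.mem_filter.mp hk).2]
  rw [h2, add_zero]
  have h3 : Finset.univ.filter (fun k => k ∈ J) = J := by ext; simp
  rw [h3]
  refine Finset.sum_congr rfl fun k hk => ?_
  simp only [hk, if_true, Finset.mul_sum]
  refine Finset.sum_congr rfl fun p _ => ?_
  ring

theorem ContDiff.dOp {n : ℕ} {F : QForm n} (hF : ContDiff ℝ ∞ F) (α : Fin 2) :
    ContDiff ℝ ∞ (dOp α F) := by
  have : QuatPluri.dOp α F = fun x => ∑ p, dx α p (QuatPluri.pd p F x) :=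
    funext fun x => dOp_eq_sum α hF x
  rw [this]
  exact ContDiff.sum fun p _ => contDiff_end _ (ContDiff.pd hF p)

theorem dOp_dOp_eq_sum {n : ℕ} (α β : Fin 2) {F : QForm n} (hF : ContDiff ℝ ∞ F) (x : HSpace n) :
    dOp α (dOp β F) x = ∑ p, ∑ q, dx α p (dx β q (pd p (pd q F) x)) := by
  rw [dOp_eq_sum α (ContDiff.dOp hF β)]
  refine Finset.sum_congr rfl fun p _ => ?_
  have : dOp β F = fun x => ∑ q, dx β q (pd q F x) := funext fun x => dOp_eq_sum β hF x
  rw [this, pd_sum _ _ fun q => contDiff_end _ (ContDiff.pd hF q), map_sum]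
  refine Finset.sum_congr rfl fun q _ => ?_
  rw [pd_end _ (ContDiff.pd hF q)]

theorem dOp_anticomm {n : ℕ} (α β : Fin 2) {F : QForm n} (hF : ContDiff ℝ ∞ F) :
    dOp α (dOp β F) = -dOp β (dOp α F) := by
  funext x
  rw [Pi.neg_apply, dOp_dOp_eq_sum α β hF, dOp_dOp_eq_sum β α hF, Finset.sum_comm,
    ← Finset.sum_neg_distrib]
  refine Finset.sum_congr rfl fun p _ => ?_
  rw [← Finset.sum_neg_distrib]
  refine Finset.sum_congr rfl fun q _ => ?_
  rw [pd_comm hF]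
  exact LinearMap.congr_fun (dx_anticomm α β _ _) _

theorem dOp_self {n : ℕ} (α : Fin 2) {F : QForm n} (hF : ContDiff ℝ ∞ F) :
    dOp α (dOp α F) = 0 := by
  have h := dOp_anticomm α α hF
  have h2 : (2 : ℂ) • dOp α (dOp α F) = 0 := by
    rw [two_smul]
    nth_rewrite 1 [h]
    simp
  simpa using h2

theorem dOp_zero {n : ℕ} (α : Fin 2) : dOp α (0 : QForm n) = 0 := by
  funext x
  have h : ContDiff ℝ ∞ (0 : QForm n) := contDiff_const
  rw [dOp_eq_sum α h]
  refine Finset.sum_eq_zero fun p _ => ?_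
  have : pd p (0 : QForm n) x = 0 := pd_const p 0 x
  rw [this, map_zero]

theorem dOp_neg {n : ℕ} (α : Fin 2) {F : QForm n} (hF : ContDiff ℝ ∞ F) :
    dOp α (-F) = -dOp α F := by
  funext x
  rw [Pi.neg_apply, dOp_eq_sum α hF, dOp_eq_sum α (F := -F) hF.neg, ← Finset.sum_neg_distrib]
  refine Finset.sum_congr rfl fun p _ => ?_
  have : pd p (-F) x = -pd p F x := by
    unfold pd
    rw [fderiv_neg]
    rfl
  rw [this, map_neg]

/-- Anticommute d_α next to its twin and use d_α² = 0. By duality this makes △(uT) closed for every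
u. -/
theorem baston_dOp {n : ℕ} (α : Fin 2) {F : QForm n} (hF : ContDiff ℝ ∞ F) :
    baston (dOp α F) = 0 := by
  unfold baston
  have h : α = 0 ∨ α = 1 := by omega
  rcases h with rfl | rfl
  · rw [dOp_anticomm 1 0 hF, dOp_neg 0 (ContDiff.dOp (ContDiff.dOp hF 1) 0),
      dOp_self 0 (ContDiff.dOp hF 1), neg_zero]
  · rw [dOp_self 1 hF, dOp_zero]

theorem dOp_baston {n : ℕ} (α : Fin 2) {F : QForm n} (hF : ContDiff ℝ ∞ F) :
    dOp α (baston F) = 0 := by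
  unfold baston
  have h : α = 0 ∨ α = 1 := by omega
  rcases h with rfl | rfl
  · exact dOp_self 0 (ContDiff.dOp hF 1)
  · rw [dOp_anticomm 1 0 (ContDiff.dOp hF 1), dOp_self 1 hF, dOp_zero, neg_zero]

theorem ContDiff.baston {n : ℕ} {F : QForm n} (hF : ContDiff ℝ ∞ F) : ContDiff ℝ ∞ (baston F) :=
  ContDiff.dOp (ContDiff.dOp hF 1) 0

/-- The real Hessian of a function. -/
def hess {n : ℕ} (u : HSpace n → ℝ) (x : HSpace n) : Matrix (RIdx n) (RIdx n) ℝ :=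
  Matrix.of fun p q => pd p (pd q u) x

theorem hess_isSymm {n : ℕ} {u : HSpace n → ℝ} (hu : ContDiff ℝ ∞ u) (x : HSpace n) :
    (hess u x).IsSymm := by
  ext p q
  exact pd_comm hu q p x

theorem hessForm_apply_eq {n : ℕ} (H : Matrix (RIdx n) (RIdx n) ℝ) (v : Lam n) :
    hessForm H v = ∑ p, ∑ q, H p q • (dx 0 p * dx 1 q) v := by
  simp only [hessForm, LinearMap.sum_apply, LinearMap.smul_apply]
  rfl

/-- `u △η` differs from `△u ∧ η` by exact forms. -/
theorem smul_baston_eq {n : ℕ} {u : HSpace n → ℝ} (hu : ContDiff ℝ ∞ u) {η : QForm n}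
    (hη : ContDiff ℝ ∞ η) (x : HSpace n) :
    u x • baston η x = dOp 0 (fun y => u y • dOp 1 η y) x +
      dOp 1 (fun y => ∑ p, pd p u y • dx 0 p (η y)) x + hessForm (hess u x) (η x) := by
  have hd1 := ContDiff.dOp hη 1
  have e1 : dOp 0 (fun y => u y • dOp 1 η y) x =
      ∑ p, pd p u x • dx 0 p (dOp 1 η x) + u x • baston η x := by
    rw [dOp_eq_sum 0 (F := fun y => u y • dOp 1 η y) (hu.smul hd1), baston, dOp_eq_sum 0 hd1, Finset.smul_sum,
      ← Finset.sum_add_distrib]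
    refine Finset.sum_congr rfl fun p _ => ?_
    rw [pd_smul hu hd1, map_add, end_map_real_smul, end_map_real_smul]
  have hs : ∀ p, ContDiff ℝ ∞ fun y => pd p u y • dx 0 p (η y) := fun p =>
    (ContDiff.pd hu p).smul (contDiff_end _ hη)
  -- The form differentiated here is d₀u ∧ η. Its d₁ supplies -△u ∧ η and cancels the cross term d₀u
  -- ∧ d₁η left over by the Leibniz rule in `e1`.
  have e2 : dOp 1 (fun y => ∑ p, pd p u y • dx 0 p (η y)) x =
      -hessForm (hess u x) (η x) - ∑ p, pd p u x • dx 0 p (dOp 1 η x) := by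
    rw [dOp_eq_sum 1 (ContDiff.sum fun p _ => hs p)]
    have : ∀ q, dx 1 q (pd q (fun y => ∑ p, pd p u y • dx 0 p (η y)) x) =
        ∑ p, (-(hess u x p q • (dx 0 p * dx 1 q) (η x)) -
          pd p u x • dx 0 p (dx 1 q (pd q η x))) := by
      intro q
      rw [pd_sum _ _ hs, map_sum]
      refine Finset.sum_congr rfl fun p _ => ?_
      have hanti : ∀ v : Lam n, dx 1 q (dx 0 p v) = -dx 0 p (dx 1 q v) :=
        fun v => LinearMap.congr_fun (dx_anticomm 1 0 q p) v
      rw [pd_smul (ContDiff.pd hu p) (contDiff_end _ hη), pd_end _ hη, map_add,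
        end_map_real_smul, end_map_real_smul, hanti, hanti, smul_neg, smul_neg,
        ← sub_eq_add_neg, pd_comm hu q p]
      rfl
    simp only [this]
    rw [Finset.sum_comm, dOp_eq_sum 1 hη, hessForm_apply_eq]
    simp only [map_sum, Finset.smul_sum, Finset.sum_sub_distrib, Finset.sum_neg_distrib]
  rw [e1, e2]
  abel

/-- `△(u △η) = △u ∧ △η`. -/
theorem baston_smul_of_closed {n : ℕ} {u : HSpace n → ℝ} (hu : ContDiff ℝ ∞ u) {ζ : QForm n}
    (hζ : ContDiff ℝ ∞ ζ) (h0 : dOp 0 ζ = 0) (h1 : dOp 1 ζ = 0) (x : HSpace n) :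
    baston (fun y => u y • ζ y) x = hessForm (hess u x) (ζ x) := by
  have e1 : dOp 1 (fun y => u y • ζ y) = fun y => ∑ q, pd q u y • dx 1 q (ζ y) := by
    funext y
    rw [dOp_eq_sum 1 (F := fun y => u y • ζ y) (hu.smul hζ)]
    have : ∑ q, dx 1 q (pd q ζ y) = 0 := by rw [← dOp_eq_sum 1 hζ, h1]; rfl
    rw [← add_zero (∑ q, pd q u y • dx 1 q (ζ y)), ← smul_zero (u y), ← this, Finset.smul_sum,
      ← Finset.sum_add_distrib]
    refine Finset.sum_congr rfl fun p _ => ?_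
    rw [pd_smul hu hζ, map_add, end_map_real_smul, end_map_real_smul]
  have hs : ∀ p, ContDiff ℝ ∞ fun y => pd p u y • dx 1 p (ζ y) := fun p =>
    (ContDiff.pd hu p).smul (contDiff_end _ hζ)
  have h0' : ∑ p, dx 0 p (pd p ζ x) = 0 := by rw [← dOp_eq_sum 0 hζ, h0]; rfl
  rw [baston, e1, dOp_eq_sum 0 (ContDiff.sum fun p _ => hs p), hessForm_apply_eq]
  have : ∀ p, dx 0 p (pd p (fun y => ∑ q, pd q u y • dx 1 q (ζ y)) x) =
      ∑ q, (hess u x p q • (dx 0 p * dx 1 q) (ζ x) -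
        pd q u x • dx 1 q (dx 0 p (pd p ζ x))) := by
    intro p
    rw [pd_sum _ _ hs, map_sum]
    refine Finset.sum_congr rfl fun q _ => ?_
    have hanti : ∀ v : Lam n, dx 0 p (dx 1 q v) = -dx 1 q (dx 0 p v) :=
      fun v => LinearMap.congr_fun (dx_anticomm 0 1 p q) v
    rw [pd_smul (ContDiff.pd hu q) (contDiff_end _ hζ), pd_end _ hζ, map_add,
      end_map_real_smul, end_map_real_smul, hanti (pd p ζ x), smul_neg, ← sub_eq_add_neg]
    rfl
  simp only [this, Finset.sum_sub_distrib]
  have h2 : ∑ p, ∑ q, pd q u x • dx 1 q (dx 0 p (pd p ζ x)) = 0 := by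
    rw [Finset.sum_comm]
    refine Finset.sum_eq_zero fun q _ => ?_
    rw [← Finset.smul_sum, ← map_sum, h0', map_zero, smul_zero]
  rw [h2, sub_zero]

theorem dOp_congr {n : ℕ} (α : Fin 2) {F G : QForm n} (hF : ContDiff ℝ ∞ F)
    (hG : ContDiff ℝ ∞ G) {x : HSpace n} (h : F =ᶠ[𝓝 x] G) : dOp α F =ᶠ[𝓝 x] dOp α G := by
  have : ∀ᶠ y in 𝓝 x, ∀ p, pd p F y = pd p G y := eventually_all.mpr fun p => pd_congr h p
  filter_upwards [this] with y hy
  rw [dOp_eq_sum α hF, dOp_eq_sum α hG]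
  exact Finset.sum_congr rfl fun p _ => by rw [hy p]

theorem baston_congr {n : ℕ} {F G : QForm n} (hF : ContDiff ℝ ∞ F)
    (hG : ContDiff ℝ ∞ G) {x : HSpace n} (h : F =ᶠ[𝓝 x] G) : baston F x = baston G x :=
  (dOp_congr 0 (ContDiff.dOp hF 1) (ContDiff.dOp hG 1) (dOp_congr 1 hF hG h)).eq_of_nhds

theorem dOp_add {n : ℕ} (α : Fin 2) {F G : QForm n} (hF : ContDiff ℝ ∞ F)
    (hG : ContDiff ℝ ∞ G) : dOp α (F + G) = dOp α F + dOp α G := by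
  funext x
  rw [Pi.add_apply, dOp_eq_sum α hF, dOp_eq_sum α hG, dOp_eq_sum α (F := F + G) (hF.add hG),
    ← Finset.sum_add_distrib]
  refine Finset.sum_congr rfl fun p _ => ?_
  rw [← map_add, ← pd_add hF hG]
  rfl

theorem dOp_smul {n : ℕ} (α : Fin 2) (c : ℂ) {F : QForm n} (hF : ContDiff ℝ ∞ F) :
    dOp α (c • F) = c • dOp α F := by
  funext x
  rw [Pi.smul_apply, dOp_eq_sum α hF, dOp_eq_sum α (F := c • F) (hF.const_smul c), Finset.smul_sum]
  refine Finset.sum_congr rfl fun p _ => ?_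
  rw [← map_smul]
  have := pd_end (c • (1 : Module.End ℂ (Lam n))) hF p x
  exact congrArg _ this

theorem baston_add {n : ℕ} {F G : QForm n} (hF : ContDiff ℝ ∞ F)
    (hG : ContDiff ℝ ∞ G) : baston (F + G) = baston F + baston G := by
  rw [baston, dOp_add 1 hF hG, dOp_add 0 (ContDiff.dOp hF 1) (ContDiff.dOp hG 1)]
  rfl

theorem baston_smul {n : ℕ} (c : ℂ) {F : QForm n} (hF : ContDiff ℝ ∞ F) :
    baston (c • F) = c • baston F := by
  rw [baston, dOp_smul 1 c hF, dOp_smul 0 c (ContDiff.dOp hF 1)]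
  rfl

/-! ### Test forms -/

section TestForms

variable {n : ℕ} {Ω : Set (HSpace n)}

theorem IsTestForm.of_tsupport_subset {η ζ : QForm n} (hη : IsTestForm Ω η)
    (hζ : ContDiff ℝ ∞ ζ) (h : tsupport ζ ⊆ tsupport η) : IsTestForm Ω ζ :=
  ⟨hζ, hη.2.1.of_isClosed_subset (isClosed_tsupport _) h, h.trans hη.2.2⟩

theorem IsTestForm.of_eq_zero {η ζ : QForm n} (hη : IsTestForm Ω η)
    (hζ : ContDiff ℝ ∞ ζ) (h : ∀ x, η x = 0 → ζ x = 0) : IsTestForm Ω ζ :=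
  hη.of_tsupport_subset hζ (closure_mono fun x hx => fun h0 => hx (h x h0))

theorem IsTestForm.mono {U : Set (HSpace n)} {η : QForm n} (hη : IsTestForm U η) (h : U ⊆ Ω) :
    IsTestForm Ω η := ⟨hη.1, hη.2.1, hη.2.2.trans h⟩

theorem IsTestForm.add {η ζ : QForm n} (hη : IsTestForm Ω η) (hζ : IsTestForm Ω ζ) :
    IsTestForm Ω (η + ζ) :=
  ⟨hη.1.add hζ.1, hη.2.1.add hζ.2.1,
    (tsupport_add _ _).trans (union_subset hη.2.2 hζ.2.2)⟩

theorem IsTestForm.const_smul {η : QForm n} (hη : IsTestForm Ω η) (c : ℂ) :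
    IsTestForm Ω (c • η) :=
  hη.of_eq_zero (hη.1.const_smul c) fun x hx => by simp [hx]

theorem IsTestForm.zero : IsTestForm Ω (0 : QForm n) :=
  ⟨contDiff_const, HasCompactSupport.zero, by simp [tsupport_eq_empty_iff.mpr]⟩

theorem IsTestForm.sum {ι : Type*} (s : Finset ι) {η : ι → QForm n}
    (h : ∀ i ∈ s, IsTestForm Ω (η i)) : IsTestForm Ω (∑ i ∈ s, η i) := by
  classical
  induction s using Finset.induction_on with
  | empty => simpa using IsTestForm.zero
  | insert a s ha ih =>
    rw [Finset.sum_insert ha]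
    exact (h a (by simp)).add (ih fun i hi => h i (by simp [hi]))

theorem IsTestForm.smul {η : QForm n} (hη : IsTestForm Ω η) {u : HSpace n → ℝ}
    (hu : ContDiff ℝ ∞ u) : IsTestForm Ω fun x => u x • η x :=
  hη.of_eq_zero (hu.smul hη.1) fun x hx => by simp [hx]

theorem IsTestForm.end_apply {η : QForm n} (hη : IsTestForm Ω η) (A : Module.End ℂ (Lam n)) :
    IsTestForm Ω fun x => A (η x) :=
  hη.of_eq_zero (contDiff_end A hη.1) fun x hx => by simp [hx]

theorem contDiff_hessForm {H : HSpace n → Matrix (RIdx n) (RIdx n) ℝ}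
    (hH : ∀ p q, ContDiff ℝ ∞ fun x => H x p q) {η : QForm n} (hη : ContDiff ℝ ∞ η) :
    ContDiff ℝ ∞ fun x => hessForm (H x) (η x) := by
  simp only [hessForm_apply_eq]
  exact ContDiff.sum fun p _ => ContDiff.sum fun q _ => (hH p q).smul (contDiff_end _ hη)

theorem IsTestForm.hessForm {H : HSpace n → Matrix (RIdx n) (RIdx n) ℝ}
    (hH : ∀ p q, ContDiff ℝ ∞ fun x => H x p q) {η : QForm n} (hη : IsTestForm Ω η) :
    IsTestForm Ω fun x => hessForm (H x) (η x) :=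
  hη.of_eq_zero (contDiff_hessForm hH hη.1) fun x hx => by simp [hx]

theorem contDiff_hess {u : HSpace n → ℝ} (hu : ContDiff ℝ ∞ u) (p q : RIdx n) :
    ContDiff ℝ ∞ fun x => hess u x p q := ContDiff.pd (ContDiff.pd hu q) p

theorem IsTestForm.dOp {η : QForm n} (hη : IsTestForm Ω η) (α : Fin 2) :
    IsTestForm Ω (dOp α η) := by
  refine hη.of_tsupport_subset (ContDiff.dOp hη.1 α) ?_
  refine closure_minimal (fun x hx => ?_) (isClosed_tsupport _)
  by_contra hc
  refine hx ?_
  rw [dOp_eq_sum α hη.1]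
  refine Finset.sum_eq_zero fun p _ => ?_
  rw [image_eq_zero_of_notMem_tsupport fun h => hc (tsupport_pd_subset p η h), map_zero]

theorem IsTestForm.baston {η : QForm n} (hη : IsTestForm Ω η) : IsTestForm Ω (baston η) :=
  (hη.dOp 1).dOp 0

theorem integral_pd_eq_zero {E : Type*} [NormedAddCommGroup E] [NormedSpace ℝ E]
    {F : HSpace n → E} (hF : ContDiff ℝ ∞ F)
    (hc : HasCompactSupport F) (p : RIdx n) : ∫ x, pd p F x = 0 := by
  have hi : Integrable (pd p F) := (ContDiff.pd hF p).continuous.integrable_of_hasCompactSupport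
    (hc.of_isClosed_subset (isClosed_tsupport _) (tsupport_pd_subset p F))
  have := integral_smul_fderiv_eq_neg_fderiv_smul_of_integrable (μ := (volume : Measure (HSpace n)))
    (f := fun _ => (1 : ℝ)) (g := F) (v := EuclideanSpace.single p 1) (by simp)
    (by simp only [one_smul]; exact hi) (by simpa using hF.continuous.integrable_of_hasCompactSupport hc)
    (fun _ _ => differentiableAt_const _) (fun x _ => hF.differentiable (by simp) x)
  simpa [pd] using this

theorem integral_dOp_univ_eq_zero {η : QForm n} (hη : IsTestForm Ω η) (α : Fin 2)
    (J : Finset (Fin (n * 2))) : ∫ x in Ω, dOp α η x J = 0 := by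
  have h1 : ∫ x in Ω, dOp α η x J = ∫ x, dOp α η x J :=
    setIntegral_eq_integral_of_forall_compl_eq_zero fun x hx => by
      rw [image_eq_zero_of_notMem_tsupport fun h => hx ((hη.dOp α).2.2 h)]; rfl
  have h2 : ∀ x, dOp α η x J = ∑ p, pd p (fun y => dx α p (η y) J) x := by
    intro x
    rw [dOp_eq_sum α hη.1, Finset.sum_apply]
    refine Finset.sum_congr rfl fun p _ => ?_
    rw [← pd_end _ hη.1]
    have h := (hasFDerivAt_pi'.mp
      ((contDiff_end (dx α p) hη.1).differentiable (by simp) x).hasFDerivAt) J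
    unfold pd
    rw [h.fderiv]
    rfl
  have hs : ∀ p, ContDiff ℝ ∞ fun y => dx α p (η y) J := fun p =>
    contDiff_pi.mp (contDiff_end (dx α p) hη.1) J
  have hcs : ∀ p, HasCompactSupport fun y => dx α p (η y) J := fun p =>
    hη.2.1.mono' fun x hx => subset_tsupport _ fun h0 => hx (by simp [h0])
  rw [h1]
  simp only [h2]
  rw [integral_finsetSum]
  · exact Finset.sum_eq_zero fun p _ => integral_pd_eq_zero (hs p) (hcs p) p
  · intro p _
    refine (ContDiff.pd (hs p) p).continuous.integrable_of_hasCompactSupport ?_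
    exact (hcs p).of_isClosed_subset (isClosed_tsupport _) (tsupport_pd_subset p _)

end TestForms

/-! ### Test functions -/

section TestFun

variable {n : ℕ} {E : Type*} [NormedAddCommGroup E] [NormedSpace ℝ E] {Ω : Set (HSpace n)}

/-- Smooth functions with compact support contained in `Ω`. -/
def IsTestFun (Ω : Set (HSpace n)) (f : HSpace n → E) : Prop :=
  ContDiff ℝ ∞ f ∧ HasCompactSupport f ∧ tsupport f ⊆ Ω

theorem IsTestFun.eq_zero {f : HSpace n → E} (hf : IsTestFun Ω f) {x : HSpace n} (hx : x ∉ Ω) :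
    f x = 0 := image_eq_zero_of_notMem_tsupport fun h => hx (hf.2.2 h)

theorem IsTestFun.of_eq_zero {F : Type*} [NormedAddCommGroup F] [NormedSpace ℝ F]
    {f : HSpace n → E} {g : HSpace n → F} (hf : IsTestFun Ω f)
    (hg : ContDiff ℝ ∞ g) (h : ∀ x, f x = 0 → g x = 0) : IsTestFun Ω g := by
  have : tsupport g ⊆ tsupport f := closure_mono fun x hx => fun h0 => hx (h x h0)
  exact ⟨hg, hf.2.1.of_isClosed_subset (isClosed_tsupport _) this, this.trans hf.2.2⟩

theorem IsTestFun.ofReal {f : HSpace n → ℝ} (hf : IsTestFun Ω f) :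
    IsTestFun Ω fun x => (f x : ℂ) :=
  hf.of_eq_zero (Complex.ofRealCLM.contDiff.comp hf.1) fun x hx => by simp [hx]

theorem IsTestFun.mono {U : Set (HSpace n)} {f : HSpace n → E} (hf : IsTestFun U f) (h : U ⊆ Ω) :
    IsTestFun Ω f := ⟨hf.1, hf.2.1, hf.2.2.trans h⟩

theorem IsTestFun.add {f g : HSpace n → E} (hf : IsTestFun Ω f) (hg : IsTestFun Ω g) :
    IsTestFun Ω (f + g) :=
  ⟨hf.1.add hg.1, hf.2.1.add hg.2.1, (tsupport_add _ _).trans (union_subset hf.2.2 hg.2.2)⟩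

theorem exists_cutoff {K : Set (HSpace n)} (hΩ : IsOpen Ω) (hK : IsCompact K) (hKΩ : K ⊆ Ω) :
    ∃ θ : HSpace n → ℝ, IsTestFun Ω θ ∧ (∀ x, 0 ≤ θ x ∧ θ x ≤ 1) ∧ ∀ᶠ x in 𝓝ˢ K, θ x = 1 := by
  obtain ⟨L, hL, hKL, hLΩ⟩ := exists_compact_between hK hΩ hKΩ
  obtain ⟨f, h1, h0, hr⟩ := exists_contMDiffMap_one_nhds_of_subset_interior (n := ⊤)
    (modelWithCornersSelf ℝ (HSpace n)) hK.isClosed hKL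
  have hsub : tsupport f ⊆ L := closure_minimal
    (fun x hx => by by_contra hc; exact hx (h0 x hc)) hL.isClosed
  exact ⟨f, ⟨f.contMDiff.contDiff, hL.of_isClosed_subset (isClosed_tsupport _) hsub,
    hsub.trans hLΩ⟩, fun x => hr x, h1⟩

end TestFun

/-! ### Positive functionals on test functions -/

section Riesz

variable {n : ℕ} {Ω : Set (HSpace n)}

open CompactlySupported

/-- A test function on `Ω` as a compactly supported continuous function on the subtype. -/
def IsTestFun.toCc {f : HSpace n → ℝ} (hf : IsTestFun Ω f) : C_c(Ω, ℝ) where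
  toFun x := f x
  continuous_toFun := hf.1.continuous.comp continuous_subtype_val
  hasCompactSupport' := by
    have hK : IsCompact ((↑) ⁻¹' tsupport f : Set Ω) :=
      Topology.IsInducing.subtypeVal.isCompact_preimage' hf.2.1 (by simpa using hf.2.2)
    exact HasCompactSupport.intro hK fun x hx => image_eq_zero_of_notMem_tsupport hx

theorem extend_toCc {f : HSpace n → ℝ} (hf : IsTestFun Ω f) :
    Function.extend Subtype.val hf.toCc (0 : HSpace n → ℝ) = f := by
  funext x
  by_cases hx : x ∈ Ω
  · exact Subtype.val_injective.extend_apply _ _ (⟨x, hx⟩ : Ω)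
  · rw [Function.extend_apply' _ _ _ (by simpa using hx), hf.eq_zero hx]
    rfl

/-- A positive functional on test functions is given by a Radon measure. -/
theorem exists_measure_of_positive (hΩ : IsOpen Ω) (Λ : (HSpace n → ℝ) → ℝ)
    (hadd : ∀ f g, IsTestFun Ω f → IsTestFun Ω g → Λ (f + g) = Λ f + Λ g)
    (hsmul : ∀ (c : ℝ) f, IsTestFun Ω f → Λ (c • f) = c * Λ f)
    (hpos : ∀ f, IsTestFun Ω f → (∀ x, 0 ≤ f x) → 0 ≤ Λ f) :
    ∃ m : Measure (HSpace n), m Ωᶜ = 0 ∧ IsRadonOn Ω m ∧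
      ∀ f, IsTestFun Ω f → Λ f = ∫ x, f x ∂m := by
  have : LocallyCompactSpace Ω := hΩ.locallyCompactSpace
  let ex : C_c(Ω, ℝ) → HSpace n → ℝ := fun f => Function.extend Subtype.val f 0
  have ex_mem : ∀ (f : C_c(Ω, ℝ)) (x : Ω), ex f x = f x := fun f x =>
    Subtype.val_injective.extend_apply _ _ x
  have ex_notMem : ∀ (f : C_c(Ω, ℝ)) (x : HSpace n), x ∉ Ω → ex f x = 0 := fun f x hx =>
    Function.extend_apply' _ _ _ (by simpa using hx)
  have ex_ext : ∀ (f : C_c(Ω, ℝ)) (g : HSpace n → ℝ), (∀ x : Ω, f x = g x) →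
      (∀ x ∉ Ω, g x = 0) → ex f = g := by
    intro f g h1 h2
    funext x
    by_cases hx : x ∈ Ω
    · rw [← h1 ⟨x, hx⟩, ← ex_mem f ⟨x, hx⟩]
    · rw [ex_notMem f x hx, h2 x hx]
  have ex_add : ∀ f g : C_c(Ω, ℝ), ex (f + g) = ex f + ex g := fun f g =>
    ex_ext _ _ (fun x => by simp [ex_mem]) (fun x hx => by simp [ex_notMem _ x hx])
  have ex_smul : ∀ (c : ℝ) (f : C_c(Ω, ℝ)), ex (c • f) = c • ex f := fun c f =>
    ex_ext _ _ (fun x => by simp [ex_mem]) (fun x hx => by simp [ex_notMem _ x hx])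
  have ex_test : ∀ f : C_c(Ω, ℝ), ContDiff ℝ ∞ (ex f) → IsTestFun Ω (ex f) := fun f hf =>
    ⟨hf, f.hasCompactSupport.extend_zero continuous_subtype_val,
      (f.hasCompactSupport.tsupport_extend_zero_subset continuous_subtype_val).trans
        (Subtype.coe_image_subset _ _)⟩
  let D : Submodule ℝ C_c(Ω, ℝ) :=
    { carrier := {f | ContDiff ℝ ∞ (ex f)}
      add_mem' := fun {f g} hf hg => by
        simp only [mem_ofPred_eq, ex_add] at *
        exact hf.add hg
      zero_mem' := by
        have : ex 0 = 0 := ex_ext _ _ (fun x => rfl) (fun x _ => rfl)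
        simp only [mem_ofPred_eq, this]
        exact contDiff_const
      smul_mem' := fun c f hf => by
        simp only [mem_ofPred_eq, ex_smul] at *
        exact hf.const_smul c }
  let L : C_c(Ω, ℝ) →ₗ.[ℝ] ℝ :=
    { domain := D
      toFun :=
        { toFun := fun f => Λ (ex f.1)
          map_add' := fun f g => by
            simp only [Submodule.coe_add, ex_add]
            exact hadd _ _ (ex_test _ f.2) (ex_test _ g.2)
          map_smul' := fun c f => by
            simp only [Submodule.coe_smul, ex_smul]
            exact hsmul _ _ (ex_test _ f.2) } }
  let P : PointedCone ℝ C_c(Ω, ℝ) :=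
    { carrier := {f | ∀ x, 0 ≤ f x}
      add_mem' := fun {f g} hf hg x => add_nonneg (hf x) (hg x)
      zero_mem' := fun x => le_rfl
      smul_mem' := fun c f hf x => mul_nonneg c.2 (hf x) }
  have hP : ∀ f : C_c(Ω, ℝ), f ∈ P ↔ ∀ x, 0 ≤ f x := fun f => Iff.rfl
  -- The functional is given only on the subspace of smooth functions. The M. Riesz extension
  -- theorem extends it positively to all of C_c(Ω), since every y there becomes nonnegative after
  -- adding a smooth function |M| θ, with θ = 1 on the support of y and |y| ≤ M.
  obtain ⟨G, hG, hGpos⟩ := riesz_extension P L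
    (fun f hf => by
      refine hpos _ (ex_test _ f.2) fun x => ?_
      by_cases hx : x ∈ Ω
      · rw [ex_mem f.1 ⟨x, hx⟩]
        exact (hP _).mp hf _
      · rw [ex_notMem _ x hx])
    (fun y => by
      have hK : IsCompact (Subtype.val '' tsupport y : Set (HSpace n)) :=
        IsCompact.image y.hasCompactSupport continuous_subtype_val
      obtain ⟨θ, hθ, hθ01, hθ1⟩ := exists_cutoff hΩ hK (Subtype.coe_image_subset _ _)
      obtain ⟨M, hM⟩ := y.hasCompactSupport.exists_bound_of_continuous y.continuous
      have hM0 : 0 ≤ |M| := abs_nonneg M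
      have hθM : IsTestFun Ω (|M| • θ) := hθ.of_eq_zero (g := |M| • θ) (contDiff_const.smul hθ.1)
        fun x hx => by simp [hx]
      refine ⟨⟨hθM.toCc, ?_⟩, ?_⟩
      · change ContDiff ℝ ∞ (Function.extend Subtype.val hθM.toCc (0 : HSpace n → ℝ))
        rw [extend_toCc]
        exact hθM.1
      · rw [hP]
        intro x
        change 0 ≤ |M| * θ x + y x
        by_cases hx : x ∈ tsupport y
        · have h1 : θ x = 1 := hθ1.self_of_nhdsSet _ ⟨x, hx, rfl⟩
          have h2 := hM x
          rw [Real.norm_eq_abs] at h2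
          have h3 := neg_abs_le (y x)
          have h4 := le_abs_self M
          rw [h1]
          linarith
        · rw [image_eq_zero_of_notMem_tsupport hx, add_zero]
          exact mul_nonneg hM0 (hθ01 x).1)
  let Γ : C_c(Ω, ℝ) →ₚ[ℝ] ℝ := PositiveLinearMap.mk₀ G fun f hf => hGpos f hf
  let μ := RealRMK.rieszMeasure Γ
  refine ⟨μ.map Subtype.val, ?_, ?_, ?_⟩
  · rw [Measure.map_apply measurable_subtype_coe hΩ.measurableSet.compl]
    have : (Subtype.val ⁻¹' Ωᶜ : Set Ω) = ∅ := by ext x; simp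
    rw [this, measure_empty]
  · intro K hK hKΩ
    rw [Measure.map_apply measurable_subtype_coe hK.measurableSet]
    exact (Topology.IsInducing.subtypeVal.isCompact_preimage' hK
      (by simpa using hKΩ)).measure_lt_top
  · intro f hf
    rw [integral_map measurable_subtype_coe.aemeasurable hf.1.continuous.aestronglyMeasurable]
    have h1 : ∫ x : Ω, f x ∂μ = Γ hf.toCc := RealRMK.integral_rieszMeasure Γ hf.toCc
    have h2 : ContDiff ℝ ∞ (ex hf.toCc) := by
      change ContDiff ℝ ∞ (Function.extend Subtype.val hf.toCc (0 : HSpace n → ℝ))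
      rw [extend_toCc]
      exact hf.1
    have h3 : G hf.toCc = Λ (ex hf.toCc) := hG ⟨hf.toCc, h2⟩
    have h4 : ex hf.toCc = f := extend_toCc hf
    rw [h1]
    exact (congrArg Λ h4).symm.trans h3.symm

end Riesz

/-! ### Radon measures on an open set -/

section Radon

variable {n : ℕ} {Ω : Set (HSpace n)}

theorem IsRadonOn.sigmaFinite_restrict (hΩ : IsOpen Ω) {μ : Measure (HSpace n)}
    (hμ : IsRadonOn Ω μ) : SigmaFinite (μ.restrict Ω) := by
  have : LocallyCompactSpace Ω := hΩ.locallyCompactSpace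
  obtain ⟨K, hK, hKΩ⟩ : IsSigmaCompact Ω :=
    isSigmaCompact_iff_sigmaCompactSpace.mpr inferInstance
  refine ⟨⟨⟨fun j => K j ∪ Ωᶜ, fun _ => trivial, fun j => ?_, ?_⟩⟩⟩
  · refine (measure_union_le _ _).trans_lt (ENNReal.add_lt_top.mpr ⟨?_, ?_⟩)
    · exact (Measure.restrict_apply_le _ _).trans_lt
        (hμ _ (hK j) (hKΩ ▸ subset_iUnion K j))
    · rw [Measure.restrict_apply hΩ.measurableSet.compl]
      simp
  · rw [← iUnion_union, hKΩ, union_compl_self]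

theorem restrict_eq_self_of_null {μ : Measure (HSpace n)} (h : μ Ωᶜ = 0) :
    μ.restrict Ω = μ := by
  refine Measure.restrict_eq_self_of_ae_mem ?_
  rw [ae_iff]
  exact h

/-- Functions on `Ω` which are Borel and locally bounded. -/
structure IsLocBddBorel (Ω : Set (HSpace n)) (u : HSpace n → ℝ) : Prop where
  measurable : Measurable (Ω.indicator u)
  bounded : ∀ K, IsCompact K → K ⊆ Ω → ∃ C, ∀ x ∈ K, |u x| ≤ C

theorem IsLocBddBorel.mono {U : Set (HSpace n)} {u : HSpace n → ℝ}
    (hU : IsOpen U) (hu : IsLocBddBorel Ω u) (h : U ⊆ Ω) : IsLocBddBorel U u := by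
  refine ⟨?_, fun K hK hKU => hu.bounded K hK (hKU.trans h)⟩
  have : U.indicator u = U.indicator (Ω.indicator u) := by
    rw [indicator_indicator, inter_eq_left.mpr h]
  rw [this]
  exact hu.measurable.indicator hU.measurableSet

theorem isLocBddBorel_of_continuousOn (hΩ : IsOpen Ω) {u : HSpace n → ℝ}
    (hu : ContinuousOn u Ω) : IsLocBddBorel Ω u := by
  refine ⟨?_, fun K hK hKU => ?_⟩
  · classical
    have := hu.measurable_piecewise (continuousOn_const (c := (0 : ℝ)) (s := Ωᶜ))
      hΩ.measurableSet
    exact this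
  · obtain ⟨C, hC⟩ := hK.exists_bound_of_continuousOn (hu.mono hKU)
    exact ⟨C, fun x hx => hC x hx⟩

theorem IsLocBddBorel.integrable_mul {u : HSpace n → ℝ} (hu : IsLocBddBorel Ω u)
    {μ : Measure (HSpace n)} {g : HSpace n → ℂ} (hg : LocallyIntegrableOn g Ω μ)
    {f : HSpace n → ℂ} (hf : Continuous f) (hfc : HasCompactSupport f) (hfΩ : tsupport f ⊆ Ω) :
    Integrable (fun x => (u x : ℂ) * (g x * f x)) μ := by
  obtain ⟨C, hC⟩ := hu.bounded _ hfc hfΩ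
  obtain ⟨C', hC'⟩ := hfc.exists_bound_of_continuous hf
  have hgK : IntegrableOn g (tsupport f) μ := hg.integrableOn_compact_subset hfΩ hfc
  have hK : MeasurableSet (tsupport f) := (isClosed_tsupport f).measurableSet
  have h0 : (fun x => (u x : ℂ) * (g x * f x)) =
      (tsupport f).indicator fun x => ((Ω.indicator u x : ℝ) : ℂ) * f x * g x := by
    funext x
    by_cases hx : x ∈ tsupport f
    · rw [indicator_of_mem hx, indicator_of_mem (hfΩ hx)]
      ring
    · rw [indicator_of_notMem hx, image_eq_zero_of_notMem_tsupport hx]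
      simp
  rw [h0, integrable_indicator_iff hK]
  refine Integrable.bdd_mul (c := C * C') hgK ?_ ?_
  · exact ((Complex.measurable_ofReal.comp hu.measurable).mul hf.measurable).aestronglyMeasurable
  · filter_upwards [ae_restrict_mem hK] with x hx
    rw [norm_mul, indicator_of_mem (hfΩ hx), Complex.norm_real]
    exact mul_le_mul (hC x hx) (hC' x) (norm_nonneg _) ((abs_nonneg _).trans (hC x hx))

theorem IsRadonOn.locallyIntegrableOn_const (hΩ : IsOpen Ω) {μ : Measure (HSpace n)}
    (hμ : IsRadonOn Ω μ) (c : ℂ) : LocallyIntegrableOn (fun _ => c) Ω μ := by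
  rw [locallyIntegrableOn_iff hΩ.isLocallyClosed]
  intro K hKΩ hK
  exact integrableOn_const (hμ K hK hKΩ).ne

theorem IsLocBddBorel.integrable_mul' {u : HSpace n → ℝ} (hu : IsLocBddBorel Ω u)
    {μ : Measure (HSpace n)} (hΩ : IsOpen Ω) (hμ : IsRadonOn Ω μ)
    {f : HSpace n → ℂ} (hf : Continuous f) (hfc : HasCompactSupport f) (hfΩ : tsupport f ⊆ Ω) :
    Integrable (fun x => (u x : ℂ) * f x) μ := by
  simpa using hu.integrable_mul (hμ.locallyIntegrableOn_const hΩ 1) hf hfc hfΩ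

end Radon

/-! ### Currents with measure coefficients and their products with functions -/

section Density

variable {n : ℕ} {Ω : Set (HSpace n)}

theorem integrableOn_rnDeriv_smul {μ ν : Measure (HSpace n)} [SigmaFinite μ] [SigmaFinite ν]
    (h : μ ≪ ν) {a : HSpace n → ℂ} {K : Set (HSpace n)} (hK : MeasurableSet K)
    (ha : IntegrableOn a K μ) : IntegrableOn (fun x => (μ.rnDeriv ν x).toReal • a x) K ν := by
  have h1 := (integrable_rnDeriv_smul_iff h).mpr ((integrable_indicator_iff hK).mpr ha)
  rw [← integrable_indicator_iff hK]
  refine h1.congr (Eventually.of_forall fun x => ?_)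
  by_cases hx : x ∈ K <;> simp [hx]

/-- Two complex Radon measures on `Ω` which agree on test functions agree on locally bounded Borel
functions with compact support. -/
theorem integral_mul_eq_of_test (hΩ : IsOpen Ω) {μ μ' : Measure (HSpace n)}
    (hμ : IsRadonOn Ω μ) (hμ' : IsRadonOn Ω μ') {a b : HSpace n → ℂ}
    (ha : LocallyIntegrableOn a Ω μ) (hb : LocallyIntegrableOn b Ω μ')
    (hab : ∀ f : HSpace n → ℝ, IsTestFun Ω f →
      ∫ x in Ω, f x • a x ∂μ = ∫ x in Ω, f x • b x ∂μ')
    (u : HSpace n → ℝ) {f : HSpace n → ℂ} (hfΩ : tsupport f ⊆ Ω) :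
    ∫ x in Ω, (u x : ℂ) * (a x * f x) ∂μ = ∫ x in Ω, (u x : ℂ) * (b x * f x) ∂μ' := by
  have s1 := hμ.sigmaFinite_restrict hΩ
  have s2 := hμ'.sigmaFinite_restrict hΩ
  set μ₁ := μ.restrict Ω with hμ₁
  set μ₂ := μ'.restrict Ω with hμ₂
  -- Both complex measures get densities with respect to the common dominating measure ν. Agreement
  -- on test functions then means that these densities coincide almost everywhere on Ω.
  set ν := μ₁ + μ₂ with hν
  have ac1 : μ₁ ≪ ν := Measure.absolutelyContinuous_of_le (Measure.le_add_right le_rfl)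
  have ac2 : μ₂ ≪ ν := Measure.absolutelyContinuous_of_le (Measure.le_add_left le_rfl)
  set h₁ : HSpace n → ℝ := fun x => (μ₁.rnDeriv ν x).toReal with hh₁
  set h₂ : HSpace n → ℝ := fun x => (μ₂.rnDeriv ν x).toReal with hh₂
  have ia : ∀ K, IsCompact K → K ⊆ Ω → IntegrableOn (fun x => h₁ x • a x) K ν :=
    fun K hK hKΩ => integrableOn_rnDeriv_smul ac1 hK.measurableSet
      ((ha.integrableOn_compact_subset hKΩ hK).mono_measure Measure.restrict_le_self)
  have ib : ∀ K, IsCompact K → K ⊆ Ω → IntegrableOn (fun x => h₂ x • b x) K ν :=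
    fun K hK hKΩ => integrableOn_rnDeriv_smul ac2 hK.measurableSet
      ((hb.integrableOn_compact_subset hKΩ hK).mono_measure Measure.restrict_le_self)
  have la : LocallyIntegrableOn (fun x => h₁ x • a x) Ω ν :=
    (locallyIntegrableOn_iff hΩ.isLocallyClosed).mpr fun K hKΩ hK => ia K hK hKΩ
  have lb : LocallyIntegrableOn (fun x => h₂ x • b x) Ω ν :=
    (locallyIntegrableOn_iff hΩ.isLocallyClosed).mpr fun K hKΩ hK => ib K hK hKΩ
  have hae : ∀ᵐ x ∂ν, x ∈ Ω → h₁ x • a x - h₂ x • b x = 0 := by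
    refine hΩ.ae_eq_zero_of_integral_contDiff_smul_eq_zero (la.sub lb) fun f hf hfc hfΩ => ?_
    have hfr : IsTestFun Ω f := ⟨hf, hfc, hfΩ⟩
    have one : IsLocBddBorel Ω fun _ => (1 : ℝ) :=
      isLocBddBorel_of_continuousOn hΩ continuousOn_const
    have key : ∀ g : HSpace n → ℂ, LocallyIntegrableOn g Ω ν →
        Integrable (fun x => f x • g x) ν := by
      intro g hg
      have := one.integrable_mul hg hfr.ofReal.1.continuous hfr.ofReal.2.1 hfr.ofReal.2.2
      refine this.congr (Eventually.of_forall fun x => ?_)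
      simp [mul_comm]
    simp only [smul_sub]
    rw [integral_sub (key _ la) (key _ lb), sub_eq_zero]
    simp_rw [smul_comm (f _) (h₁ _), smul_comm (f _) (h₂ _)]
    rw [integral_rnDeriv_smul ac1, integral_rnDeriv_smul ac2]
    exact hab f hfr
  rw [← integral_rnDeriv_smul ac1, ← integral_rnDeriv_smul ac2]
  refine integral_congr_ae ?_
  filter_upwards [hae] with x hx
  by_cases hxΩ : x ∈ Ω
  · have h := sub_eq_zero.mp (hx hxΩ)
    simp only [Complex.real_smul] at h ⊢
    calc _ = (u x : ℂ) * ((h₁ x : ℂ) * a x) * f x := by ring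
      _ = _ := by rw [h]; ring
  · rw [image_eq_zero_of_notMem_tsupport fun h => hxΩ (hfΩ h)]
    simp

theorem LocallyIntegrableOn.apply {μ : Measure (HSpace n)} (hΩ : IsOpen Ω) {g : QForm n}
    (hg : LocallyIntegrableOn g Ω μ) (I : Finset (Fin (n * 2))) :
    LocallyIntegrableOn (fun x => g x I) Ω μ := by
  rw [locallyIntegrableOn_iff hΩ.isLocallyClosed] at hg ⊢
  intro K hKΩ hK
  exact (ContinuousLinearMap.proj (R := ℝ) (φ := fun _ : Finset (Fin (n * 2)) => ℂ)
    I).integrable_comp (hg K hKΩ hK)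

theorem IsTestForm.apply {η : QForm n} (hη : IsTestForm Ω η) (I : Finset (Fin (n * 2))) :
    IsTestFun Ω fun x => η x I :=
  IsTestFun.of_eq_zero (f := η) hη (contDiff_pi.mp hη.1 I) fun x hx => by simp [hx]

theorem IsTestFun.smul_const {f : HSpace n → ℂ} (hf : IsTestFun Ω f) (v : Lam n) :
    IsTestForm Ω fun x => f x • v :=
  IsTestFun.of_eq_zero hf (hf.1.smul contDiff_const) fun x hx => by simp [hx]

/-- The integral of `u Σ_I g_I η_I` splits. -/
theorem setIntegral_density_eq_sum {μ : Measure (HSpace n)} (hΩ : IsOpen Ω)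
    {g : QForm n} (hg : LocallyIntegrableOn g Ω μ) {u : HSpace n → ℝ} (hu : IsLocBddBorel Ω u)
    {η : QForm n} (hη : IsTestForm Ω η) :
    ∫ x in Ω, (u x : ℂ) * ∑ I, g x I * η x I ∂μ =
      ∑ I, ∫ x in Ω, (u x : ℂ) * (g x I * η x I) ∂μ := by
  simp only [Finset.mul_sum]
  refine integral_finsetSum _ fun I _ => ?_
  exact (hu.integrable_mul (LocallyIntegrableOn.apply hΩ hg I) (hη.apply I).1.continuous
    (hη.apply I).2.1 (hη.apply I).2.2).integrableOn

/-- Test forms fω^I isolate the coefficient measures g_I μ, which are thus determined by T. This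
makes the choice of a density in `mulCurrent` immaterial. -/
theorem HasDensity.integral_unique (hΩ : IsOpen Ω) {T : QCurrent n} {μ μ' : Measure (HSpace n)}
    {g g' : QForm n} (h : HasDensity Ω T μ g) (h' : HasDensity Ω T μ' g') {u : HSpace n → ℝ}
    (hu : IsLocBddBorel Ω u) {η : QForm n} (hη : IsTestForm Ω η) :
    ∫ x in Ω, (u x : ℂ) * ∑ I, g x I * η x I ∂μ =
      ∫ x in Ω, (u x : ℂ) * ∑ I, g' x I * η x I ∂μ' := by
  rw [setIntegral_density_eq_sum hΩ h.2.1 hu hη, setIntegral_density_eq_sum hΩ h'.2.1 hu hη]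
  refine Finset.sum_congr rfl fun I _ => ?_
  refine integral_mul_eq_of_test hΩ h.1 h'.1 (LocallyIntegrableOn.apply hΩ h.2.1 I)
    (LocallyIntegrableOn.apply hΩ h'.2.1 I) (fun f hf => ?_) u (hη.apply I).2.2
  have h1 := h.2.2 _ (hf.ofReal.smul_const (omega I))
  have h2 := h'.2.2 _ (hf.ofReal.smul_const (omega I))
  have e : ∀ (g : QForm n) x, ∑ J, g x J * ((f x : ℂ) • omega I) J = f x • g x I := by
    intro g x
    simp [omega, Pi.single_apply, mul_comm]
  simp only [e] at h1 h2
  rw [← h1, ← h2]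

/-- The product `uT` may be computed by any density. -/
theorem HasDensity.mulCurrent_eq (hΩ : IsOpen Ω) {T : QCurrent n} {μ : Measure (HSpace n)}
    {g : QForm n} (h : HasDensity Ω T μ g) {u : HSpace n → ℝ}
    (hu : IsLocBddBorel Ω u) {η : QForm n} (hη : IsTestForm Ω η) :
    mulCurrent Ω u T η = ∫ x in Ω, (u x : ℂ) * ∑ I, g x I * η x I ∂μ := by
  have hex : HasMeasureCoefficients Ω T := ⟨μ, g, h⟩
  rw [mulCurrent, dif_pos hex]
  exact HasDensity.integral_unique hΩ hex.choose_spec.choose_spec h hu hη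

/-! ### Representation by finitely many positive measures -/

/-- `T(η) = ∑_s c_s ∫ η_{I_s} dm_s` for finitely many Radon measures `m_s` on `Ω`. -/
structure IsMeasureRep {ι : Type} [Fintype ι] (Ω : Set (HSpace n)) (T : QCurrent n)
    (m : ι → Measure (HSpace n)) (c : ι → ℂ) (idx : ι → Finset (Fin (n * 2))) : Prop where
  null : ∀ s, m s Ωᶜ = 0
  radon : ∀ s, IsRadonOn Ω (m s)
  eq : ∀ η, IsTestForm Ω η → T η = ∑ s, c s * ∫ x, η x (idx s) ∂(m s)

variable {ι : Type} [Fintype ι] {T : QCurrent n} {m : ι → Measure (HSpace n)} {c : ι → ℂ}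
  {idx : ι → Finset (Fin (n * 2))}

/-- Take for ν the sum of the m_s, and as coefficient at I the sum of c_s dm_s/dν over those s with
I_s = I. The second clause allows uT to be computed directly from the m_s. -/
theorem IsMeasureRep.exists_density (hΩ : IsOpen Ω) (h : IsMeasureRep Ω T m c idx) :
    ∃ (ν : Measure (HSpace n)) (g : QForm n), HasDensity Ω T ν g ∧
      ∀ u, IsLocBddBorel Ω u → ∀ η, IsTestForm Ω η →
        ∫ x in Ω, (u x : ℂ) * ∑ I, g x I * η x I ∂ν =
          ∑ s, c s * ∫ x, (u x : ℂ) * η x (idx s) ∂(m s) := by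
  classical
  set ν : Measure (HSpace n) := ∑ s, m s with hν
  have hνapp : ∀ A, ν A = ∑ s, m s A := fun A => by simp [hν]
  have hνnull : ν Ωᶜ = 0 := by rw [hνapp]; exact Finset.sum_eq_zero fun s _ => h.null s
  have hνradon : IsRadonOn Ω ν := fun K hK hKΩ => by
    rw [hνapp]
    exact ENNReal.sum_lt_top.mpr fun s _ => h.radon s K hK hKΩ
  have hνr := restrict_eq_self_of_null hνnull
  have sν : SigmaFinite ν := by rw [← hνr]; exact hνradon.sigmaFinite_restrict hΩ
  have sm : ∀ s, SigmaFinite (m s) := fun s => by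
    rw [← restrict_eq_self_of_null (h.null s)]; exact (h.radon s).sigmaFinite_restrict hΩ
  have ac : ∀ s, m s ≪ ν := fun s => Measure.absolutelyContinuous_of_le (by
    rw [hν]; exact Finset.single_le_sum (fun _ _ => Measure.zero_le _) (Finset.mem_univ s))
  let d : ι → HSpace n → ℝ := fun s x => ((m s).rnDeriv ν x).toReal
  let g : QForm n := fun x I => ∑ s, if idx s = I then c s * d s x else 0
  have hdloc : ∀ s K, IsCompact K → K ⊆ Ω → IntegrableOn (fun x => (d s x : ℂ)) K ν := by
    intro s K hK hKΩ
    have := integrableOn_rnDeriv_smul (ac s) hK.measurableSet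
      (integrableOn_const (μ := m s) (C := (1 : ℂ)) (h.radon s K hK hKΩ).ne)
    simpa using this
  have hgloc : LocallyIntegrableOn g Ω ν := by
    rw [locallyIntegrableOn_iff hΩ.isLocallyClosed]
    intro K hKΩ hK
    refine Integrable.of_eval fun I => ?_
    refine integrable_finsetSum _ fun s _ => ?_
    by_cases hs : idx s = I
    · simp only [hs, if_true]
      exact (hdloc s K hK hKΩ).const_mul _
    · simp only [hs, if_false]
      exact integrable_zero _ _ _
  have main : ∀ u, IsLocBddBorel Ω u → ∀ η, IsTestForm Ω η →
        ∫ x in Ω, (u x : ℂ) * ∑ I, g x I * η x I ∂ν =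
          ∑ s, c s * ∫ x, (u x : ℂ) * η x (idx s) ∂(m s) := by
    intro u hu η hη
    rw [hνr]
    have e1 : ∀ x, (u x : ℂ) * ∑ I, g x I * η x I =
        ∑ s, c s * (d s x • ((u x : ℂ) * η x (idx s))) := by
      intro x
      simp only [g, Finset.sum_mul, ite_mul, zero_mul]
      rw [Finset.sum_comm, Finset.mul_sum]
      refine Finset.sum_congr rfl fun s _ => ?_
      rw [Finset.sum_ite_eq]
      simp only [Finset.mem_univ, if_true, Complex.real_smul]
      ring
    simp only [e1]
    have hi : ∀ s, Integrable (fun x => d s x • ((u x : ℂ) * η x (idx s))) ν := fun s =>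
      (integrable_rnDeriv_smul_iff (ac s)).mpr (hu.integrable_mul' hΩ (h.radon s)
        (hη.apply _).1.continuous (hη.apply _).2.1 (hη.apply _).2.2)
    rw [integral_finsetSum _ fun s _ => (hi s).const_mul _]
    refine Finset.sum_congr rfl fun s _ => ?_
    rw [integral_const_mul, integral_rnDeriv_smul (ac s)]
  refine ⟨ν, g, ⟨hνradon, hgloc, fun η hη => ?_⟩, main⟩
  have h1 := main (fun _ => 1) (isLocBddBorel_of_continuousOn hΩ continuousOn_const) η hη
  simp only [Complex.ofReal_one, one_mul] at h1
  rw [h1, h.eq η hη]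

theorem IsMeasureRep.hasMeasureCoefficients (hΩ : IsOpen Ω) (h : IsMeasureRep Ω T m c idx) :
    HasMeasureCoefficients Ω T := by
  obtain ⟨ν, g, hd, -⟩ := h.exists_density hΩ
  exact ⟨ν, g, hd⟩

theorem IsMeasureRep.mulCurrent_eq (hΩ : IsOpen Ω) (h : IsMeasureRep Ω T m c idx)
    {u : HSpace n → ℝ} (hu : IsLocBddBorel Ω u) {η : QForm n} (hη : IsTestForm Ω η) :
    mulCurrent Ω u T η = ∑ s, c s * ∫ x, (u x : ℂ) * η x (idx s) ∂(m s) := by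
  obtain ⟨ν, g, hd, hm⟩ := h.exists_density hΩ
  rw [hd.mulCurrent_eq hΩ hu hη, hm u hu η hη]

end Density

/-! ### Weak convergence and comparison of measures -/

section Weak

variable {n : ℕ} {Ω : Set (HSpace n)}

theorem continuous_mul_of_tsupport_subset (hΩ : IsOpen Ω) {θ w : HSpace n → ℝ}
    (hθ : Continuous θ) (hθΩ : tsupport θ ⊆ Ω) (hw : ContinuousOn w Ω) :
    Continuous fun x => θ x * w x := by
  refine continuous_iff_continuousAt.mpr fun x => ?_
  by_cases hx : x ∈ tsupport θ
  · exact hθ.continuousAt.mul (hw.continuousAt (hΩ.mem_nhds (hθΩ hx)))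
  · have : (fun x => θ x * w x) =ᶠ[𝓝 x] fun _ => 0 := by
      filter_upwards [(isClosed_tsupport θ).isOpen_compl.mem_nhds hx] with y hy
      rw [image_eq_zero_of_notMem_tsupport hy, zero_mul]
    exact continuousAt_const.congr this.symm

/-- On the support of ζ both w_j and v are close to one smooth function p, and weak convergence
applies to pζ. The errors are controlled because the masses of the μ_j near that support, measured
by a cutoff θ, converge and hence stay bounded. -/
theorem tendsto_integral_mul_of_weak (hΩ : IsOpen Ω) {μ : ℕ → Measure (HSpace n)}
    {ν : Measure (HSpace n)} (hμ : ∀ j, IsRadonOn Ω (μ j)) (hν : IsRadonOn Ω ν)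
    (hweak : ∀ f : HSpace n → ℂ, IsTestFun Ω f →
      Tendsto (fun j => ∫ x, f x ∂(μ j)) atTop (𝓝 (∫ x, f x ∂ν)))
    {w : ℕ → HSpace n → ℝ} {v : HSpace n → ℝ} (hw : ∀ j, IsLocBddBorel Ω (w j))
    (hv : ContinuousOn v Ω)
    (hwv : ∀ K, IsCompact K → K ⊆ Ω → TendstoUniformlyOn w v atTop K)
    {ζ : HSpace n → ℂ} (hζ : IsTestFun Ω ζ) :
    Tendsto (fun j => ∫ x, (w j x : ℂ) * ζ x ∂(μ j)) atTop (𝓝 (∫ x, (v x : ℂ) * ζ x ∂ν)) := by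
  obtain ⟨θ, hθ, hθ01, hθ1⟩ := exists_cutoff hΩ hζ.2.1 hζ.2.2
  have hθK : ∀ x ∈ tsupport ζ, θ x = 1 := fun x hx => hθ1.self_of_nhdsSet x hx
  obtain ⟨Z, hZ⟩ := hζ.2.1.exists_bound_of_continuous hζ.1.continuous
  have hZ0 : 0 ≤ Z := (norm_nonneg _).trans (hZ 0)
  have hθint : ∀ m : Measure (HSpace n), IsRadonOn Ω m → Integrable θ m := by
    intro m hm
    have := (isLocBddBorel_of_continuousOn hΩ (continuousOn_const (c := (1 : ℝ)))).integrable_mul'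
      hΩ hm hθ.ofReal.1.continuous hθ.ofReal.2.1 hθ.ofReal.2.2
    simpa using this.re
  have hθconv : Tendsto (fun j => ∫ x, θ x ∂(μ j)) atTop (𝓝 (∫ x, θ x ∂ν)) := by
    have h := hweak _ hθ.ofReal
    simp only [integral_complex_ofReal] at h
    exact (Complex.continuous_re.tendsto _).comp h
  obtain ⟨M, hM⟩ := hθconv.bddAbove_range
  have hM' : ∀ j, ∫ x, θ x ∂(μ j) ≤ M := fun j => hM ⟨j, rfl⟩
  have hθnn : ∀ m : Measure (HSpace n), 0 ≤ ∫ x, θ x ∂m := fun m =>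
    integral_nonneg fun x => (hθ01 x).1
  set N := ∫ x, θ x ∂ν with hN
  have hM0 : 0 ≤ M := (hθnn _).trans (hM' 0)
  have hN0 : 0 ≤ N := hθnn ν
  have hvl := isLocBddBorel_of_continuousOn hΩ hv
  -- the basic estimate
  have est : ∀ (m : Measure (HSpace n)), IsRadonOn Ω m → ∀ a b : HSpace n → ℝ,
      IsLocBddBorel Ω a → IsLocBddBorel Ω b → ∀ δ : ℝ, 0 ≤ δ →
      (∀ x ∈ tsupport ζ, |a x - b x| ≤ δ) →
      ‖∫ x, (a x : ℂ) * ζ x ∂m - ∫ x, (b x : ℂ) * ζ x ∂m‖ ≤ δ * Z * ∫ x, θ x ∂m := by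
    intro m hm a b ha hb δ hδ hab
    rw [← integral_sub (ha.integrable_mul' hΩ hm hζ.1.continuous hζ.2.1 hζ.2.2)
      (hb.integrable_mul' hΩ hm hζ.1.continuous hζ.2.1 hζ.2.2), ← integral_const_mul]
    refine norm_integral_le_of_norm_le ((hθint m hm).const_mul _) (Eventually.of_forall fun x => ?_)
    by_cases hx : x ∈ tsupport ζ
    · rw [← sub_mul, norm_mul, ← Complex.ofReal_sub, Complex.norm_real, hθK x hx, mul_one]
      exact mul_le_mul (hab x hx) (hZ x) (norm_nonneg _) hδ
    · rw [image_eq_zero_of_notMem_tsupport hx]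
      simpa using mul_nonneg (mul_nonneg hδ hZ0) (hθ01 x).1
  rw [Metric.tendsto_atTop]
  intro ε hε
  -- Replacing w_j by p costs at most 2δZM and replacing v by p at most δZN. With δD = ε/2 both
  -- together stay below ε/2, and the other half is left for weak convergence.
  set D := 2 * Z * M + Z * N + 1 with hD
  have hDpos : 0 < D := by positivity
  set δ := ε / (2 * D) with hδdef
  have hδ : 0 < δ := by positivity
  obtain ⟨p, hp, hpa, -⟩ := (continuous_mul_of_tsupport_subset hΩ hθ.1.continuous hθ.2.2
    hv).exists_contDiff_approx ⊤ (ε := fun _ => δ) continuous_const (fun _ => hδ)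
  have hpv : ∀ x ∈ tsupport ζ, |p x - v x| ≤ δ := by
    intro x hx
    have := hpa x
    rw [hθK x hx, one_mul, Real.dist_eq] at this
    exact this.le
  have hpl : IsLocBddBorel Ω p := isLocBddBorel_of_continuousOn hΩ hp.continuous.continuousOn
  have hpζ : IsTestFun Ω fun x => (p x : ℂ) * ζ x :=
    hζ.of_eq_zero ((Complex.ofRealCLM.contDiff.comp hp).mul hζ.1) fun x hx => by simp [hx]
  have hconv := Metric.tendsto_atTop.mp (hweak _ hpζ) (ε / 2) (by positivity)
  obtain ⟨j₁, hj₁⟩ := hconv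
  obtain ⟨j₂, hj₂⟩ := eventually_atTop.mp
    (Metric.tendstoUniformlyOn_iff.mp (hwv _ hζ.2.1 hζ.2.2) δ hδ)
  refine ⟨max j₁ j₂, fun j hj => ?_⟩
  have hj1 := hj₁ j (le_of_max_le_left hj)
  have hj2 := hj₂ j (le_of_max_le_right hj)
  have e1 := est (μ j) (hμ j) (w j) p (hw j) hpl (2 * δ) (by positivity) (fun x hx => by
    have h1 := (hj2 x hx).le
    rw [Real.dist_eq, abs_sub_comm] at h1
    have h2 := hpv x hx
    rw [abs_sub_comm] at h2
    calc |w j x - p x| = |(w j x - v x) + (v x - p x)| := by ring_nf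
      _ ≤ _ := (abs_add_le _ _).trans (by linarith))
  have e2 := est ν hν p v hpl hvl δ hδ.le hpv
  rw [dist_eq_norm] at hj1 ⊢
  have e3 : ∫ x, (w j x : ℂ) * ζ x ∂(μ j) - ∫ x, (v x : ℂ) * ζ x ∂ν =
      (∫ x, (w j x : ℂ) * ζ x ∂(μ j) - ∫ x, (p x : ℂ) * ζ x ∂(μ j)) +
      ((∫ x, (p x : ℂ) * ζ x ∂(μ j) - ∫ x, (p x : ℂ) * ζ x ∂ν) +
      (∫ x, (p x : ℂ) * ζ x ∂ν - ∫ x, (v x : ℂ) * ζ x ∂ν)) := by ring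
  rw [e3]
  have e4 : 2 * δ * Z * ∫ x, θ x ∂(μ j) ≤ 2 * δ * Z * M :=
    mul_le_mul_of_nonneg_left (hM' j) (by positivity)
  have e5 : 2 * δ * Z * M + δ * Z * N < ε / 2 := by
    have : δ * D = ε / 2 := by rw [hδdef]; field_simp
    rw [← this, hD]
    nlinarith
  calc _ ≤ _ := norm_add_le _ _
    _ ≤ _ := add_le_add_right (norm_add_le _ _) _
    _ < ε := by linarith

/-- Comparison of Radon measures on `Ω` by nonnegative test functions. -/
theorem measure_le_of_test (hΩ : IsOpen Ω) {μ ν : Measure (HSpace n)} (hμ0 : μ Ωᶜ = 0)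
    (hμ : IsRadonOn Ω μ) (hν : IsRadonOn Ω ν)
    (h : ∀ f : HSpace n → ℝ, IsTestFun Ω f → (∀ x, 0 ≤ f x) → ∫ x, f x ∂μ ≤ ∫ x, f x ∂ν) :
    μ ≤ ν := by
  have hInt : ∀ m : Measure (HSpace n), IsRadonOn Ω m → ∀ f : HSpace n → ℝ, IsTestFun Ω f →
      Integrable f m := by
    intro m hm f hf
    have := (isLocBddBorel_of_continuousOn hΩ (continuousOn_const (c := (1 : ℝ)))).integrable_mul'
      hΩ hm hf.ofReal.1.continuous hf.ofReal.2.1 hf.ofReal.2.2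
    simpa using this.re
  -- compact sets
  have hcomp : ∀ K, IsCompact K → K ⊆ Ω → μ K ≤ ν K := by
    intro K hK hKΩ
    obtain ⟨L, hL, hKL, hLΩ⟩ := exists_compact_between hK hΩ hKΩ
    -- Test with a cutoff equal to 1 on K and supported in O ∩ interior L. The compact L keeps all
    -- masses finite while O shrinks to K by outer regularity.
    have key : ∀ O : Set (HSpace n), IsOpen O → K ⊆ O → μ K ≤ ν (O ∩ L) := by
      intro O hO hKO
      obtain ⟨θ, hθ, hθ01, hθ1⟩ := exists_cutoff (hO.inter isOpen_interior) hK
        (subset_inter hKO hKL)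
      have hθΩ : IsTestFun Ω θ :=
        hθ.mono (inter_subset_right.trans (interior_subset.trans hLΩ))
      have h1 := h θ hθΩ fun x => (hθ01 x).1
      have hKfin := (hμ K hK hKΩ).ne
      have hLfin : ν (O ∩ L) ≠ ⊤ :=
        ((measure_mono inter_subset_right).trans_lt (hν L hL hLΩ)).ne
      have hOL : MeasurableSet (O ∩ L) := hO.measurableSet.inter hL.measurableSet
      have h2 : μ.real K ≤ ∫ x, θ x ∂μ := by
        rw [← integral_indicator_one hK.measurableSet]
        refine integral_mono ?_ (hInt μ hμ θ hθΩ) fun x => ?_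
        · exact (integrable_indicator_iff hK.measurableSet).mpr (integrableOn_const hKfin)
        · by_cases hx : x ∈ K
          · simp [hx, hθ1.self_of_nhdsSet x hx]
          · simp [hx, (hθ01 x).1]
      have h3 : ∫ x, θ x ∂ν ≤ ν.real (O ∩ L) := by
        rw [← integral_indicator_one hOL]
        refine integral_mono (hInt ν hν θ hθΩ) ?_ fun x => ?_
        · exact (integrable_indicator_iff hOL).mpr (integrableOn_const hLfin)
        · by_cases hx : x ∈ O ∩ L
          · simp [hx, (hθ01 x).2]
          · rw [hθ.eq_zero fun h => hx ⟨h.1, interior_subset h.2⟩]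
            simp [hx]
      exact (ENNReal.toReal_le_toReal hKfin hLfin).mp ((h2.trans h1).trans h3)
    -- outer regularity of the finite measure `ν` restricted to `L`
    have : IsFiniteMeasure (ν.restrict L) := ⟨by simpa using hν L hL hLΩ⟩
    have hKL' : ν.restrict L K = ν K := by
      rw [Measure.restrict_apply hK.measurableSet,
        inter_eq_left.mpr (hKL.trans interior_subset)]
    rw [← hKL', K.measure_eq_iInf_isOpen (ν.restrict L)]
    refine le_iInf fun O => le_iInf fun hKO => le_iInf fun hO => ?_
    rw [Measure.restrict_apply hO.measurableSet]
    exact key O hO hKO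
  have : LocallyCompactSpace Ω := hΩ.locallyCompactSpace
  obtain ⟨K, hK, hKΩ⟩ : IsSigmaCompact Ω :=
    isSigmaCompact_iff_sigmaCompactSpace.mpr inferInstance
  -- A Borel set is exhausted by its intersections with compact subsets of Ω, and each of these is
  -- approximated from inside by compact sets.
  refine Measure.le_iff.mpr fun A hA => ?_
  have hA' : μ A = μ (A ∩ Ω) := by
    rw [← Measure.restrict_apply hA, restrict_eq_self_of_null hμ0]
  have hU : A ∩ Ω = ⋃ j, A ∩ accumulate K j := by
    rw [← inter_iUnion, iUnion_accumulate, hKΩ]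
  rw [hA', hU, Monotone.measure_iUnion fun i j hij =>
    inter_subset_inter_right A (monotone_accumulate hij)]
  refine iSup_le fun j => ?_
  have hL : IsCompact (accumulate K j) := isCompact_accumulate hK j
  have hLΩ : accumulate K j ⊆ Ω := by
    rw [← hKΩ, ← iUnion_accumulate]
    exact subset_iUnion _ j
  have : IsFiniteMeasure (μ.restrict (accumulate K j)) := ⟨by simpa using hμ _ hL hLΩ⟩
  rw [← Measure.restrict_apply hA, hA.measure_eq_iSup_isCompact_of_ne_top (measure_ne_top _ _)]
  refine iSup_le fun C => iSup_le fun hCA => iSup_le fun hC => ?_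
  rw [Measure.restrict_apply hC.measurableSet]
  exact (hcomp _ (hC.inter hL) (inter_subset_right.trans hLΩ)).trans
    (measure_mono (inter_subset_left.trans hCA))

end Weak

/-! ### Right quaternionic lines -/

section Lines

variable {n : ℕ}

/-- The product `v q`. -/
def rlin (v : HSpace n) (q : EuclideanSpace ℝ (Fin 4)) : HSpace n := rightLine 0 v q

theorem rlin_apply (v : HSpace n) (q : EuclideanSpace ℝ (Fin 4)) (p : RIdx n) :
    rlin v q p = rmul q v p := by
  simp [rlin, rightLine_apply]

theorem rightLine_eq_add (a v : HSpace n) (q : EuclideanSpace ℝ (Fin 4)) :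
    rightLine a v q = a + rlin v q := by
  ext p
  simp [rightLine_apply, rlin_apply]

theorem rlin_add (v w : HSpace n) (q : EuclideanSpace ℝ (Fin 4)) :
    rlin (v + w) q = rlin v q + rlin w q := by
  ext p
  simp [rlin_apply, rmul, mul_add, Finset.sum_add_distrib]

theorem rlin_smul (t : ℝ) (v : HSpace n) (q : EuclideanSpace ℝ (Fin 4)) :
    rlin (t • v) q = t • rlin v q := by
  ext p
  simp [rlin_apply, rmul, Finset.mul_sum, mul_left_comm]

theorem rlin_zero_left (q : EuclideanSpace ℝ (Fin 4)) : rlin (0 : HSpace n) q = 0 := by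
  ext p
  simp [rlin_apply, rmul]

theorem norm_rlin (v : HSpace n) (q : EuclideanSpace ℝ (Fin 4)) :
    ‖rlin v q‖ = ‖v‖ * ‖q‖ := by
  rw [← sq_eq_sq₀ (norm_nonneg _) (by positivity), mul_pow, EuclideanSpace.norm_sq_eq,
    EuclideanSpace.norm_sq_eq, EuclideanSpace.norm_sq_eq, Fintype.sum_prod_type,
    Fintype.sum_prod_type, Finset.sum_mul]
  refine Finset.sum_congr rfl fun l _ => ?_
  simp only [rlin_apply, rmul, Fin.sum_univ_four, Real.norm_eq_abs, sq_abs]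
  simp [rmulMatrix]
  ring

theorem continuous_rlin : Continuous fun p : HSpace n × EuclideanSpace ℝ (Fin 4) =>
    rlin p.1 p.2 := by
  have h : Continuous fun x : HSpace n × EuclideanSpace ℝ (Fin 4) =>
      (fun p : RIdx n => rmul x.2 x.1 p) := by
    refine continuous_pi fun p => ?_
    obtain ⟨l, k⟩ := p
    simp only [rmul, Fin.sum_univ_four]
    fin_cases k <;> simp [rmulMatrix] <;> fun_prop
  refine ((PiLp.continuous_toLp 2 (fun _ : RIdx n => ℝ)).comp h).congr fun x => ?_
  ext p
  simp [rlin_apply]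

theorem continuous_rlin_right (v : HSpace n) :
    Continuous fun q : EuclideanSpace ℝ (Fin 4) => rlin v q :=
  (continuous_rlin (n := n)).comp (f := fun q => (v, q)) (by fun_prop)

/-- Right multiplication by `q ≠ 0` as a linear equivalence. -/
def rlinEquiv (n : ℕ) (q : EuclideanSpace ℝ (Fin 4)) (hq : q ≠ 0) : HSpace n ≃ₗ[ℝ] HSpace n :=
  LinearEquiv.ofInjectiveEndo
    { toFun := fun v => rlin v q
      map_add' := fun v w => rlin_add v w q
      map_smul' := fun t v => rlin_smul t v q }
    (by
      rw [← LinearMap.ker_eq_bot, LinearMap.ker_eq_bot']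
      intro v hv
      have h : ‖rlin v q‖ = 0 := by
        rw [norm_eq_zero]
        exact hv
      rw [norm_rlin] at h
      simpa [hq] using h)

theorem rlinEquiv_apply (q : EuclideanSpace ℝ (Fin 4)) (hq : q ≠ 0) (v : HSpace n) :
    rlinEquiv n q hq v = rlin v q := rfl

end Lines

/-! ### The sub-mean value property on small quaternionic lines -/

section SubMean

variable {n : ℕ}

/-- The unit ball of `ℍ`. -/
abbrev qBall : Set (EuclideanSpace ℝ (Fin 4)) := Metric.ball 0 1

/-- The uniform probability measure on the unit ball of `ℍ`. -/
def qUnif : Measure (EuclideanSpace ℝ (Fin 4)) :=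
  (volume qBall)⁻¹ • volume.restrict qBall

instance : IsProbabilityMeasure qUnif := by
  refine ⟨?_⟩
  simp only [qUnif, Measure.smul_apply, Measure.restrict_apply_univ, smul_eq_mul]
  exact ENNReal.inv_mul_cancel (Metric.measure_ball_pos volume _ one_pos).ne'
    measure_ball_lt_top.ne

theorem integral_qUnif {E : Type*} [NormedAddCommGroup E] [NormedSpace ℝ E]
    (f : EuclideanSpace ℝ (Fin 4) → E) : ∫ q, f q ∂qUnif = ⨍ q in qBall, f q := by
  rw [qUnif, setAverage_eq', ← ProbabilityTheory.cond]

theorem ae_qUnif_mem : ∀ᵐ q ∂qUnif, q ∈ qBall := by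
  refine Measure.ae_smul_measure ?_ _
  exact ae_restrict_mem Metric.isOpen_ball.measurableSet

theorem ae_qUnif_ne_zero : ∀ᵐ q ∂qUnif, q ≠ 0 := by
  refine Measure.ae_smul_measure ?_ _
  refine ae_restrict_of_ae ?_
  rw [ae_iff]
  simp

/-- The sub-mean value inequality at `x` on all right quaternionic lines, for radii at most `ρ`. -/
def SubMean (f : HSpace n → ℝ) (ρ : ℝ) (x : HSpace n) : Prop :=
  ∀ v : HSpace n, ‖v‖ ≤ ρ → f x ≤ ∫ q, f (x + rlin v q) ∂qUnif

theorem integrable_of_bounded_measurable {Y : Type*} [MeasurableSpace Y] {μ : Measure Y}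
    [IsFiniteMeasure μ] {f : Y → ℝ} (hf : Measurable f) {M : ℝ} (hM : ∀ x, |f x| ≤ M) :
    Integrable f μ :=
  Integrable.of_bound hf.aestronglyMeasurable M (Eventually.of_forall hM)

/-- The sub-mean value property is preserved by averages of translates. -/
theorem SubMean.average {Y : Type*} [MeasurableSpace Y] (μ : Measure Y) [IsFiniteMeasure μ]
    {s : Y → HSpace n} (hs : Measurable s) {f : HSpace n → ℝ} (hf : Measurable f) {M : ℝ}
    (hM : ∀ x, |f x| ≤ M) {ρ : ℝ} {x : HSpace n} (h : ∀ᵐ y ∂μ, SubMean f ρ (x + s y)) :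
    SubMean (fun z => ∫ y, f (z + s y) ∂μ) ρ x := by
  intro v hv
  have hm : Measurable fun p : EuclideanSpace ℝ (Fin 4) × Y => f (x + rlin v p.1 + s p.2) :=
    hf.comp (((continuous_rlin_right v).measurable.comp measurable_fst).const_add x |>.add
      (hs.comp measurable_snd))
  have hswap : ∫ q, ∫ y, f (x + rlin v q + s y) ∂μ ∂qUnif =
      ∫ y, ∫ q, f (x + rlin v q + s y) ∂qUnif ∂μ :=
    integral_integral_swap (integrable_of_bounded_measurable hm fun _ => hM _)
  rw [hswap]
  refine integral_mono_ae ?_ ?_ ?_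
  · exact integrable_of_bounded_measurable (hf.comp (hs.const_add x)) fun _ => hM _
  · exact (integrable_of_bounded_measurable (μ := qUnif.prod μ) hm
      fun _ => hM _).integral_prod_right
  · filter_upwards [h] with y hy
    refine (hy v hv).trans_eq (integral_congr_ae (Eventually.of_forall fun q => ?_))
    simp only
    congr 1
    abel

end SubMean

/-! ### The Hessian of a smooth function with the sub-mean value property -/

section Hessian

variable {n : ℕ}

theorem pd_pd_eq {u : HSpace n → ℝ} (hu : ContDiff ℝ ∞ u) (p q : RIdx n) (x : HSpace n) :
    pd p (pd q u) x =
      fderiv ℝ (fderiv ℝ u) x (EuclideanSpace.single p 1) (EuclideanSpace.single q 1) := by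
  have hd : DifferentiableAt ℝ (fderiv ℝ u) x :=
    ((hu.fderiv_right (m := ∞) le_rfl).differentiable (by simp)).differentiableAt
  unfold pd
  rw [fderiv_clm_apply hd (differentiableAt_const _)]
  simp

theorem fderiv_fderiv_eq_dotProduct {u : HSpace n → ℝ} (hu : ContDiff ℝ ∞ u) (x z : HSpace n) :
    fderiv ℝ (fderiv ℝ u) x z z = dotProduct (z : RIdx n → ℝ) ((hess u x).mulVec z) := by
  have hz : z = ∑ p, z p • EuclideanSpace.single p (1 : ℝ) := by
    ext p
    simp [Finset.sum_apply, Pi.single_apply]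
  conv_lhs => rw [hz]
  simp only [map_sum, map_smul, sum_apply, smul_apply,
    smul_eq_mul, dotProduct, Matrix.mulVec, Finset.mul_sum]
  rw [Finset.sum_comm]
  refine Finset.sum_congr rfl fun p _ => Finset.sum_congr rfl fun q _ => ?_
  simp only [hess, Matrix.of_apply, pd_pd_eq hu]
  ring

/-- The second order Taylor formula. -/
theorem taylor_second_order {u : HSpace n → ℝ} (hu : ContDiff ℝ ∞ u) (x : HSpace n) {ε : ℝ}
    (hε : 0 < ε) : ∃ δ > 0, ∀ z : HSpace n, ‖z‖ < δ →
      |u (x + z) - u x - fderiv ℝ u x z - fderiv ℝ (fderiv ℝ u) x z z / 2| ≤ ε * ‖z‖ ^ 2 := by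
  have hd1 : Differentiable ℝ u := hu.differentiable (by simp)
  have hd : HasFDerivAt (fderiv ℝ u) (fderiv ℝ (fderiv ℝ u) x) x :=
    ((hu.fderiv_right (m := ∞) le_rfl).differentiable (by simp)).differentiableAt.hasFDerivAt
  have hsym : ∀ a b, fderiv ℝ (fderiv ℝ u) x a b = fderiv ℝ (fderiv ℝ u) x b a :=
    (hu.contDiffAt (x := x)).isSymmSndFDerivAt (by simpa using ENat.LEInfty.out)
  set A := fderiv ℝ (fderiv ℝ u) x with hA
  obtain ⟨δ, hδ, hball⟩ := Metric.eventually_nhds_iff.mp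
    ((hasFDerivAt_iff_isLittleO_nhds_zero.mp hd).def hε)
  refine ⟨δ, hδ, fun z hz => ?_⟩
  -- The Taylor remainder. By symmetry of the second derivative its gradient at y is the first order
  -- remainder of `fderiv ℝ u`, at most ε‖y‖, and the mean value inequality finishes.
  let φ : HSpace n → ℝ := fun y => u (x + y) - u x - fderiv ℝ u x y - A y y / 2
  have hφ : ∀ y, HasFDerivAt φ (fderiv ℝ u (x + y) - fderiv ℝ u x - A y) y := by
    intro y
    have h1 : HasFDerivAt (fun y => u (x + y)) (fderiv ℝ u (x + y)) y :=
      by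
      have := (hd1 (x + y)).hasFDerivAt.comp y ((hasFDerivAt_id y).const_add x)
      rwa [ContinuousLinearMap.comp_id] at this
    have h2 : HasFDerivAt (fun y => A y y) (A y + A.flip y) y := by
      have := A.hasFDerivAt (x := y) |>.clm_apply (hasFDerivAt_id y)
      refine this.congr_fderiv ?_
      ext w
      simp
    have h3 := ((h1.sub_const (u x)).sub (fderiv ℝ u x).hasFDerivAt).sub
      (h2.mul_const (2⁻¹ : ℝ))
    refine (h3.congr_fderiv ?_).congr_of_eventuallyEq (Eventually.of_forall fun w => ?_)
    · ext w
      simp [hsym w y]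
      ring
    · simp [φ, div_eq_mul_inv]
  have hbound : ∀ y ∈ Metric.closedBall (0 : HSpace n) ‖z‖,
      ‖fderiv ℝ u (x + y) - fderiv ℝ u x - A y‖ ≤ ε * ‖z‖ := by
    intro y hy
    have hy' : ‖y‖ ≤ ‖z‖ := by simpa using hy
    have h4 : dist y 0 < δ := by simpa using hy'.trans_lt hz
    exact (hball h4).trans (mul_le_mul_of_nonneg_left hy' hε.le)
  have := (convex_closedBall (0 : HSpace n) ‖z‖).norm_image_sub_le_of_norm_hasFDerivWithin_le
    (fun y _ => (hφ y).hasFDerivWithinAt) hbound (by simp : (0 : HSpace n) ∈ _)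
    (by simp : z ∈ Metric.closedBall (0 : HSpace n) ‖z‖)
  have h0 : φ 0 = 0 := by simp [φ]
  rw [h0, sub_zero, sub_zero, Real.norm_eq_abs] at this
  calc _ ≤ ε * ‖z‖ * ‖z‖ := this
    _ = _ := by ring

/-- Insert the second order expansion into the sub-mean value inequalities for the directions tw and
-tw and add. The linear terms cancel, so the mean of the Hessian form over the quaternionic ball is
at least -2ε‖w‖² for every ε > 0. -/
theorem lineNonneg_hess {u : HSpace n → ℝ} (hu : ContDiff ℝ ∞ u) {x : HSpace n} {ρ : ℝ}
    (hρ : 0 < ρ) (h : SubMean u ρ x) : LineNonneg (hess u x) := by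
  intro w'
  set w : HSpace n := WithLp.toLp 2 w' with hw
  set A := fderiv ℝ (fderiv ℝ u) x with hA
  have hInt : ∀ {f : EuclideanSpace ℝ (Fin 4) → ℝ}, Continuous f → Integrable f qUnif := by
    intro f hf
    refine Integrable.smul_measure ?_ (ENNReal.inv_ne_top.mpr
      (Metric.measure_ball_pos volume _ one_pos).ne')
    exact integrableOn_ball_of_continuous hf 0 1
  have hAc : Continuous fun q : EuclideanSpace ℝ (Fin 4) => A (rlin w q) (rlin w q) :=
    ((A.continuous.comp (continuous_rlin_right w)).clm_apply (continuous_rlin_right w))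
  -- it suffices to bound the average from below
  suffices hI : 0 ≤ ∫ q, A (rlin w q) (rlin w q) ∂qUnif by
    rw [integral_qUnif, setAverage_eq, smul_eq_mul] at hI
    have hpos : 0 < (volume.real qBall)⁻¹ := by
      refine inv_pos.mpr (ENNReal.toReal_pos ?_ measure_ball_lt_top.ne)
      exact (Metric.measure_ball_pos volume _ one_pos).ne'
    have hI' := nonneg_of_mul_nonneg_right hI hpos
    refine hI'.trans_eq (integral_congr_ae (Eventually.of_forall fun q => ?_))
    have e : (rlin w q : RIdx n → ℝ) = rmul q w' := by
      funext p
      rw [rlin_apply]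
    simp only [hA, fderiv_fderiv_eq_dotProduct hu, e]
  set I := ∫ q, A (rlin w q) (rlin w q) ∂qUnif with hIdef
  have key : ∀ ε > 0, -(2 * ε * ‖w‖ ^ 2) ≤ I := by
    intro ε hε
    obtain ⟨δ, hδ, htaylor⟩ := taylor_second_order hu x hε
    obtain ⟨t, ht0, htw⟩ : ∃ t : ℝ, 0 < t ∧ t * ‖w‖ < min δ ρ := by
      refine ⟨min δ ρ / (2 * (‖w‖ + 1)), by positivity, ?_⟩
      rw [div_mul_eq_mul_div, div_lt_iff₀ (by positivity)]
      have : 0 < min δ ρ := lt_min hδ hρ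
      nlinarith [norm_nonneg w]
    have hsm : ∀ s : ℝ, |s| = t → u x ≤ ∫ q, u (x + s • rlin w q) ∂qUnif := by
      intro s hs
      have := h (s • w) (by
        rw [norm_smul, Real.norm_eq_abs, hs]
        exact (htw.trans_le (min_le_right _ _)).le)
      simpa only [rlin_smul] using this
    have hc : ∀ s : ℝ, Continuous fun q : EuclideanSpace ℝ (Fin 4) => u (x + s • rlin w q) :=
      fun s => hu.continuous.comp (continuous_const.add ((continuous_rlin_right w).const_smul s))
    have h1 := hsm t (abs_of_pos ht0)
    have h2 := hsm (-t) (by rw [abs_neg, abs_of_pos ht0])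
    have h3 : 2 * u x ≤ ∫ q, (u (x + t • rlin w q) + u (x + (-t) • rlin w q)) ∂qUnif := by
      rw [integral_add (hInt (hc _)) (hInt (hc _))]
      linarith
    have hcc : Continuous fun q => 2 * u x + t ^ 2 * A (rlin w q) (rlin w q) +
        2 * ε * t ^ 2 * ‖w‖ ^ 2 :=
      (continuous_const.add (continuous_const.mul hAc)).add continuous_const
    have h4 : ∫ q, (u (x + t • rlin w q) + u (x + (-t) • rlin w q)) ∂qUnif ≤
        ∫ q, (2 * u x + t ^ 2 * A (rlin w q) (rlin w q) + 2 * ε * t ^ 2 * ‖w‖ ^ 2) ∂qUnif := by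
      refine integral_mono_ae ((hInt (hc _)).add (hInt (hc _))) (hInt hcc) ?_
      filter_upwards [ae_qUnif_mem] with q hq
      have hq1 : ‖q‖ ≤ 1 := (by simpa using hq : ‖q‖ < 1).le
      have hz : ‖rlin w q‖ ≤ ‖w‖ := by
        rw [norm_rlin]
        exact mul_le_of_le_one_right (norm_nonneg _) hq1
      have hT : ∀ s : ℝ, |s| = t → u (x + s • rlin w q) ≤ u x + s * fderiv ℝ u x (rlin w q) +
          t ^ 2 * A (rlin w q) (rlin w q) / 2 + ε * t ^ 2 * ‖w‖ ^ 2 := by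
        intro s hs
        have hns : ‖s • rlin w q‖ ≤ t * ‖w‖ := by
          rw [norm_smul, Real.norm_eq_abs, hs]
          exact mul_le_mul_of_nonneg_left hz ht0.le
        have h5 := htaylor (s • rlin w q) (hns.trans_lt (htw.trans_le (min_le_left _ _)))
        have h6 := (abs_le.mp h5).2
        have h7 : ε * ‖s • rlin w q‖ ^ 2 ≤ ε * (t * ‖w‖) ^ 2 := by gcongr
        simp only [map_smul, smul_apply, smul_eq_mul] at h6
        have h8 : s * (s * A (rlin w q) (rlin w q)) = t ^ 2 * A (rlin w q) (rlin w q) := by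
          rw [← hs, sq_abs]; ring
        rw [← hA, h8] at h6
        nlinarith
      have h9 := hT t (abs_of_pos ht0)
      have h10 := hT (-t) (by rw [abs_neg, abs_of_pos ht0])
      linarith
    have h5 : ∫ q, (2 * u x + t ^ 2 * A (rlin w q) (rlin w q) + 2 * ε * t ^ 2 * ‖w‖ ^ 2) ∂qUnif =
        2 * u x + t ^ 2 * I + 2 * ε * t ^ 2 * ‖w‖ ^ 2 := by
      have hc1 : Continuous fun q => t ^ 2 * A (rlin w q) (rlin w q) := continuous_const.mul hAc
      have hc2 : Continuous fun q => 2 * u x + t ^ 2 * A (rlin w q) (rlin w q) :=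
        continuous_const.add hc1
      rw [integral_add (hInt hc2) (hInt continuous_const),
        integral_add (hInt continuous_const) (hInt hc1)]
      simp only [hIdef, integral_const, probReal_univ, one_smul, add_left_inj, add_right_inj]
      exact integral_const_mul _ _
    have h6 : 0 ≤ t ^ 2 * (I + 2 * ε * ‖w‖ ^ 2) := by linarith
    have h7 := nonneg_of_mul_nonneg_right h6 (by positivity)
    linarith
  by_contra hneg
  push Not at hneg
  -- For I < 0 this choice of ε gives 2ε‖w‖² < -I, which contradicts `key`.
  have := key (-I / (4 * (‖w‖ ^ 2 + 1))) (by apply div_pos <;> [linarith; positivity])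
  have h2 : 2 * (-I / (4 * (‖w‖ ^ 2 + 1))) * ‖w‖ ^ 2 < -I := by
    have h3 : 2 * (-I / (4 * (‖w‖ ^ 2 + 1))) * ‖w‖ ^ 2 =
        -I * (2 * ‖w‖ ^ 2 / (4 * (‖w‖ ^ 2 + 1))) := by ring
    rw [h3]
    refine mul_lt_of_lt_one_right (by linarith) ?_
    rw [div_lt_one (by positivity)]
    nlinarith [sq_nonneg ‖w‖]
  linarith

end Hessian

/-! ### Averaging against bump functions -/

section Bump

variable {n : ℕ}

open scoped Convolution

/-- The probability measure with density a normalized bump function. -/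
def bumpMeasure (χ : ContDiffBump (0 : HSpace n)) : Measure (HSpace n) :=
  volume.withDensity fun y => ENNReal.ofReal (χ.normed volume y)

theorem integral_bumpMeasure (χ : ContDiffBump (0 : HSpace n)) (g : HSpace n → ℝ) :
    ∫ y, g y ∂(bumpMeasure χ) = ∫ y, χ.normed volume y * g y := by
  rw [bumpMeasure, integral_withDensity_eq_integral_toReal_smul]
  · refine integral_congr_ae (Eventually.of_forall fun y => ?_)
    simp [ENNReal.toReal_ofReal (χ.nonneg_normed y)]
  · exact (χ.continuous_normed (μ := volume)).measurable.ennreal_ofReal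
  · exact Eventually.of_forall fun _ => ENNReal.ofReal_lt_top

instance (χ : ContDiffBump (0 : HSpace n)) : IsProbabilityMeasure (bumpMeasure χ) := by
  refine ⟨?_⟩
  rw [bumpMeasure, withDensity_apply _ MeasurableSet.univ, Measure.restrict_univ,
    ← ofReal_integral_eq_lintegral_ofReal χ.integrable_normed
      (Eventually.of_forall χ.nonneg_normed), χ.integral_normed, ENNReal.ofReal_one]

theorem ae_bumpMeasure_norm_le (χ : ContDiffBump (0 : HSpace n)) :
    ∀ᵐ y ∂(bumpMeasure χ), ‖y‖ ≤ χ.rOut := by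
  rw [bumpMeasure, ae_withDensity_iff
    (χ.continuous_normed (μ := volume)).measurable.ennreal_ofReal]
  refine Eventually.of_forall fun y hy => ?_
  by_contra h
  refine hy ?_
  have : y ∉ Function.support (χ.normed volume) := by
    rw [χ.support_normed_eq]
    simpa using (not_le.mp h).le
  simp [Function.notMem_support.mp this]

theorem integral_bumpMeasure_eq_convolution (χ : ContDiffBump (0 : HSpace n)) (g : HSpace n → ℝ)
    (a : HSpace n) : ∫ y, g (a + y) ∂(bumpMeasure χ) =
      (χ.normed volume ⋆[ContinuousLinearMap.lsmul ℝ ℝ, volume] g) a := by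
  rw [integral_bumpMeasure, convolution_def,
    ← integral_neg_eq_self fun y => χ.normed volume y * g (a + y)]
  refine integral_congr_ae (Eventually.of_forall fun y => ?_)
  simp [χ.normed_neg, sub_eq_add_neg]

theorem locallyIntegrable_of_bounded {g : HSpace n → ℝ} (hg : Measurable g) {M : ℝ}
    (hM : ∀ x, |g x| ≤ M) : LocallyIntegrable g volume := by
  intro x
  refine ⟨Metric.ball x 1, Metric.ball_mem_nhds x one_pos, ?_⟩
  have : IsFiniteMeasure (volume.restrict (Metric.ball x 1)) :=
    ⟨by simpa using measure_ball_lt_top⟩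
  exact integrable_of_bounded_measurable hg hM

theorem continuous_integral_bumpMeasure (χ : ContDiffBump (0 : HSpace n)) {g : HSpace n → ℝ}
    (hg : Measurable g) {M : ℝ} (hM : ∀ x, |g x| ≤ M) :
    Continuous fun a => ∫ y, g (a + y) ∂(bumpMeasure χ) := by
  simp only [integral_bumpMeasure_eq_convolution]
  exact HasCompactSupport.continuous_convolution_left _ χ.hasCompactSupport_normed
    χ.continuous_normed (locallyIntegrable_of_bounded hg hM)

theorem contDiff_integral_bumpMeasure (χ : ContDiffBump (0 : HSpace n)) {g : HSpace n → ℝ}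
    (hg : Measurable g) {M : ℝ} (hM : ∀ x, |g x| ≤ M) :
    ContDiff ℝ ∞ fun a => ∫ y, g (a + y) ∂(bumpMeasure χ) := by
  simp only [integral_bumpMeasure_eq_convolution]
  exact HasCompactSupport.contDiff_convolution_left _ χ.hasCompactSupport_normed
    χ.contDiff_normed (locallyIntegrable_of_bounded hg hM)

end Bump

/-! ### Averages over small quaternionic multiples -/

section LineAverage

variable {n : ℕ}

/-- The average of the function `f` over the points `x + y q`, where `q` is uniformly distributed
in the unit ball and `y` is distributed according to the bump function. -/
def lineAverage (χ : ContDiffBump (0 : HSpace n)) (f : HSpace n → ℝ) (x : HSpace n) : ℝ :=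
  ∫ p, f (x + rlin p.2 p.1) ∂(qUnif.prod (bumpMeasure χ))

variable {f : HSpace n → ℝ} {M : ℝ} (χ : ContDiffBump (0 : HSpace n))

theorem measurable_rlin_swap :
    Measurable fun p : EuclideanSpace ℝ (Fin 4) × HSpace n => rlin p.2 p.1 := by
  have h := (continuous_rlin (n := n)).comp
    (continuous_swap (X := EuclideanSpace ℝ (Fin 4)) (Y := HSpace n))
  exact h.measurable

theorem ae_norm_rlin_le :
    ∀ᵐ p ∂(qUnif.prod (bumpMeasure χ)), ‖rlin p.2 p.1‖ ≤ χ.rOut := by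
  have h1 : ∀ᵐ p ∂(qUnif.prod (bumpMeasure χ)), p.1 ∈ qBall :=
    Measure.quasiMeasurePreserving_fst.ae ae_qUnif_mem
  have h2 : ∀ᵐ p ∂(qUnif.prod (bumpMeasure χ)), ‖p.2‖ ≤ χ.rOut :=
    Measure.quasiMeasurePreserving_snd.ae (ae_bumpMeasure_norm_le χ)
  filter_upwards [h1, h2] with p hp1 hp2
  rw [norm_rlin]
  have : ‖p.1‖ ≤ 1 := (by simpa using hp1 : ‖p.1‖ < 1).le
  exact (mul_le_of_le_one_right (norm_nonneg _) this).trans hp2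

theorem integrable_lineAverage (hf : Measurable f) (hM : ∀ x, |f x| ≤ M) (x : HSpace n) :
    Integrable (fun p => f (x + rlin p.2 p.1)) (qUnif.prod (bumpMeasure χ)) :=
  integrable_of_bounded_measurable (hf.comp (measurable_rlin_swap.const_add x)) fun _ => hM _

theorem abs_lineAverage_le (hM : ∀ x, |f x| ≤ M) (x : HSpace n) : |lineAverage χ f x| ≤ M := by
  have := norm_integral_le_of_norm_le_const (μ := qUnif.prod (bumpMeasure χ))
    (f := fun p => f (x + rlin p.2 p.1)) (Eventually.of_forall fun _ => hM _)
  simpa [lineAverage] using this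

/-- For fixed q ≠ 0, the map y ↦ yq is a linear isomorphism, and in these coordinates the inner
integral is a convolution with a bump function, hence continuous in x. Dominated convergence then
handles the integral over q; the exceptional q = 0 is a null set. -/
theorem continuous_lineAverage (hf : Measurable f) (hM : ∀ x, |f x| ≤ M) :
    Continuous (lineAverage χ f) := by
  have h : lineAverage χ f = fun x => ∫ q, ∫ y, f (x + rlin y q) ∂(bumpMeasure χ) ∂qUnif :=
    funext fun x => integral_prod _ (integrable_lineAverage χ hf hM x)
  rw [h]
  refine continuous_of_dominated (bound := fun _ => M) (fun x => ?_) (fun x => ?_)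
    (integrable_const _) ?_
  · exact (integrable_lineAverage χ hf hM x).integral_prod_left.aestronglyMeasurable
  · refine Eventually.of_forall fun q => ?_
    have := norm_integral_le_of_norm_le_const (μ := bumpMeasure χ)
      (f := fun y => f (x + rlin y q)) (Eventually.of_forall fun _ => hM _)
    simpa using this
  · filter_upwards [ae_qUnif_ne_zero] with q hq
    let e := (rlinEquiv n q hq).toContinuousLinearEquiv
    have he : ∀ v, e v = rlin v q := fun v => rlinEquiv_apply q hq v
    have h2 : (fun x => ∫ y, f (x + rlin y q) ∂(bumpMeasure χ)) =
        (fun a => ∫ y, f (e (a + y)) ∂(bumpMeasure χ)) ∘ e.symm := by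
      funext x
      simp [he]
      simp [← he]
    rw [h2]
    exact (continuous_integral_bumpMeasure χ (g := fun z => f (e z))
      (hf.comp e.continuous.measurable) fun _ => hM _).comp e.symm.continuous

/-- With y outermost in Fubini, each inner integral is the mean over the quaternionic line in
direction y. This lower bound at every single point is the reason for averaging over lines before
mollifying. -/
theorem le_lineAverage (hf : Measurable f) (hM : ∀ x, |f x| ≤ M) {ρ : ℝ} {x : HSpace n}
    (h : SubMean f ρ x) (hρ : χ.rOut ≤ ρ) : f x ≤ lineAverage χ f x := by
  have hi := integrable_lineAverage χ hf hM x
  rw [lineAverage, integral_prod_symm _ hi]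
  calc f x = ∫ _, f x ∂(bumpMeasure χ) := by simp
    _ ≤ _ := by
      refine integral_mono_ae (integrable_const _) hi.integral_prod_right ?_
      filter_upwards [ae_bumpMeasure_norm_le χ] with y hy
      exact h y (hy.trans hρ)

theorem lineAverage_le (hf : Measurable f) (hM : ∀ x, |f x| ≤ M) {x : HSpace n} {c : ℝ}
    (h : ∀ z, ‖z‖ ≤ χ.rOut → f (x + z) ≤ c) : lineAverage χ f x ≤ c := by
  calc lineAverage χ f x ≤ ∫ _, c ∂(qUnif.prod (bumpMeasure χ)) := by
        refine integral_mono_ae (integrable_lineAverage χ hf hM x) (integrable_const _) ?_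
        filter_upwards [ae_norm_rlin_le χ] with p hp
        exact h _ hp
    _ = c := by simp

theorem SubMean.lineAverage (hf : Measurable f) (hM : ∀ x, |f x| ≤ M) {ρ : ℝ} {x : HSpace n}
    (h : ∀ z, ‖z‖ ≤ χ.rOut → SubMean f ρ (x + z)) : SubMean (lineAverage χ f) ρ x := by
  refine SubMean.average (qUnif.prod (bumpMeasure χ)) measurable_rlin_swap hf hM ?_
  filter_upwards [ae_norm_rlin_le χ] with p hp
  exact h _ hp

end LineAverage

/-! ### Smooth approximation -/

section Approximation

variable {n : ℕ} {Ω : Set (HSpace n)} {u : HSpace n → ℝ}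

theorem measurable_indicator_of_upperSemicontinuousOn {s : Set (HSpace n)} (hs : MeasurableSet s)
    (hu : UpperSemicontinuousOn u s) : Measurable (s.indicator u) := by
  refine measurable_of_restrict_of_restrict_compl hs ?_ ?_
  · have h : s.domRestrict (s.indicator u) = s.domRestrict u :=
      funext fun x => indicator_of_mem x.2 u
    rw [h]
    exact (upperSemicontinuousOn_iff_restrict.mpr hu).measurable
  · have h : sᶜ.domRestrict (s.indicator u) = fun _ => 0 :=
      funext fun x => indicator_of_notMem x.2 u
    rw [h]
    exact measurable_const

theorem IsLocallyBoundedOn.bounded (hu : IsLocallyBoundedOn Ω u) {K : Set (HSpace n)}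
    (hK : IsCompact K) (hKΩ : K ⊆ Ω) : ∃ C, ∀ x ∈ K, |u x| ≤ C := by
  refine hK.induction_on (p := fun s => ∃ C, ∀ x ∈ s, |u x| ≤ C) ⟨0, by simp⟩ ?_ ?_ ?_
  · rintro s t hst ⟨C, hC⟩
    exact ⟨C, fun x hx => hC x (hst hx)⟩
  · rintro s t ⟨C, hC⟩ ⟨D, hD⟩
    refine ⟨max C D, fun x hx => ?_⟩
    rcases hx with hx | hx
    · exact (hC x hx).trans (le_max_left _ _)
    · exact (hD x hx).trans (le_max_right _ _)
  · intro x hx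
    obtain ⟨C, hC⟩ := hu x (hKΩ hx)
    exact ⟨{y | |u y| ≤ C}, nhdsWithin_mono x hKΩ hC, C, fun y hy => hy⟩

theorem IsPSH.isLocBddBorel (hΩ : IsOpen Ω) (hu : IsPSH Ω u) (hb : IsLocallyBoundedOn Ω u) :
    IsLocBddBorel Ω u :=
  ⟨measurable_indicator_of_upperSemicontinuousOn hΩ.measurableSet hu.1,
    fun _ hK hKΩ => hb.bounded hK hKΩ⟩

/-- Truncating u to L makes it a globally bounded Borel function and does not change the values that
enter the inequality at z. The direction v = 0, excluded in the definition of PSH, is trivial. -/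
theorem IsPSH.subMean_indicator (hu : IsPSH Ω u) {L : Set (HSpace n)} (hLΩ : L ⊆ Ω)
    {z : HSpace n} {ρ : ℝ} (hz : Metric.closedBall z ρ ⊆ L) : SubMean (L.indicator u) ρ z := by
  intro v hv
  have hρ : 0 ≤ ρ := (norm_nonneg v).trans hv
  have hzL : z ∈ L := hz (Metric.mem_closedBall_self hρ)
  have hmem : ∀ q ∈ Metric.closedBall (0 : EuclideanSpace ℝ (Fin 4)) 1, z + rlin v q ∈ L := by
    intro q hq
    refine hz ?_
    rw [mem_closedBall_iff_norm, add_sub_cancel_left, norm_rlin]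
    exact (mul_le_of_le_one_right (norm_nonneg _) (by simpa using hq)).trans hv
  rw [indicator_of_mem hzL]
  by_cases hv0 : v = 0
  · simp [hv0, rlin_zero_left, hzL]
  have h := ((hu.2 z v hv0).2 0 1 one_pos fun q hq => by
    rw [mem_preimage, rightLine_eq_add]
    exact hLΩ (hmem q hq)).2
  rw [← integral_qUnif] at h
  have h0 : rightLine z v 0 = z := by
    rw [rightLine_eq_add]
    simpa using (norm_rlin v 0)
  simp only [h0] at h
  refine h.trans_eq (integral_congr_ae ?_)
  filter_upwards [ae_qUnif_mem] with q hq
  rw [rightLine_eq_add, indicator_of_mem (hmem q (Metric.ball_subset_closedBall hq))]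

/-- Smooth approximation of a locally bounded plurisubharmonic function near a compact set. -/
theorem IsPSH.exists_smooth_approx (hΩ : IsOpen Ω) (hu : IsPSH Ω u)
    (hb : IsLocallyBoundedOn Ω u) {K : Set (HSpace n)} (hK : IsCompact K) (hKΩ : K ⊆ Ω) :
    ∃ v : ℕ → HSpace n → ℝ, (∀ j, ContDiff ℝ ∞ (v j)) ∧
      (∀ j, ∀ x ∈ K, LineNonneg (hess (v j) x)) ∧ (∃ C, ∀ j, ∀ x, |v j x| ≤ C) ∧
      ∀ x ∈ K, Tendsto (fun j => v j x) atTop (𝓝 (u x)) := by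
  obtain ⟨δ₀, hδ₀, hδΩ⟩ := hK.exists_cthickening_subset_open hΩ hKΩ
  set L := Metric.cthickening δ₀ K with hL
  have hLc : IsCompact L := hK.cthickening
  obtain ⟨M, hM⟩ := hb.bounded hLc hδΩ
  set f := L.indicator u with hf
  have hfm : Measurable f :=
    measurable_indicator_of_upperSemicontinuousOn hLc.isClosed.measurableSet (hu.1.mono hδΩ)
  have hfM : ∀ x, |f x| ≤ max M 0 := by
    intro x
    by_cases hx : x ∈ L
    · simp only [hf, indicator_of_mem hx]
      exact (hM x hx).trans (le_max_left _ _)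
    · simp [hf, indicator_of_notMem hx]
  -- The shift from the line average, the shift from the mollification and the radius of the
  -- sub-mean inequality are each at most δ, so everything stays in L.
  set δ := δ₀ / 3 with hδ
  have hδp : 0 < δ := by positivity
  have hfsub : ∀ x ∈ K, ∀ z, ‖z‖ ≤ 2 * δ → SubMean f δ (x + z) := by
    intro x hx z hz
    refine hu.subMean_indicator hδΩ fun y hy => ?_
    refine Metric.mem_cthickening_of_dist_le y x δ₀ K hx ?_
    have h1 : dist y (x + z) ≤ δ := hy
    have h2 : dist (x + z) x ≤ 2 * δ := by simpa [dist_eq_norm] using hz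
    linarith [dist_triangle y (x + z) x]
  have hfK : ∀ x ∈ K, f x = u x := fun x hx =>
    indicator_of_mem (Metric.self_subset_cthickening K hx) u
  have hpos : ∀ j : ℕ, 0 < δ / (j + 1) := fun j => by positivity
  let χ : ℕ → ContDiffBump (0 : HSpace n) := fun j =>
    ⟨δ / (j + 1) / 2, δ / (j + 1), half_pos (hpos j), half_lt_self (hpos j)⟩
  have hχ : ∀ j, (χ j).rOut ≤ δ := fun j => div_le_self hδp.le (by linarith [j.cast_nonneg (α := ℝ)])
  -- W_j lies between f(x), by the sub-mean inequality, and the supremum of f over a small ball,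
  -- which upper semicontinuity controls. Hence W_j tends to u at every point of K, but W_j is only
  -- known to be continuous. A second mollification, so fine that it moves W_j by at most 1/(j+1) on
  -- K, makes it smooth and keeps the sub-mean property.
  let W : ℕ → HSpace n → ℝ := fun j => lineAverage (χ j) f
  have hWc : ∀ j, Continuous (W j) := fun j => continuous_lineAverage (χ j) hfm hfM
  have hWM : ∀ j x, |W j x| ≤ max M 0 := fun j x => abs_lineAverage_le (χ j) hfM x
  have hexists : ∀ j : ℕ, ∃ v : HSpace n → ℝ, ContDiff ℝ ∞ v ∧
      (∀ x ∈ K, LineNonneg (hess v x)) ∧ (∀ x, |v x| ≤ max M 0) ∧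
      ∀ x ∈ K, |v x - W j x| ≤ 1 / ((j : ℝ) + 1) := by
    intro j
    have huc := hK.uniformContinuousAt_of_continuousAt (W j)
      (fun x _ => (hWc j).continuousAt)
      (Metric.dist_mem_uniformity (show (0 : ℝ) < 1 / ((j : ℝ) + 1) by positivity))
    obtain ⟨s, hs, hsW⟩ := Metric.mem_uniformity_dist.mp huc
    have hs2 : 0 < min s δ / 2 := by positivity
    let κ : ContDiffBump (0 : HSpace n) :=
      ⟨min s δ / 2 / 2, min s δ / 2, half_pos hs2, half_lt_self hs2⟩
    have hκs : κ.rOut < s := (half_lt_self (lt_min hs hδp)).trans_le (min_le_left _ _)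
    have hκδ : κ.rOut ≤ δ := ((half_lt_self (lt_min hs hδp)).trans_le (min_le_right _ _)).le
    have hInt : ∀ x, Integrable (fun y => W j (x + y)) (bumpMeasure κ) := fun x =>
      integrable_of_bounded_measurable ((hWc j).measurable.comp (measurable_const_add x))
        fun _ => hWM j _
    refine ⟨fun x => ∫ y, W j (x + y) ∂(bumpMeasure κ),
      contDiff_integral_bumpMeasure κ (hWc j).measurable (hWM j), fun x hx => ?_, fun x => ?_,
      fun x hx => ?_⟩
    · refine lineNonneg_hess (contDiff_integral_bumpMeasure κ (hWc j).measurable (hWM j)) hδp ?_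
      refine SubMean.average (bumpMeasure κ) measurable_id (hWc j).measurable (hWM j) ?_
      filter_upwards [ae_bumpMeasure_norm_le κ] with y hy
      refine SubMean.lineAverage (χ j) hfm hfM fun z hz => ?_
      rw [add_assoc]
      refine hfsub x hx _ ((norm_add_le _ _).trans ?_)
      have := hz.trans (hχ j)
      have := hy.trans hκδ
      simp only [id] at *
      linarith
    · have := norm_integral_le_of_norm_le_const (μ := bumpMeasure κ)
        (f := fun y => W j (x + y)) (Eventually.of_forall fun _ => hWM j _)
      simpa using this
    · have h1 : (∫ y, W j (x + y) ∂(bumpMeasure κ)) - W j x =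
          ∫ y, (W j (x + y) - W j x) ∂(bumpMeasure κ) := by
        rw [integral_sub (hInt x) (integrable_const _)]
        simp
      rw [h1]
      have := norm_integral_le_of_norm_le_const (μ := bumpMeasure κ)
        (f := fun y => W j (x + y) - W j x) (C := 1 / ((j : ℝ) + 1)) (by
          filter_upwards [ae_bumpMeasure_norm_le κ] with y hy
          have hd : dist x (x + y) < s := by simpa [dist_eq_norm] using hy.trans_lt hκs
          have h2 : dist (W j x) (W j (x + y)) < 1 / ((j : ℝ) + 1) := hsW hd hx
          rw [dist_comm, dist_eq_norm] at h2
          exact h2.le)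
      simpa using this
  choose v hv1 hv2 hv3 hv4 using hexists
  refine ⟨v, hv1, hv2, ⟨max M 0, hv3⟩, fun x hx => ?_⟩
  rw [Metric.tendsto_atTop]
  intro ε hε
  have husc : ∀ᶠ y in 𝓝 x, u y < u x + ε / 2 := by
    have := hu.1 x (hKΩ hx) (u x + ε / 2) (by linarith)
    rwa [hΩ.nhdsWithin_eq (hKΩ hx)] at this
  obtain ⟨s, hs, hsu⟩ := Metric.eventually_nhds_iff.mp husc
  obtain ⟨N₁, hN₁⟩ := exists_nat_gt (δ / s)
  obtain ⟨N₂, hN₂⟩ := exists_nat_gt (2 / ε)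
  refine ⟨max N₁ N₂, fun j hj => ?_⟩
  have hj1 : (N₁ : ℝ) ≤ j := by exact_mod_cast (le_max_left _ _).trans hj
  have hj2 : (N₂ : ℝ) ≤ j := by exact_mod_cast (le_max_right _ _).trans hj
  have h1 : f x ≤ W j x := by
    refine le_lineAverage (χ j) hfm hfM (ρ := δ) ?_ (hχ j)
    simpa using hfsub x hx 0 (by simp; positivity)
  have h2 : W j x ≤ u x + ε / 2 := by
    refine lineAverage_le (χ j) hfm hfM fun z hz => ?_
    have hzs : ‖z‖ < s := by
      refine hz.trans_lt ?_
      change δ / ((j : ℝ) + 1) < s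
      rw [div_lt_iff₀ (by positivity)]
      rw [div_lt_iff₀ hs] at hN₁
      nlinarith
    have hzL : x + z ∈ L := by
      refine Metric.mem_cthickening_of_dist_le _ x δ₀ K hx ?_
      have := hz.trans (hχ j)
      rw [dist_eq_norm, add_sub_cancel_left]
      linarith
    simp only [hf, indicator_of_mem hzL]
    exact (hsu (by simpa [dist_eq_norm] using hzs)).le
  have h3 : 1 / ((j : ℝ) + 1) < ε / 2 := by
    rw [div_lt_iff₀ (by positivity)]
    rw [div_lt_iff₀ hε] at hN₂
    nlinarith
  have h4 := abs_le.mp (hv4 j x hx)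
  rw [hfK x hx] at h1
  rw [Real.dist_eq, abs_lt]
  constructor <;> linarith

end Approximation

/-! ### Closed positive currents -/

section ClosedPositive

variable {n : ℕ} {Ω : Set (HSpace n)}

/-- Closed positive currents, acting on test forms of degree `2m`. -/
structure IsClosedPositive (Ω : Set (HSpace n)) (m : ℕ) (T : QCurrent n) : Prop where
  add : ∀ η ζ, IsTestForm Ω η → IsTestForm Ω ζ → T (η + ζ) = T η + T ζ
  smul : ∀ (c : ℂ) η, IsTestForm Ω η → T (c • η) = c * T η
  closed : ∀ α ξ, IsTestForm Ω ξ → T (dOp α ξ) = 0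
  nonneg : ∀ (f : HSpace n → ℝ) (As : List (HSpace n → Matrix (RIdx n) (RIdx n) ℝ)),
    IsTestFun Ω f → (∀ x, 0 ≤ f x) → As.length = m →
    (∀ A ∈ As, (∀ p q, ContDiff ℝ ∞ fun x => A x p q) ∧
      ∀ x ∈ tsupport f, (A x).IsSymm ∧ LineNonneg (A x)) →
    ∃ c : ℝ, 0 ≤ c ∧ T (fun x => f x • (As.map fun A => hessForm (A x)).prod (omega ∅)) = c
  degree : ∀ η, IsTestForm Ω η → (∀ I, I.card = 2 * m → ∀ x, η x I = 0) → T η = 0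

variable {m : ℕ} {T : QCurrent n}

theorem IsClosedPositive.mono {U : Set (HSpace n)} (hT : IsClosedPositive Ω m T) (h : U ⊆ Ω) :
    IsClosedPositive U m T where
  add η ζ hη hζ := hT.add η ζ (hη.mono h) (hζ.mono h)
  smul c η hη := hT.smul c η (hη.mono h)
  closed α ξ hξ := hT.closed α ξ (hξ.mono h)
  nonneg f As hf := hT.nonneg f As (hf.mono h)
  degree η hη := hT.degree η (hη.mono h)

theorem IsClosedPositive.zero (hT : IsClosedPositive Ω m T) : T 0 = 0 := by
  simpa using hT.smul 0 0 IsTestForm.zero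

theorem IsClosedPositive.sum (hT : IsClosedPositive Ω m T) {ι : Type*} (s : Finset ι)
    {η : ι → QForm n} (h : ∀ i ∈ s, IsTestForm Ω (η i)) : T (∑ i ∈ s, η i) = ∑ i ∈ s, T (η i) := by
  classical
  induction s using Finset.induction_on with
  | empty => simpa using hT.zero
  | insert a s ha ih =>
    rw [Finset.sum_insert ha, Finset.sum_insert ha, hT.add _ _ (h a (by simp))
      (IsTestForm.sum s fun i hi => h i (by simp [hi])), ih fun i hi => h i (by simp [hi])]

theorem IsTestFun.real_smul_const {f : HSpace n → ℝ} (hf : IsTestFun Ω f) (v : Lam n) :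
    IsTestForm Ω fun x => f x • v := by
  simpa using hf.ofReal.smul_const v

/-- A current which is positive in the direction of a fixed form is given by a measure there. -/
theorem IsClosedPositive.exists_measure (hΩ : IsOpen Ω) (hT : IsClosedPositive Ω m T) (γ : Lam n)
    (hγ : ∀ f : HSpace n → ℝ, IsTestFun Ω f → (∀ x, 0 ≤ f x) →
      ∃ c : ℝ, 0 ≤ c ∧ T (fun x => f x • γ) = c) :
    ∃ μ : Measure (HSpace n), μ Ωᶜ = 0 ∧ IsRadonOn Ω μ ∧
      ∀ f : HSpace n → ℂ, IsTestFun Ω f → T (fun x => f x • γ) = ∫ x, f x ∂μ := by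
  have hadd : ∀ f g : HSpace n → ℝ, IsTestFun Ω f → IsTestFun Ω g →
      T (fun x => (f + g) x • γ) = T (fun x => f x • γ) + T (fun x => g x • γ) := by
    intro f g hf hg
    rw [← hT.add _ _ (hf.real_smul_const γ) (hg.real_smul_const γ)]
    congr 1
    funext x
    simp [add_smul]
  have hsmul : ∀ (c : ℝ) (f : HSpace n → ℝ), IsTestFun Ω f →
      T (fun x => (c • f) x • γ) = c * T (fun x => f x • γ) := by
    intro c f hf
    rw [← hT.smul _ _ (hf.real_smul_const γ)]
    congr 1
    funext x
    simp [mul_smul]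
  obtain ⟨μ, h0, hμ, hrep⟩ := exists_measure_of_positive hΩ
    (fun f : HSpace n → ℝ => (T fun x => f x • γ).re)
    (fun f g hf hg => by simp only [hadd f g hf hg, Complex.add_re])
    (fun c f hf => by simp only [hsmul c f hf, Complex.re_ofReal_mul])
    (fun f hf hf0 => by
      obtain ⟨c, hc, h⟩ := hγ f hf hf0
      simpa [h] using hc)
  have hreal : ∀ f : HSpace n → ℝ, IsTestFun Ω f → T (fun x => f x • γ) = ∫ x, (f x : ℂ) ∂μ := by
    intro f hf
    -- A real test function is the difference of the nonnegative test functions f + Cθ and Cθ, whose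
    -- values under T are real.
    have him : (T fun x => f x • γ).im = 0 := by
      obtain ⟨θ, hθ, hθ01, hθ1⟩ := exists_cutoff hΩ hf.2.1 hf.2.2
      obtain ⟨C, hC⟩ := hf.2.1.exists_bound_of_continuous hf.1.continuous
      have hCθ : IsTestFun Ω (C • θ) := hθ.of_eq_zero (hθ.1.const_smul C) fun x hx => by simp [hx]
      have hC0 : 0 ≤ C := (norm_nonneg _).trans (hC 0)
      obtain ⟨a, -, ha⟩ := hγ _ (hf.add hCθ) fun x => by
        by_cases hx : x ∈ tsupport f
        · simp only [Pi.add_apply, Pi.smul_apply, hθ1.self_of_nhdsSet x hx, smul_eq_mul, mul_one]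
          linarith [(abs_le.mp (hC x)).1]
        · simp only [Pi.add_apply, Pi.smul_apply, image_eq_zero_of_notMem_tsupport hx, smul_eq_mul,
            zero_add]
          exact mul_nonneg hC0 (hθ01 x).1
      obtain ⟨b, -, hb⟩ := hγ _ hCθ fun x => mul_nonneg hC0 (hθ01 x).1
      rw [hadd _ _ hf hCθ, hb] at ha
      have := congrArg Complex.im ha
      simpa using this
    rw [integral_complex_ofReal, ← hrep f hf]
    exact Complex.ext (by simp) (by simpa using him)
  refine ⟨μ, h0, hμ, fun f hf => ?_⟩
  have hre : IsTestFun Ω fun x => (f x).re :=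
    hf.of_eq_zero (Complex.reCLM.contDiff.comp hf.1) fun x hx => by simp [hx]
  have him : IsTestFun Ω fun x => (f x).im :=
    hf.of_eq_zero (Complex.imCLM.contDiff.comp hf.1) fun x hx => by simp [hx]
  have hInt : ∀ g : HSpace n → ℝ, IsTestFun Ω g → Integrable (fun x => (g x : ℂ)) μ := by
    intro g hg
    simpa using (isLocBddBorel_of_continuousOn hΩ
      (continuousOn_const (c := (1 : ℝ)))).integrable_mul' hΩ hμ hg.ofReal.1.continuous
      hg.ofReal.2.1 hg.ofReal.2.2
  have e1 : (fun x => f x • γ) =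
      (fun x => (f x).re • γ) + Complex.I • fun x => (f x).im • γ := by
    funext x I
    simp only [Pi.add_apply, Pi.smul_apply, smul_eq_mul, Complex.real_smul]
    conv_lhs => rw [← Complex.re_add_im (f x)]
    ring
  have e2 : ∀ x, f x = ((f x).re : ℂ) + Complex.I * ((f x).im : ℂ) := fun x => by
    rw [mul_comm]
    exact (Complex.re_add_im (f x)).symm
  rw [e1, hT.add _ _ (hre.real_smul_const γ) ((him.real_smul_const γ).const_smul _),
    hT.smul _ _ (him.real_smul_const γ), hreal _ hre, hreal _ him, ← integral_const_mul,
    ← integral_add (hInt _ hre) ((hInt _ him).const_mul _)]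
  exact integral_congr_ae (Eventually.of_forall fun x => (e2 x).symm)

theorem lineNonneg_vecMulVec (b : RIdx n → ℝ) : LineNonneg (Matrix.vecMulVec b b) := by
  intro w
  refine integral_nonneg fun q => ?_
  have h : dotProduct (rmul q w) ((Matrix.vecMulVec b b).mulVec (rmul q w)) =
      dotProduct b (rmul q w) * dotProduct b (rmul q w) := by
    rw [Matrix.vecMulVec_mulVec, dotProduct_comm (rmul q w)]
    simp [dotProduct, Finset.sum_mul, mul_comm, mul_left_comm, mul_assoc]
  simp only [Pi.zero_apply, h]
  exact mul_self_nonneg _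

/-- Closed positive currents are represented by finitely many measures, uniformly for all
currents. -/
theorem exists_measureRep (n m : ℕ) :
    ∃ (ι : Type) (_ : Fintype ι) (idx : ι → Finset (Fin (n * 2))) (c : ι → ℂ) (γ : ι → Lam n),
      (∀ s, (idx s).card = 2 * m) ∧
      ∀ (Ω : Set (HSpace n)), IsOpen Ω → ∀ T : QCurrent n, IsClosedPositive Ω m T →
        ∃ μ : ι → Measure (HSpace n), IsMeasureRep Ω T μ c idx ∧
          ∀ s, ∀ f : HSpace n → ℂ, IsTestFun Ω f → T (fun x => f x • γ s) = ∫ x, f x ∂(μ s) := by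
  -- The decomposition is fixed before the current is chosen, so different currents share the same
  -- forms γ_s and their measures μ_s can be compared.
  obtain ⟨ι, hι, idx, c, bs, hlen, hcard, hdec⟩ := exists_elemProducts_decomposition n m
  refine ⟨ι, hι, idx, c, fun s => ((bs s).map elemPos).prod (omega ∅), hcard,
    fun Ω hΩ T hT => ?_⟩
  have hγ : ∀ s, ∀ f : HSpace n → ℝ, IsTestFun Ω f → (∀ x, 0 ≤ f x) →
      ∃ a : ℝ, 0 ≤ a ∧ T (fun x => f x • ((bs s).map elemPos).prod (omega ∅)) = a := by
    intro s f hf hf0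
    have := hT.nonneg f ((bs s).map fun b => fun _ => Matrix.vecMulVec b b) hf hf0
      (by simpa using hlen s) (by
        simp only [List.mem_map]
        rintro A ⟨b, -, rfl⟩
        exact ⟨fun p q => contDiff_const, fun x _ =>
          ⟨by ext p q; simp [Matrix.vecMulVec_apply, mul_comm], lineNonneg_vecMulVec b⟩⟩)
    simpa [List.map_map, Function.comp_def, ← elemPos_eq_hessForm] using this
  choose μ hμ0 hμ hrep using fun s => hT.exists_measure hΩ _ (hγ s)
  refine ⟨μ, ⟨hμ0, hμ, fun η hη => ?_⟩, hrep⟩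
  classical
  have hP : IsTestForm Ω fun x I => if I.card = 2 * m then η x I else 0 := by
    refine hη.of_eq_zero (contDiff_pi.mpr fun I => ?_) fun x hx => by funext I; simp [hx]
    by_cases hI : I.card = 2 * m
    · simpa [hI] using contDiff_pi.mp hη.1 I
    · simpa [hI] using contDiff_const
  have hQ : IsTestForm Ω fun x I => if I.card = 2 * m then 0 else η x I := by
    refine hη.of_eq_zero (contDiff_pi.mpr fun I => ?_) fun x hx => by funext I; simp [hx]
    by_cases hI : I.card = 2 * m
    · simpa [hI] using contDiff_const
    · simpa [hI] using contDiff_pi.mp hη.1 I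
  -- The part of degree other than 2m is killed by T; the part of degree 2m is expanded in products
  -- of elementary positive forms.
  have e1 : η = (fun x I => if I.card = 2 * m then η x I else 0) +
      fun x I => if I.card = 2 * m then 0 else η x I := by
    funext x I
    by_cases hI : I.card = 2 * m <;> simp [hI]
  have e2 : (fun x I => if I.card = 2 * m then η x I else 0) =
      ∑ s, c s • fun x => η x (idx s) • ((bs s).map elemPos).prod (omega ∅) := by
    funext x
    rw [hdec (fun I => if I.card = 2 * m then η x I else 0) fun I hI => by simp [hI],
      Finset.sum_apply]
    refine Finset.sum_congr rfl fun s _ => ?_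
    simp [hcard s, mul_smul]
  have hs : ∀ s, IsTestForm Ω fun x => η x (idx s) • ((bs s).map elemPos).prod (omega ∅) :=
    fun s => (hη.apply (idx s)).smul_const _
  calc T η = T (fun x I => if I.card = 2 * m then η x I else 0) +
        T (fun x I => if I.card = 2 * m then 0 else η x I) := by
        conv_lhs => rw [e1]
        exact hT.add _ _ hP hQ
    _ = T (fun x I => if I.card = 2 * m then η x I else 0) := by
        rw [hT.degree _ hQ fun I hI x => by simp [hI], add_zero]
    _ = ∑ s, c s * ∫ x, η x (idx s) ∂(μ s) := by
        rw [e2, hT.sum _ fun s _ => (hs s).const_smul _]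
        refine Finset.sum_congr rfl fun s _ => ?_
        rw [hT.smul _ _ (hs s), hrep s _ (hη.apply (idx s))]

/-- Closed positive currents of bidegree `(n, n)` are positive measures. -/
theorem IsClosedPositive.exists_coefficientMeasure (hΩ : IsOpen Ω)
    (hT : IsClosedPositive Ω 0 T) : ∃ μ, IsCoefficientMeasure Ω T μ := by
  obtain ⟨μ, h0, hμ, hrep⟩ := hT.exists_measure hΩ (omega ∅) fun f hf hf0 => by
    simpa using hT.nonneg f [] hf hf0 rfl (by simp)
  refine ⟨μ, h0, hμ, fun η hη => ?_⟩
  rw [← hrep _ (hη.apply ∅)]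
  have hs : IsTestForm Ω fun x => η x ∅ • (omega ∅ : Lam n) := (hη.apply ∅).smul_const _
  have e : η = (fun x => η x ∅ • (omega ∅ : Lam n)) +
      (η + (-1 : ℂ) • fun x => η x ∅ • (omega ∅ : Lam n)) := by
    funext x I
    simp
  conv_lhs => rw [e]
  rw [hT.add _ _ hs (hη.add (hs.const_smul _)), hT.degree _ (hη.add (hs.const_smul _)), add_zero]
  intro I hI x
  have : I = ∅ := by simpa using hI
  simp [this, omega]

end ClosedPositive

/-! ### Products of functions and closed positive currents -/

section MulCurrent

variable {n : ℕ} {Ω : Set (HSpace n)} {m : ℕ} {T : QCurrent n}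

theorem IsLocBddBorel.integrable_apply (hΩ : IsOpen Ω) {u : HSpace n → ℝ}
    (hu : IsLocBddBorel Ω u) {μ : Measure (HSpace n)} (hμ : IsRadonOn Ω μ) {η : QForm n}
    (hη : IsTestForm Ω η) (I : Finset (Fin (n * 2))) :
    Integrable (fun x => (u x : ℂ) * η x I) μ :=
  hu.integrable_mul' hΩ hμ (hη.apply I).1.continuous (hη.apply I).2.1 (hη.apply I).2.2

theorem IsClosedPositive.hasMeasureCoefficients (hΩ : IsOpen Ω) (hT : IsClosedPositive Ω m T) :
    HasMeasureCoefficients Ω T := by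
  obtain ⟨ι, hι, idx, c, γ, -, h⟩ := exists_measureRep n m
  obtain ⟨μ, hμ, -⟩ := h Ω hΩ T hT
  exact hμ.hasMeasureCoefficients hΩ

theorem IsClosedPositive.mulCurrent_add (hΩ : IsOpen Ω) (hT : IsClosedPositive Ω m T)
    {u : HSpace n → ℝ} (hu : IsLocBddBorel Ω u) {η ζ : QForm n} (hη : IsTestForm Ω η)
    (hζ : IsTestForm Ω ζ) :
    mulCurrent Ω u T (η + ζ) = mulCurrent Ω u T η + mulCurrent Ω u T ζ := by
  obtain ⟨ι, hι, idx, c, γ, -, h⟩ := exists_measureRep n m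
  obtain ⟨μ, hμ, -⟩ := h Ω hΩ T hT
  rw [hμ.mulCurrent_eq hΩ hu hη, hμ.mulCurrent_eq hΩ hu hζ, hμ.mulCurrent_eq hΩ hu (hη.add hζ),
    ← Finset.sum_add_distrib]
  refine Finset.sum_congr rfl fun s _ => ?_
  rw [← mul_add, ← integral_add (hu.integrable_apply hΩ (hμ.radon s) hη _)
    (hu.integrable_apply hΩ (hμ.radon s) hζ _)]
  simp only [Pi.add_apply, mul_add]

theorem IsClosedPositive.mulCurrent_smul (hΩ : IsOpen Ω) (hT : IsClosedPositive Ω m T)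
    {u : HSpace n → ℝ} (hu : IsLocBddBorel Ω u) (a : ℂ) {η : QForm n} (hη : IsTestForm Ω η) :
    mulCurrent Ω u T (a • η) = a * mulCurrent Ω u T η := by
  obtain ⟨ι, hι, idx, c, γ, -, h⟩ := exists_measureRep n m
  obtain ⟨μ, hμ, -⟩ := h Ω hΩ T hT
  rw [hμ.mulCurrent_eq hΩ hu hη, hμ.mulCurrent_eq hΩ hu (hη.const_smul a), Finset.mul_sum]
  refine Finset.sum_congr rfl fun s _ => ?_
  have e : ∀ x, (u x : ℂ) * (a • η) x (idx s) = a * ((u x : ℂ) * η x (idx s)) := fun x => by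
    simp only [Pi.smul_apply, smul_eq_mul, mul_left_comm]
  simp only [e]
  rw [integral_const_mul, mul_left_comm]

theorem IsClosedPositive.mulCurrent_degree (hΩ : IsOpen Ω) (hT : IsClosedPositive Ω m T)
    {u : HSpace n → ℝ} (hu : IsLocBddBorel Ω u) {η : QForm n} (hη : IsTestForm Ω η)
    (h0 : ∀ I, I.card = 2 * m → ∀ x, η x I = 0) : mulCurrent Ω u T η = 0 := by
  obtain ⟨ι, hι, idx, c, γ, hcard, h⟩ := exists_measureRep n m
  obtain ⟨μ, hμ, -⟩ := h Ω hΩ T hT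
  rw [hμ.mulCurrent_eq hΩ hu hη]
  refine Finset.sum_eq_zero fun s _ => ?_
  simp [h0 _ (hcard s)]

theorem IsClosedPositive.mulCurrent_of_contDiff (hΩ : IsOpen Ω) (hT : IsClosedPositive Ω m T)
    {u : HSpace n → ℝ} (hu : ContDiff ℝ ∞ u) {η : QForm n} (hη : IsTestForm Ω η) :
    mulCurrent Ω u T η = T fun x => u x • η x := by
  obtain ⟨ι, hι, idx, c, γ, -, h⟩ := exists_measureRep n m
  obtain ⟨μ, hμ, -⟩ := h Ω hΩ T hT
  rw [hμ.mulCurrent_eq hΩ (isLocBddBorel_of_continuousOn hΩ hu.continuous.continuousOn) hη,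
    hμ.eq _ (hη.smul hu)]
  simp only [Pi.smul_apply, Complex.real_smul]

theorem IsClosedPositive.mulCurrent_congr (hΩ : IsOpen Ω) (hT : IsClosedPositive Ω m T)
    {u v : HSpace n → ℝ} (hu : IsLocBddBorel Ω u) (hv : IsLocBddBorel Ω v) {η ζ : QForm n}
    (hη : IsTestForm Ω η) (hζ : IsTestForm Ω ζ) (h : ∀ x, u x • η x = v x • ζ x) :
    mulCurrent Ω u T η = mulCurrent Ω v T ζ := by
  obtain ⟨ι, hι, idx, c, γ, -, hrep⟩ := exists_measureRep n m
  obtain ⟨μ, hμ, -⟩ := hrep Ω hΩ T hT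
  rw [hμ.mulCurrent_eq hΩ hu hη, hμ.mulCurrent_eq hΩ hv hζ]
  refine Finset.sum_congr rfl fun s _ => ?_
  congr 2
  funext x
  simpa using congrFun (h x) (idx s)

theorem IsLocBddBorel.sub {u v : HSpace n → ℝ} (hu : IsLocBddBorel Ω u) (hv : IsLocBddBorel Ω v) :
    IsLocBddBorel Ω fun x => u x - v x := by
  refine ⟨?_, fun K hK hKΩ => ?_⟩
  · have h : (Ω.indicator fun x => u x - v x) = fun x => Ω.indicator u x - Ω.indicator v x := by
      funext x
      by_cases hx : x ∈ Ω <;> simp [hx]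
    rw [h]
    exact hu.measurable.sub hv.measurable
  · obtain ⟨C, hC⟩ := hu.bounded K hK hKΩ
    obtain ⟨D, hD⟩ := hv.bounded K hK hKΩ
    exact ⟨C + D, fun x hx => (abs_sub _ _).trans (add_le_add (hC x hx) (hD x hx))⟩

theorem IsClosedPositive.mulCurrent_sub (hΩ : IsOpen Ω) (hT : IsClosedPositive Ω m T)
    {u v : HSpace n → ℝ} (hu : IsLocBddBorel Ω u) (hv : IsLocBddBorel Ω v) {η : QForm n}
    (hη : IsTestForm Ω η) :
    mulCurrent Ω (fun x => u x - v x) T η = mulCurrent Ω u T η - mulCurrent Ω v T η := by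
  obtain ⟨ι, hι, idx, c, γ, -, h⟩ := exists_measureRep n m
  obtain ⟨μ, hμ, -⟩ := h Ω hΩ T hT
  rw [hμ.mulCurrent_eq hΩ hu hη, hμ.mulCurrent_eq hΩ hv hη, hμ.mulCurrent_eq hΩ (hu.sub hv) hη,
    ← Finset.sum_sub_distrib]
  refine Finset.sum_congr rfl fun s _ => ?_
  rw [← mul_sub, ← integral_sub (hu.integrable_apply hΩ (hμ.radon s) hη _)
    (hv.integrable_apply hΩ (hμ.radon s) hη _)]
  simp only [Complex.ofReal_sub, sub_mul]

/-- The product depends only on the values of the current on test forms. -/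
theorem mulCurrent_congr_current (hΩ : IsOpen Ω) {S : QCurrent n}
    (hT : HasMeasureCoefficients Ω T) (h : ∀ η, IsTestForm Ω η → T η = S η) {u : HSpace n → ℝ}
    (hu : IsLocBddBorel Ω u) {η : QForm n} (hη : IsTestForm Ω η) :
    mulCurrent Ω u T η = mulCurrent Ω u S η := by
  obtain ⟨μ, g, hd⟩ := hT
  have hd' : HasDensity Ω S μ g := ⟨hd.1, hd.2.1, fun η hη => by rw [← h η hη, hd.2.2 η hη]⟩
  rw [hd.mulCurrent_eq hΩ hu hη, hd'.mulCurrent_eq hΩ hu hη]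

theorem IsMeasureRep.restrict {ι : Type} [Fintype ι] {μ : ι → Measure (HSpace n)} {c : ι → ℂ}
    {idx : ι → Finset (Fin (n * 2))} (h : IsMeasureRep Ω T μ c idx) {U : Set (HSpace n)}
    (hU : IsOpen U) (hUΩ : U ⊆ Ω) :
    IsMeasureRep U T (fun s => (μ s).restrict U) c idx where
  null s := by rw [Measure.restrict_apply hU.measurableSet.compl]; simp
  radon s K hK hKU := (Measure.restrict_apply_le _ _).trans_lt (h.radon s K hK (hKU.trans hUΩ))
  eq η hη := by
    rw [h.eq η (hη.mono hUΩ)]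
    refine Finset.sum_congr rfl fun s _ => ?_
    rw [setIntegral_eq_integral_of_forall_compl_eq_zero fun x hx => (hη.apply _).eq_zero hx]

/-- Multiplication is local. -/
theorem IsClosedPositive.mulCurrent_restrict (hΩ : IsOpen Ω) (hT : IsClosedPositive Ω m T)
    {U : Set (HSpace n)} (hU : IsOpen U) (hUΩ : U ⊆ Ω) {u : HSpace n → ℝ}
    (hu : IsLocBddBorel Ω u) {η : QForm n} (hη : IsTestForm U η) :
    mulCurrent U u T η = mulCurrent Ω u T η := by
  obtain ⟨ι, hι, idx, c, γ, -, h⟩ := exists_measureRep n m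
  obtain ⟨μ, hμ, -⟩ := h Ω hΩ T hT
  rw [hμ.mulCurrent_eq hΩ hu (hη.mono hUΩ),
    (hμ.restrict hU hUΩ).mulCurrent_eq hU (hu.mono hU hUΩ) hη]
  refine Finset.sum_congr rfl fun s _ => ?_
  rw [setIntegral_eq_integral_of_forall_compl_eq_zero fun x hx => by
    rw [(hη.apply _).eq_zero hx, mul_zero]]

/-- Bounded pointwise convergence. -/
theorem IsClosedPositive.tendsto_mulCurrent (hΩ : IsOpen Ω) (hT : IsClosedPositive Ω m T)
    {v : ℕ → HSpace n → ℝ} {u : HSpace n → ℝ} (hv : ∀ j, IsLocBddBorel Ω (v j))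
    (hu : IsLocBddBorel Ω u) {η : QForm n} (hη : IsTestForm Ω η) {C : ℝ}
    (hC : ∀ j, ∀ x ∈ tsupport η, |v j x| ≤ C)
    (hlim : ∀ x ∈ tsupport η, Tendsto (fun j => v j x) atTop (𝓝 (u x))) :
    Tendsto (fun j => mulCurrent Ω (v j) T η) atTop (𝓝 (mulCurrent Ω u T η)) := by
  obtain ⟨ι, hι, idx, c, γ, -, h⟩ := exists_measureRep n m
  obtain ⟨μ, hμ, -⟩ := h Ω hΩ T hT
  simp only [hμ.mulCurrent_eq hΩ hu hη, fun j => hμ.mulCurrent_eq hΩ (hv j) hη]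
  refine tendsto_finsetSum _ fun s _ => Tendsto.const_mul _ ?_
  have h1 : Integrable (fun x => η x (idx s)) (μ s) := by
    simpa using (isLocBddBorel_of_continuousOn hΩ
      (continuousOn_const (c := (1 : ℝ)))).integrable_apply hΩ (hμ.radon s) hη (idx s)
  refine tendsto_integral_of_dominated_convergence (fun x => C * ‖η x (idx s)‖)
    (fun j => ((hv j).integrable_apply hΩ (hμ.radon s) hη _).aestronglyMeasurable)
    (h1.norm.const_mul C) (fun j => Eventually.of_forall fun x => ?_)
    (Eventually.of_forall fun x => ?_)
  · by_cases hx : x ∈ tsupport η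
    · rw [norm_mul, Complex.norm_real]
      exact mul_le_mul_of_nonneg_right (hC j x hx) (norm_nonneg _)
    · simp [image_eq_zero_of_notMem_tsupport hx]
  · by_cases hx : x ∈ tsupport η
    · exact ((Complex.continuous_ofReal.tendsto _).comp (hlim x hx)).mul_const _
    · simp [image_eq_zero_of_notMem_tsupport hx]

/-- Weak convergence of currents and locally uniform convergence of functions. -/
theorem tendsto_mulCurrent_of_weak (hΩ : IsOpen Ω) {Ts : ℕ → QCurrent n}
    (hTs : ∀ j, IsClosedPositive Ω m (Ts j)) (hT : IsClosedPositive Ω m T)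
    (hlim : ∀ η, IsTestForm Ω η → Tendsto (fun j => Ts j η) atTop (𝓝 (T η)))
    {w : ℕ → HSpace n → ℝ} {v : HSpace n → ℝ} (hw : ∀ j, IsLocBddBorel Ω (w j))
    (hv : ContinuousOn v Ω)
    (hwv : ∀ K, IsCompact K → K ⊆ Ω → TendstoUniformlyOn w v atTop K)
    {ζ : QForm n} (hζ : IsTestForm Ω ζ) :
    Tendsto (fun j => mulCurrent Ω (w j) (Ts j) ζ) atTop (𝓝 (mulCurrent Ω v T ζ)) := by
  obtain ⟨ι, hι, idx, c, γ, -, h⟩ := exists_measureRep n m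
  obtain ⟨μ, hμ, hμγ⟩ := h Ω hΩ T hT
  -- The s-th measure of a current is determined by f ↦ T(fγ_s), with γ_s independent of j. Weak
  -- convergence of the currents therefore gives weak convergence of each of these measures.
  choose μs hμs hμsγ using fun j => h Ω hΩ (Ts j) (hTs j)
  simp only [hμ.mulCurrent_eq hΩ (isLocBddBorel_of_continuousOn hΩ hv) hζ,
    fun j => (hμs j).mulCurrent_eq hΩ (hw j) hζ]
  refine tendsto_finsetSum _ fun s _ => Tendsto.const_mul _ ?_
  refine tendsto_integral_mul_of_weak hΩ (fun j => (hμs j).radon s) (hμ.radon s) (fun f hf => ?_)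
    hw hv hwv (hζ.apply _)
  simp only [← hμγ s f hf, fun j => (hμsγ j s f hf).symm]
  exact hlim _ (hf.smul_const _)

end MulCurrent

/-! ### The current `△u ∧ T` -/

section Wedge

variable {n : ℕ} {Ω : Set (HSpace n)} {m : ℕ} {T : QCurrent n}

theorem dOp_degree (α : Fin 2) {F : QForm n} {k : ℕ} (h : ∀ I, I.card = k → ∀ x, F x I = 0)
    (J : Finset (Fin (n * 2))) (hJ : J.card = k + 1) (x : HSpace n) : dOp α F x J = 0 := by
  refine Finset.sum_eq_zero fun j hj => ?_
  have h0 : (fun y => F y (J.erase j)) = fun _ => 0 :=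
    funext fun y => h _ (by rw [Finset.card_erase_of_mem hj, hJ]; simp) y
  rw [h0]
  simp [nabla, partialX]

theorem baston_degree {F : QForm n} {k : ℕ} (h : ∀ I, I.card = k → ∀ x, F x I = 0)
    (J : Finset (Fin (n * 2))) (hJ : J.card = k + 2) (x : HSpace n) : baston F x J = 0 :=
  dOp_degree 0 (k := k + 1) (fun I hI y => dOp_degree 1 h I hI y) J hJ x

theorem tsupport_baston_subset {η : QForm n} (hη : ContDiff ℝ ∞ η) :
    tsupport (baston η) ⊆ tsupport η := by
  refine closure_minimal (fun x hx => ?_) (isClosed_tsupport _)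
  by_contra hc
  refine hx ?_
  rw [baston_congr hη contDiff_const (notMem_tsupport_iff_eventuallyEq.mp hc)]
  change dOp 0 (dOp 1 (0 : QForm n)) x = 0
  rw [dOp_zero, dOp_zero]
  rfl

/-- For smooth `u` the current `△u ∧ T` is the exterior product with the form `△u`. -/
theorem IsClosedPositive.smul_baston (hT : IsClosedPositive Ω m T) {u : HSpace n → ℝ}
    (hu : ContDiff ℝ ∞ u) {η : QForm n} (hη : IsTestForm Ω η) :
    T (fun x => u x • baston η x) = T fun x => hessForm (hess u x) (η x) := by
  have h1 : IsTestForm Ω fun y => u y • dOp 1 η y := (hη.dOp 1).smul hu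
  have h2 : IsTestForm Ω fun y => ∑ p, pd p u y • dx 0 p (η y) := by
    have := IsTestForm.sum (Ω := Ω) Finset.univ (η := fun p y => pd p u y • dx 0 p (η y))
      fun p _ => (hη.end_apply (dx 0 p)).smul (ContDiff.pd hu p)
    have e : (∑ p, fun y => pd p u y • dx 0 p (η y)) = fun y => ∑ p, pd p u y • dx 0 p (η y) := by
      funext y
      simp
    rwa [e] at this
  have h3 : IsTestForm Ω fun x => hessForm (hess u x) (η x) :=
    IsTestForm.hessForm (contDiff_hess hu) hη
  have e : (fun x => u x • baston η x) = (dOp 0 (fun y => u y • dOp 1 η y) +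
      dOp 1 (fun y => ∑ p, pd p u y • dx 0 p (η y))) + fun x => hessForm (hess u x) (η x) :=
    funext fun x => smul_baston_eq hu hη.1 x
  rw [e, hT.add _ _ ((h1.dOp 0).add (h2.dOp 1)) h3, hT.add _ _ (h1.dOp 0) (h2.dOp 1),
    hT.closed 0 _ h1, hT.closed 1 _ h2, zero_add, zero_add]

theorem IsClosedPositive.bastonWedge_of_contDiff (hΩ : IsOpen Ω) (hT : IsClosedPositive Ω m T)
    {u : HSpace n → ℝ} (hu : ContDiff ℝ ∞ u) {η : QForm n} (hη : IsTestForm Ω η) :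
    bastonWedge Ω u T η = T fun x => hessForm (hess u x) (η x) := by
  rw [bastonWedge, hT.mulCurrent_of_contDiff hΩ hu hη.baston, hT.smul_baston hu hη]

theorem nonneg_real_of_tendsto {z : ℕ → ℂ} {w : ℂ} (h : Tendsto z atTop (𝓝 w))
    (hz : ∀ j, ∃ c : ℝ, 0 ≤ c ∧ z j = c) : ∃ c : ℝ, 0 ≤ c ∧ w = c := by
  choose c hc hzc using hz
  have hre : Tendsto (fun j => (z j).re) atTop (𝓝 w.re) := (Complex.continuous_re.tendsto w).comp h
  have him : Tendsto (fun j => (z j).im) atTop (𝓝 w.im) := (Complex.continuous_im.tendsto w).comp h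
  simp only [hzc, Complex.ofReal_re, Complex.ofReal_im] at hre him
  refine ⟨w.re, ge_of_tendsto' hre hc, Complex.ext (by simp) ?_⟩
  simpa using (tendsto_nhds_unique him tendsto_const_nhds)

theorem contDiff_prod_hessForm (As : List (HSpace n → Matrix (RIdx n) (RIdx n) ℝ))
    (hAs : ∀ A ∈ As, ∀ p q, ContDiff ℝ ∞ fun x => A x p q) :
    ContDiff ℝ ∞ fun x => (As.map fun A => hessForm (A x)).prod (omega ∅) := by
  induction As with
  | nil => simpa using contDiff_const
  | cons A As ih =>
    simp only [List.map_cons, List.prod_cons, Module.End.mul_apply]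
    exact contDiff_hessForm (hAs A (by simp)) (ih fun B hB => hAs B (by simp [hB]))

theorem IsTestFun.smul_form {f : HSpace n → ℝ} (hf : IsTestFun Ω f) {η : QForm n}
    (hη : ContDiff ℝ ∞ η) : IsTestForm Ω fun x => f x • η x := by
  have := hf.of_eq_zero (hf.1.smul hη) fun x hx => by simp [hx]
  exact this

/-- The Hessian of u joins the list of matrices. This is why `IsClosedPositive` tests positivity
against variable matrix fields, and asks them to be nonnegative only on the support of f: smooth
approximants are controlled only near a compact set. -/
theorem IsClosedPositive.hessForm_nonneg (hT : IsClosedPositive Ω (m + 1) T) {u : HSpace n → ℝ}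
    (hu : ContDiff ℝ ∞ u) {f : HSpace n → ℝ} {As : List (HSpace n → Matrix (RIdx n) (RIdx n) ℝ)}
    (hf : IsTestFun Ω f) (hf0 : ∀ x, 0 ≤ f x) (hlen : As.length = m)
    (hAs : ∀ A ∈ As, (∀ p q, ContDiff ℝ ∞ fun x => A x p q) ∧
      ∀ x ∈ tsupport f, (A x).IsSymm ∧ LineNonneg (A x))
    (hpos : ∀ x ∈ tsupport f, LineNonneg (hess u x)) :
    ∃ c : ℝ, 0 ≤ c ∧ T (fun x => hessForm (hess u x)
      (f x • (As.map fun A => hessForm (A x)).prod (omega ∅))) = c := by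
  have := hT.nonneg f (hess u :: As) hf hf0 (by simp [hlen]) (by
    intro A hA
    rcases List.mem_cons.mp hA with rfl | hA
    · exact ⟨contDiff_hess hu, fun x hx => ⟨hess_isSymm hu x, hpos x hx⟩⟩
    · exact hAs A hA)
  simpa only [List.map_cons, List.prod_cons, Module.End.mul_apply, end_map_real_smul] using this

/-- Linearity, closedness and degree of `△u ∧ T`; only positivity remains. -/
theorem IsClosedPositive.bastonWedge_of_nonneg (hΩ : IsOpen Ω)
    (hT : IsClosedPositive Ω (m + 1) T) {u : HSpace n → ℝ} (hu : IsLocBddBorel Ω u)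
    (hpos : ∀ (f : HSpace n → ℝ) (As : List (HSpace n → Matrix (RIdx n) (RIdx n) ℝ)),
      IsTestFun Ω f → (∀ x, 0 ≤ f x) → As.length = m →
      (∀ A ∈ As, (∀ p q, ContDiff ℝ ∞ fun x => A x p q) ∧
        ∀ x ∈ tsupport f, (A x).IsSymm ∧ LineNonneg (A x)) →
      ∃ c : ℝ, 0 ≤ c ∧ bastonWedge Ω u T
        (fun x => f x • (As.map fun A => hessForm (A x)).prod (omega ∅)) = c) :
    IsClosedPositive Ω m (bastonWedge Ω u T) where
  add η ζ hη hζ := by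
    rw [bastonWedge, baston_add hη.1 hζ.1, hT.mulCurrent_add hΩ hu hη.baston hζ.baston]
    rfl
  smul c η hη := by
    rw [bastonWedge, baston_smul c hη.1, hT.mulCurrent_smul hΩ hu c hη.baston]
    rfl
  closed α ξ hξ := by
    rw [bastonWedge, baston_dOp α hξ.1]
    exact hT.mulCurrent_degree hΩ hu IsTestForm.zero fun I _ x => rfl
  nonneg := hpos
  degree η hη h := hT.mulCurrent_degree hΩ hu hη.baston (baston_degree h)

theorem IsClosedPositive.bastonWedge_smooth (hΩ : IsOpen Ω)
    (hT : IsClosedPositive Ω (m + 1) T) {u : HSpace n → ℝ} (hu : ContDiff ℝ ∞ u)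
    (hpos : ∀ x ∈ Ω, LineNonneg (hess u x)) : IsClosedPositive Ω m (bastonWedge Ω u T) := by
  refine hT.bastonWedge_of_nonneg hΩ (isLocBddBorel_of_continuousOn hΩ hu.continuous.continuousOn)
    fun f As hf hf0 hlen hAs => ?_
  rw [hT.bastonWedge_of_contDiff hΩ hu
    (hf.smul_form (contDiff_prod_hessForm As fun A hA => (hAs A hA).1))]
  exact hT.hessForm_nonneg hu hf hf0 hlen hAs fun x hx => hpos x (hf.2.2 hx)

/-- For a locally bounded plurisubharmonic function `u`, the current `△u ∧ T` is closed and
positive. -/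
theorem IsClosedPositive.bastonWedge (hΩ : IsOpen Ω) (hT : IsClosedPositive Ω (m + 1) T)
    {u : HSpace n → ℝ} (hu : IsPSH Ω u) (hb : IsLocallyBoundedOn Ω u) :
    IsClosedPositive Ω m (bastonWedge Ω u T) := by
  refine hT.bastonWedge_of_nonneg hΩ (hu.isLocBddBorel hΩ hb) fun f As hf hf0 hlen hAs => ?_
  have htest : IsTestForm Ω fun x => f x • (As.map fun A => hessForm (A x)).prod (omega ∅) :=
    hf.smul_form (contDiff_prod_hessForm As fun A hA => (hAs A hA).1)
  have hK : IsCompact (tsupport f) := hf.2.1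
  obtain ⟨v, hv, hvpos, ⟨C, hC⟩, hlim⟩ := hu.exists_smooth_approx hΩ hb hK hf.2.2
  have hsub : tsupport (baston fun x => f x • (As.map fun A => hessForm (A x)).prod (omega ∅)) ⊆
      tsupport f :=
    (tsupport_baston_subset htest.1).trans (tsupport_smul_subset_left f _)
  -- Positivity survives in the limit: bounded pointwise convergence replaces u by v_j, and for
  -- smooth v_j closedness of T turns v_j△η into the Hessian form of v_j applied to η.
  refine nonneg_real_of_tendsto (hT.tendsto_mulCurrent hΩ
    (fun j => isLocBddBorel_of_continuousOn hΩ (hv j).continuous.continuousOn)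
    (hu.isLocBddBorel hΩ hb) htest.baston (C := C) (fun j x _ => hC j x)
    fun x hx => hlim x (hsub hx)) fun j => ?_
  rw [hT.mulCurrent_of_contDiff hΩ (hv j) htest.baston, hT.smul_baston (hv j) htest]
  exact hT.hessForm_nonneg (hv j) hf hf0 hlen hAs fun x hx => hvpos j x hx

end Wedge

/-! ### Products of locally bounded plurisubharmonic functions -/

section Products

variable {n : ℕ} {Ω : Set (HSpace n)} {m : ℕ} {T : QCurrent n}

theorem IsTestForm.integrable_apply {η : QForm n} (hη : IsTestForm Ω η)
    (I : Finset (Fin (n * 2))) : Integrable fun x => η x I :=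
  (hη.apply I).1.continuous.integrable_of_hasCompactSupport (hη.apply I).2.1

/-- Closedness is the vanishing of integrals of derivatives of test functions. Positivity holds
pointwise by `prod_hessForm_nonneg`, where all the linear algebra enters. -/
theorem isClosedPositive_bastonProduct_nil (Ω : Set (HSpace n)) :
    IsClosedPositive Ω n (bastonProduct Ω []) where
  add η ζ hη hζ :=
    integral_add (hη.integrable_apply _).integrableOn (hζ.integrable_apply _).integrableOn
  smul c η _ := integral_const_mul c _
  closed α ξ hξ := integral_dOp_univ_eq_zero hξ α _
  nonneg f As hf hf0 hlen hAs := by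
    have h : ∀ x, ∃ a : ℝ, 0 ≤ a ∧
        (f x • (As.map fun A => hessForm (A x)).prod (omega ∅)) Finset.univ = (a : ℂ) := by
      intro x
      by_cases hx : x ∈ tsupport f
      · obtain ⟨c, hc, h⟩ := prod_hessForm_nonneg (As.map fun A => A x) (by
          simp only [List.mem_map]
          rintro H ⟨A, hA, rfl⟩
          exact (hAs A hA).2 x hx) (by simpa using hlen)
        refine ⟨f x * c, mul_nonneg (hf0 x) hc, ?_⟩
        rw [List.map_map] at h
        rw [Pi.smul_apply, Complex.real_smul, Complex.ofReal_mul, ← h]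
        rfl
      · exact ⟨0, le_rfl, by simp [image_eq_zero_of_notMem_tsupport hx]⟩
    choose a ha hfa using h
    refine ⟨∫ x in Ω, a x, integral_nonneg ha, ?_⟩
    simp only [bastonProduct, hfa]
    exact integral_complex_ofReal
  degree η _ h := by
    simp [bastonProduct, h Finset.univ (by simp [mul_comm])]

/-- Each additional factor lowers m by one, starting from m = n for the empty product, so at most n
factors are possible. -/
theorem isClosedPositive_bastonProduct (hΩ : IsOpen Ω) (us : List (HSpace n → ℝ))
    (hus : ∀ u ∈ us, IsPSH Ω u ∧ IsLocallyBoundedOn Ω u) (hlen : us.length + m = n) :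
    IsClosedPositive Ω m (bastonProduct Ω us) := by
  induction us generalizing m with
  | nil =>
    obtain rfl : m = n := by simpa using hlen
    exact isClosedPositive_bastonProduct_nil Ω
  | cons u us ih =>
    have hu := hus u (by simp)
    have := ih (m := m + 1) (fun v hv => hus v (by simp [hv])) (by
      simp only [List.length_cons] at hlen
      omega)
    exact this.bastonWedge hΩ hu.1 hu.2

theorem mongeAmpere_isCoefficientMeasure (hΩ : IsOpen Ω) (us : List (HSpace n → ℝ))
    (hus : ∀ u ∈ us, IsPSH Ω u ∧ IsLocallyBoundedOn Ω u) (hlen : us.length = n) :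
    IsCoefficientMeasure Ω (bastonProduct Ω us) (mongeAmpere Ω us) := by
  have hex := (isClosedPositive_bastonProduct (m := 0) hΩ us hus hlen).exists_coefficientMeasure hΩ
  rw [mongeAmpere, dif_pos hex]
  exact hex.choose_spec

theorem mongeAmpereDefined (hΩ : IsOpen Ω) (us : List (HSpace n → ℝ))
    (hus : ∀ u ∈ us, IsPSH Ω u ∧ IsLocallyBoundedOn Ω u) (hlen : us.length = n) :
    MongeAmpereDefined Ω us := by
  refine ⟨fun vs hvs => ?_, mongeAmpere_isCoefficientMeasure hΩ us hus hlen⟩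
  have := hvs.length_le
  exact (isClosedPositive_bastonProduct (m := n - vs.length) hΩ vs
    (fun u hu => hus u (hvs.subset hu)) (by omega)).hasMeasureCoefficients hΩ

end Products

/-! ### Commutativity -/

section Commutativity

variable {n : ℕ} {Ω : Set (HSpace n)} {m : ℕ} {T : QCurrent n}

theorem hessForm_apply_coeff (H : Matrix (RIdx n) (RIdx n) ℝ) (v : Lam n)
    (I : Finset (Fin (n * 2))) :
    hessForm H v I = ∑ J, hessForm H (omega J) I * v J := by
  have h2 : v = ∑ J, v J • omega J := by
    funext K
    simp [omega, Finset.sum_apply, Pi.single_apply]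
  conv_lhs => rw [h2]
  rw [map_sum, Finset.sum_apply]
  refine Finset.sum_congr rfl fun J _ => ?_
  rw [map_smul, Pi.smul_apply, smul_eq_mul, mul_comm]

/-- `w (△u ∧ T)` for smooth `u`. -/
theorem IsClosedPositive.mulCurrent_bastonWedge_of_contDiff (hΩ : IsOpen Ω)
    (hT : IsClosedPositive Ω m T) {u w : HSpace n → ℝ} (hu : ContDiff ℝ ∞ u)
    (hw : IsLocBddBorel Ω w) {ζ : QForm n} (hζ : IsTestForm Ω ζ) :
    mulCurrent Ω w (QuatPluri.bastonWedge Ω u T) ζ =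
      mulCurrent Ω w T fun x => hessForm (hess u x) (ζ x) := by
  obtain ⟨μ, g, hd⟩ := hT.hasMeasureCoefficients hΩ
  have htest : ∀ η, IsTestForm Ω η → IsTestForm Ω fun x => hessForm (hess u x) (η x) :=
    fun η hη => IsTestForm.hessForm (contDiff_hess hu) hη
  -- The transpose of multiplication by △u, applied to the coefficients of T, gives coefficients of
  -- △u ∧ T for the same measure μ.
  let g' : QForm n := fun x J => ∑ I, g x I * hessForm (hess u x) (omega J) I
  have hcoeff : ∀ (η : QForm n) x,
      ∑ I, g x I * hessForm (hess u x) (η x) I = ∑ J, g' x J * η x J := by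
    intro η x
    simp only [g', hessForm_apply_coeff _ (η x), Finset.mul_sum, Finset.sum_mul]
    rw [Finset.sum_comm]
    simp only [mul_assoc]
  have hloc : LocallyIntegrableOn g' Ω μ := by
    rw [locallyIntegrableOn_iff hΩ.isLocallyClosed]
    intro K hKΩ hK
    refine Integrable.of_eval fun J => ?_
    refine integrable_finsetSum _ fun I _ => ?_
    have hc : Continuous fun x => hessForm (hess u x) (omega J) I :=
      (contDiff_pi.mp (contDiff_hessForm (contDiff_hess hu) contDiff_const) I).continuous
    exact ((LocallyIntegrableOn.apply hΩ hd.2.1 I).integrableOn_compact_subset hKΩ hK).mul_continuousOn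
      hc.continuousOn hK
  have hd' : HasDensity Ω (QuatPluri.bastonWedge Ω u T) μ g' := by
    refine ⟨hd.1, hloc, fun η hη => ?_⟩
    rw [hT.bastonWedge_of_contDiff hΩ hu hη, hd.2.2 _ (htest η hη)]
    simp only [hcoeff η]
  rw [hd'.mulCurrent_eq hΩ hw hζ, hd.mulCurrent_eq hΩ hw (htest ζ hζ)]
  simp only [hcoeff ζ]

/-- The product is commutative if one of the functions is continuous. -/
theorem IsClosedPositive.bastonWedge_comm (hΩ : IsOpen Ω) (hT : IsClosedPositive Ω (m + 2) T)
    {u w : HSpace n → ℝ} (hu : IsPSH Ω u) (hub : IsLocallyBoundedOn Ω u) (hw : IsPSH Ω w)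
    (hwb : IsLocallyBoundedOn Ω w) (hwc : ContinuousOn w Ω) {η : QForm n} (hη : IsTestForm Ω η) :
    QuatPluri.bastonWedge Ω u (QuatPluri.bastonWedge Ω w T) η =
      QuatPluri.bastonWedge Ω w (QuatPluri.bastonWedge Ω u T) η := by
  obtain ⟨L, hL, hKL, hLΩ⟩ := exists_compact_between hη.2.1 hΩ hη.2.2
  set U := interior L with hUdef
  have hU : IsOpen U := isOpen_interior
  have hUL : U ⊆ L := interior_subset
  have hUΩ : U ⊆ Ω := hUL.trans hLΩ
  have hηU : IsTestForm U η := ⟨hη.1, hη.2.1, hKL⟩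
  obtain ⟨v, hv, hvpos, ⟨C, hC⟩, hlim⟩ := hu.exists_smooth_approx hΩ hub hL hLΩ
  have hvb : ∀ j, IsLocBddBorel Ω (v j) := fun j =>
    isLocBddBorel_of_continuousOn hΩ (hv j).continuous.continuousOn
  have huB := hu.isLocBddBorel hΩ hub
  have hwB := hw.isLocBddBorel hΩ hwb
  have hS : IsClosedPositive Ω (m + 1) (QuatPluri.bastonWedge Ω w T) := hT.bastonWedge hΩ hw hwb
  have hR : IsClosedPositive Ω (m + 1) (QuatPluri.bastonWedge Ω u T) := hT.bastonWedge hΩ hu hub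
  have hTU : IsClosedPositive U (m + 2) T := hT.mono hUΩ
  have hlimη : ∀ ξ, IsTestForm U ξ → ∀ {k} {S : QCurrent n}, IsClosedPositive Ω k S →
      Tendsto (fun j => mulCurrent Ω (v j) S ξ) atTop (𝓝 (mulCurrent Ω u S ξ)) :=
    fun ξ hξ k S hS => hS.tendsto_mulCurrent hΩ hvb huB (hξ.mono hUΩ) (C := C)
      (fun j x _ => hC j x) fun x hx => hlim x (hUL (hξ.2.2 hx))
  -- Both orders are limits of w T evaluated on △v_j ∧ △η, with v_j smooth approximants of u. Here
  -- v_j tends to u in the outer factor, and △(v_j △η) = △v_j ∧ △η because △η is closed.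
  have h1 : Tendsto (fun j => mulCurrent Ω w T fun x => hessForm (hess (v j) x) (baston η x)) atTop
      (𝓝 (QuatPluri.bastonWedge Ω u (QuatPluri.bastonWedge Ω w T) η)) := by
    refine (hlimη _ hηU.baston hS).congr fun j => ?_
    rw [hS.mulCurrent_of_contDiff hΩ (hv j) hη.baston, QuatPluri.bastonWedge]
    congr 1
    funext x
    exact baston_smul_of_closed (hv j) (ContDiff.baston hη.1) (dOp_baston 0 hη.1)
      (dOp_baston 1 hη.1) x
  -- In the other order △v_j ∧ T tends weakly to △u ∧ T, and continuity of w allows multiplication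
  -- by it. The passage to U is needed because the Hessians of the v_j are nonnegative only on L.
  have h2 : Tendsto (fun j => mulCurrent U w (QuatPluri.bastonWedge U (v j) T) (baston η)) atTop
      (𝓝 (mulCurrent U w (QuatPluri.bastonWedge Ω u T) (baston η))) := by
    refine tendsto_mulCurrent_of_weak hU
      (fun j => hTU.bastonWedge_smooth hU (hv j) fun x hx => hvpos j x (hUL hx)) (hR.mono hUΩ)
      (fun ξ hξ => ?_) (fun j => hwB.mono hU hUΩ) (hwc.mono hUΩ) (fun K _ _ => ?_) hηU.baston
    · refine (hlimη _ hξ.baston hT).congr fun j => ?_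
      rw [QuatPluri.bastonWedge, hT.mulCurrent_restrict hΩ hU hUΩ (hvb j) hξ.baston]
    · rw [Metric.tendstoUniformlyOn_iff]
      intro ε hε
      exact Eventually.of_forall fun _ x _ => by simpa using hε
  have h3 : ∀ j, mulCurrent U w (QuatPluri.bastonWedge U (v j) T) (baston η) =
      mulCurrent Ω w T fun x => hessForm (hess (v j) x) (baston η x) := by
    intro j
    rw [hTU.mulCurrent_bastonWedge_of_contDiff hU (hv j) (hwB.mono hU hUΩ) hηU.baston]
    exact hT.mulCurrent_restrict hΩ hU hUΩ hwB
      (IsTestForm.hessForm (contDiff_hess (hv j)) hηU.baston)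
  simp only [h3] at h2
  rw [hR.mulCurrent_restrict hΩ hU hUΩ hwB hηU.baston] at h2
  exact tendsto_nhds_unique h1 h2

end Commutativity

/-! ### Truncations -/

section Truncation

variable {n : ℕ} {Ω : Set (HSpace n)} {φ : HSpace n → ℝ}

theorem UpperSemicontinuousOn.max_add_const {X : Type*} [TopologicalSpace X] {f : X → ℝ}
    {s : Set X} (hf : UpperSemicontinuousOn f s) (ε r : ℝ) :
    UpperSemicontinuousOn (fun x => max (f x + ε) r) s := by
  intro x hx y hy
  have h1 := hf x hx (y - ε) (by linarith [(max_lt_iff.mp hy).1])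
  filter_upwards [h1] with z hz
  exact max_lt (by linarith) (max_lt_iff.mp hy).2

theorem IsSubharmonicOn.max_add_const {f : EuclideanSpace ℝ (Fin 4) → ℝ}
    {U : Set (EuclideanSpace ℝ (Fin 4))} (hf : IsSubharmonicOn f U) (ε r : ℝ) :
    IsSubharmonicOn (fun x => max (f x + ε) r) U := by
  refine ⟨UpperSemicontinuousOn.max_add_const hf.1 ε r, fun c R hR hcR => ?_⟩
  obtain ⟨hi, hle⟩ := hf.2 c R hR hcR
  have hfin : volume (Metric.ball c R) ≠ ⊤ := measure_ball_lt_top.ne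
  have hne : volume (Metric.ball c R) ≠ 0 := (Metric.measure_ball_pos volume c hR).ne'
  have hconst : ∀ a : ℝ, IntegrableOn (fun _ => a) (Metric.ball c R) volume := fun a =>
    integrableOn_const hfin
  have hie : IntegrableOn (fun x => f x + ε) (Metric.ball c R) volume := hi.add (hconst ε)
  have him : IntegrableOn (fun x => max (f x + ε) r) (Metric.ball c R) volume := hie.sup (hconst r)
  have hmono : ∀ {g h : EuclideanSpace ℝ (Fin 4) → ℝ}, IntegrableOn g (Metric.ball c R) volume →
      IntegrableOn h (Metric.ball c R) volume → (∀ x, g x ≤ h x) →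
      ⨍ q in Metric.ball c R, g q ≤ ⨍ q in Metric.ball c R, h q := by
    intro g h hg hh hgh
    rw [setAverage_eq, setAverage_eq]
    exact smul_le_smul_of_nonneg_left (integral_mono hg hh hgh) (by positivity)
  have hce : ∀ a : ℝ, ⨍ _ in Metric.ball c R, a = a := fun a => setAverage_const hne hfin a
  refine ⟨him, max_le ?_ ?_⟩
  · have h1 : ⨍ q in Metric.ball c R, (f q + ε) = (⨍ q in Metric.ball c R, f q) + ε := by
      conv_rhs => rw [← hce ε]
      rw [setAverage_eq, setAverage_eq, setAverage_eq, integral_add hi (hconst ε), smul_add]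
    calc f c + ε ≤ (⨍ q in Metric.ball c R, f q) + ε := by linarith
      _ = ⨍ q in Metric.ball c R, (f q + ε) := h1.symm
      _ ≤ _ := hmono hie him fun x => le_max_left _ _
  · calc r = ⨍ _ in Metric.ball c R, r := (hce r).symm
      _ ≤ _ := hmono (hconst r) him fun x => le_max_right _ _

theorem IsPSH.max_add_const (hφ : IsPSH Ω φ) (ε r : ℝ) :
    IsPSH Ω fun q => max (φ q + ε) r :=
  ⟨UpperSemicontinuousOn.max_add_const hφ.1 ε r,
    fun a v hv => (hφ.2 a v hv).max_add_const ε r⟩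

theorem IsPSH.truncation (hφ : IsPSH Ω φ) (r : ℝ) : IsPSH Ω (truncation φ r) := by
  have := hφ.max_add_const 0 r
  simp only [add_zero] at this
  exact this

theorem isLocallyBoundedOn_of_continuousOn (hφ : ContinuousOn φ Ω) : IsLocallyBoundedOn Ω φ := by
  intro x hx
  refine ⟨|φ x| + 1, ?_⟩
  have h : ContinuousWithinAt (fun y => |φ y|) Ω x := (hφ x hx).abs
  filter_upwards [h.eventually (gt_mem_nhds (lt_add_one |φ x|))] with y hy using hy.le

theorem continuousOn_truncation (hφ : ContinuousOn φ Ω) (r : ℝ) :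
    ContinuousOn (truncation φ r) Ω := hφ.sup continuousOn_const

end Truncation

/-! ### Locality -/

section Locality

variable {n : ℕ} {Ω U : Set (HSpace n)} {m : ℕ} {T S : QCurrent n} {u v : HSpace n → ℝ}

theorem IsClosedPositive.apply_baston (hT : IsClosedPositive Ω m T) {η : QForm n}
    (hη : IsTestForm Ω η) : T (baston η) = 0 := hT.closed 0 _ (hη.dOp 1)

/-- The form △η is exact and T is closed, so additive constants in u do not affect △u ∧ T. -/
theorem IsClosedPositive.mulCurrent_const_baston (hΩ : IsOpen Ω) (hT : IsClosedPositive Ω m T)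
    (c : ℝ) {η : QForm n} (hη : IsTestForm Ω η) :
    mulCurrent Ω (fun _ => c) T (baston η) = 0 := by
  rw [hT.mulCurrent_of_contDiff hΩ contDiff_const hη.baston]
  have e : (fun x => c • baston η x) = (c : ℂ) • baston η := by
    funext x I
    simp
  rw [e, hT.smul _ _ hη.baston, hT.apply_baston hη, mul_zero]

/-- The current `△u ∧ T` depends only on `u` up to constants, locally. -/
theorem IsClosedPositive.bastonWedge_congr (hΩ : IsOpen Ω) (hT : IsClosedPositive Ω m T)
    (hS : IsClosedPositive Ω m S) (hU : IsOpen U) (hUΩ : U ⊆ Ω)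
    (hTS : ∀ η, IsTestForm U η → T η = S η) (hu : IsLocBddBorel Ω u) (hv : IsLocBddBorel Ω v)
    {c : ℝ} (huv : ∀ x ∈ U, u x = v x + c) {η : QForm n} (hη : IsTestForm U η) :
    QuatPluri.bastonWedge Ω u T η = QuatPluri.bastonWedge Ω v S η := by
  have hTU := hT.mono hUΩ
  have hcb : IsLocBddBorel U fun _ => c := isLocBddBorel_of_continuousOn hU continuousOn_const
  unfold QuatPluri.bastonWedge
  rw [← hT.mulCurrent_restrict hΩ hU hUΩ hu hη.baston,
    ← hS.mulCurrent_restrict hΩ hU hUΩ hv hη.baston,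
    ← mulCurrent_congr_current hU (hTU.hasMeasureCoefficients hU) hTS (hv.mono hU hUΩ) hη.baston,
    ← sub_eq_zero, ← hTU.mulCurrent_sub hU (hu.mono hU hUΩ) (hv.mono hU hUΩ) hη.baston,
    ← hTU.mulCurrent_const_baston hU c hη]
  refine hTU.mulCurrent_congr hU ((hu.mono hU hUΩ).sub (hv.mono hU hUΩ)) hcb hη.baston hη.baston
    fun x => ?_
  by_cases hx : x ∈ U
  · rw [huv x hx, add_sub_cancel_left]
  · rw [image_eq_zero_of_notMem_tsupport fun h => hx (hη.baston.2.2 h), smul_zero, smul_zero]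

/-- The constant c is allowed for the sake of max{φ + ε, r}, which equals φ + ε where φ > r - ε. -/
theorem bastonProduct_replicate_congr (hΩ : IsOpen Ω) (hU : IsOpen U) (hUΩ : U ⊆ Ω)
    (hu : IsPSH Ω u) (hub : IsLocallyBoundedOn Ω u) (hv : IsPSH Ω v)
    (hvb : IsLocallyBoundedOn Ω v) {c : ℝ} (huv : ∀ x ∈ U, u x = v x + c) {k : ℕ} (hk : k ≤ n)
    {η : QForm n} (hη : IsTestForm U η) :
    bastonProduct Ω (List.replicate k u) η = bastonProduct Ω (List.replicate k v) η := by
  induction k generalizing η with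
  | zero => rfl
  | succ k ih =>
    have hcp : ∀ {w : HSpace n → ℝ}, IsPSH Ω w → IsLocallyBoundedOn Ω w →
        IsClosedPositive Ω (n - k) (bastonProduct Ω (List.replicate k w)) := fun hw hwb =>
      isClosedPositive_bastonProduct hΩ _ (fun w' hw' => by
        rw [List.eq_of_mem_replicate hw']; exact ⟨hw, hwb⟩) (by simp; omega)
    exact (hcp hu hub).bastonWedge_congr hΩ (hcp hv hvb) hU hUΩ (fun ξ hξ => ih (by omega) hξ)
      (hu.isLocBddBorel hΩ hub) (hv.isLocBddBorel hΩ hvb) huv hη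

/-- By induction on the number of factors: weak convergence of the shorter product and locally
uniform convergence of w_j pass to the next product. -/
theorem tendsto_bastonProduct_replicate (hΩ : IsOpen Ω) {w : ℕ → HSpace n → ℝ}
    (hw : ∀ j, IsPSH Ω (w j)) (hwb : ∀ j, IsLocallyBoundedOn Ω (w j)) (hv : IsPSH Ω v)
    (hvc : ContinuousOn v Ω)
    (hwv : ∀ K, IsCompact K → K ⊆ Ω → TendstoUniformlyOn w v atTop K) {k : ℕ} (hk : k ≤ n)
    {η : QForm n} (hη : IsTestForm Ω η) :
    Tendsto (fun j => bastonProduct Ω (List.replicate k (w j)) η) atTop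
      (𝓝 (bastonProduct Ω (List.replicate k v) η)) := by
  induction k generalizing η with
  | zero => exact tendsto_const_nhds
  | succ k ih =>
    have hcp : ∀ {w : HSpace n → ℝ}, IsPSH Ω w → IsLocallyBoundedOn Ω w →
        IsClosedPositive Ω (n - k) (bastonProduct Ω (List.replicate k w)) := fun hw hwb =>
      isClosedPositive_bastonProduct hΩ _ (fun w' hw' => by
        rw [List.eq_of_mem_replicate hw']; exact ⟨hw, hwb⟩) (by simp; omega)
    exact tendsto_mulCurrent_of_weak hΩ (fun j => hcp (hw j) (hwb j))
      (hcp hv (isLocallyBoundedOn_of_continuousOn hvc)) (fun ξ hξ => ih (by omega) hξ)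
      (fun j => (hw j).isLocBddBorel hΩ (hwb j)) hvc hwv hη.baston

end Locality

/-! ### Coefficient measures -/

section Coefficient

variable {n : ℕ} {Ω U : Set (HSpace n)} {T S : QCurrent n} {μ ν : Measure (HSpace n)}

theorem IsCoefficientMeasure.isMeasureRep (h : IsCoefficientMeasure Ω T μ) :
    IsMeasureRep Ω T (fun _ : Unit => μ) (fun _ => 1) fun _ => ∅ where
  null _ := h.1
  radon _ := h.2.1
  eq η hη := by simp [h.2.2 η hη]

theorem IsCoefficientMeasure.integral_eq (h : IsCoefficientMeasure Ω T μ) {f : HSpace n → ℝ}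
    (hf : IsTestFun Ω f) : ((∫ x, f x ∂μ : ℝ) : ℂ) = T fun x => f x • omega ∅ := by
  rw [h.2.2 _ (hf.real_smul_const _), ← integral_complex_ofReal]
  simp [omega]

theorem IsCoefficientMeasure.mulCurrent_eq (hΩ : IsOpen Ω) (h : IsCoefficientMeasure Ω T μ)
    {u : HSpace n → ℝ} (hu : IsLocBddBorel Ω u) {f : HSpace n → ℝ} (hf : IsTestFun Ω f) :
    mulCurrent Ω u T (fun x => f x • omega ∅) = ((∫ x, u x * f x ∂μ : ℝ) : ℂ) := by
  rw [h.isMeasureRep.mulCurrent_eq hΩ hu (hf.real_smul_const _), ← integral_complex_ofReal]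
  simp [omega]

/-- Coefficient measures are compared locally. -/
theorem IsCoefficientMeasure.restrict_le (h : IsCoefficientMeasure Ω T μ)
    (h' : IsCoefficientMeasure Ω S ν) (hU : IsOpen U) (hUΩ : U ⊆ Ω)
    (hTS : ∀ η, IsTestForm U η → T η = S η) : μ.restrict U ≤ ν := by
  refine measure_le_of_test hU ?_ (fun K hK hKU => ?_) (fun K hK hKU => ?_) fun f hf _ => ?_
  · rw [Measure.restrict_apply hU.measurableSet.compl]
    simp
  · exact (Measure.restrict_apply_le _ _).trans_lt (h.2.1 K hK (hKU.trans hUΩ))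
  · exact h'.2.1 K hK (hKU.trans hUΩ)
  · rw [setIntegral_eq_integral_of_forall_compl_eq_zero fun x hx => hf.eq_zero hx]
    refine le_of_eq ?_
    have h1 := h.integral_eq (hf.mono hUΩ)
    rw [hTS _ (hf.real_smul_const _), ← h'.integral_eq (hf.mono hUΩ)] at h1
    exact_mod_cast h1

end Coefficient

/-! ### The boundary measure is nonnegative -/

section MassInequality

variable {n : ℕ} {Ω : Set (HSpace n)} {φ : HSpace n → ℝ}

theorem IsRadonOn.integrable_test (hΩ : IsOpen Ω) {μ : Measure (HSpace n)} (hμ : IsRadonOn Ω μ)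
    {f : HSpace n → ℝ} (hf : IsTestFun Ω f) : Integrable f μ := by
  have := (isLocBddBorel_of_continuousOn hΩ (continuousOn_const (c := (1 : ℝ)))).integrable_mul'
    hΩ hμ hf.ofReal.1.continuous hf.ofReal.2.1 hf.ofReal.2.2
  simpa using this.re

theorem mongeAmpereSelf_isCoefficientMeasure (hΩ : IsOpen Ω) (hφ : IsPSH Ω φ)
    (hφb : IsLocallyBoundedOn Ω φ) :
    IsCoefficientMeasure Ω (bastonProduct Ω (List.replicate n φ)) (mongeAmpereSelf Ω φ) :=
  mongeAmpere_isCoefficientMeasure hΩ _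
    (fun u hu => by rw [List.eq_of_mem_replicate hu]; exact ⟨hφ, hφb⟩) (by simp)

/-- The truncation equals φ on {φ ≥ r}, which need not be open. The function max{φ + ε, r} equals φ
+ ε on the open set {φ > r - ε}, so its measure dominates that of φ restricted to {φ ≥ r}. As ε → 0
the convergence to the truncation is uniform and the inequality survives in the weak limit. -/
theorem restrict_mongeAmpereSelf_le (hΩ : IsOpen Ω) (hφ : IsPSH Ω φ) (hφc : ContinuousOn φ Ω)
    (r : ℝ) : (mongeAmpereSelf Ω φ).restrict (Ω \ sublevel Ω φ r) ≤
      mongeAmpereSelf Ω (truncation φ r) := by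
  have hφb := isLocallyBoundedOn_of_continuousOn hφc
  have hψ := hφ.truncation r
  have hψc := continuousOn_truncation hφc r
  have hψb := isLocallyBoundedOn_of_continuousOn hψc
  let w : ℕ → HSpace n → ℝ := fun j q => max (φ q + 1 / ((j : ℝ) + 1)) r
  have hw : ∀ j, IsPSH Ω (w j) := fun j => hφ.max_add_const _ r
  have hwc : ∀ j, ContinuousOn (w j) Ω := fun j =>
    (hφc.add continuousOn_const).sup continuousOn_const
  have hwb := fun j => isLocallyBoundedOn_of_continuousOn (hwc j)
  have hMφ := mongeAmpereSelf_isCoefficientMeasure hΩ hφ hφb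
  have hMψ := mongeAmpereSelf_isCoefficientMeasure hΩ hψ hψb
  have hMw := fun j => mongeAmpereSelf_isCoefficientMeasure hΩ (hw j) (hwb j)
  have hle : ∀ j, (mongeAmpereSelf Ω φ).restrict (Ω \ sublevel Ω φ r) ≤
      mongeAmpereSelf Ω (w j) := by
    intro j
    have hpos : (0 : ℝ) < 1 / ((j : ℝ) + 1) := by positivity
    have hU : IsOpen (Ω ∩ φ ⁻¹' Ioi (r - 1 / ((j : ℝ) + 1))) :=
      hφc.isOpen_inter_preimage hΩ isOpen_Ioi
    refine (Measure.restrict_mono_set _ ?_).trans (hMφ.restrict_le (hMw j) hU inter_subset_left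
      fun η hη => ?_)
    · rintro x ⟨hx, hxB⟩
      refine ⟨hx, ?_⟩
      have : r ≤ φ x := by
        by_contra h
        exact hxB ⟨hx, not_le.mp h⟩
      simp only [mem_preimage, mem_Ioi]
      linarith
    · refine (bastonProduct_replicate_congr hΩ hU inter_subset_left (hw j) (hwb j) hφ hφb
        (c := 1 / ((j : ℝ) + 1)) (fun x hx => max_eq_left ?_) le_rfl hη).symm
      have : r - 1 / ((j : ℝ) + 1) < φ x := hx.2
      linarith
  refine measure_le_of_test hΩ ?_ (fun K hK hKΩ => ?_) hMψ.2.1 fun f hf hf0 => ?_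
  · exact le_antisymm ((Measure.restrict_apply_le _ _).trans hMφ.1.le) zero_le
  · exact (Measure.restrict_apply_le _ _).trans_lt (hMφ.2.1 K hK hKΩ)
  · have hlim : Tendsto (fun j => ∫ x, f x ∂(mongeAmpereSelf Ω (w j))) atTop
        (𝓝 (∫ x, f x ∂(mongeAmpereSelf Ω (truncation φ r)))) := by
      have h1 := tendsto_bastonProduct_replicate (k := n) hΩ hw hwb hψ hψc (fun K _ _ => ?_) le_rfl
        (hf.real_smul_const (omega ∅))
      · simp only [← hMψ.integral_eq hf, fun j => ((hMw j).integral_eq hf).symm] at h1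
        exact_mod_cast (Complex.continuous_re.tendsto _).comp h1
      · rw [Metric.tendstoUniformlyOn_iff]
        intro ε hε
        obtain ⟨N, hN⟩ := exists_nat_one_div_lt hε
        filter_upwards [eventually_ge_atTop N] with j hj x _
        have h2 : 1 / ((j : ℝ) + 1) ≤ 1 / ((N : ℝ) + 1) := by gcongr
        have h3 : |max (φ x) r - max (φ x + 1 / ((j : ℝ) + 1)) r| ≤
            |φ x - (φ x + 1 / ((j : ℝ) + 1))| := abs_max_sub_max_le_abs _ _ _
        have h4 : |φ x - (φ x + 1 / ((j : ℝ) + 1))| = 1 / ((j : ℝ) + 1) := by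
          rw [sub_add_cancel_left, abs_neg, abs_of_pos (by positivity)]
        rw [Real.dist_eq]
        exact (h3.trans (h4.le.trans h2)).trans_lt hN
    refine ge_of_tendsto' hlim fun j => ?_
    exact integral_mono_measure (hle j) (Eventually.of_forall hf0)
      ((hMw j).2.1.integrable_test hΩ hf)

end MassInequality

/-! ### Integration by parts -/

section IntegrationByParts

variable {n : ℕ} {Ω : Set (HSpace n)} {m : ℕ} {S : QCurrent n} {φ ψ V θ : HSpace n → ℝ}

theorem dOp_const (α : Fin 2) (v : Lam n) : dOp α (fun _ => v : QForm n) = 0 := by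
  funext x
  rw [dOp_eq_sum α contDiff_const]
  simp [pd_const]

/-- `∫ θ V △ψ ∧ S - ∫ θ V △φ ∧ S = ∫ (ψ - φ) △V ∧ S`, if `θ = 1` near the set where `ψ ≠ φ`. -/
theorem IsClosedPositive.integration_by_parts (hΩ : IsOpen Ω) (hS : IsClosedPositive Ω (m + 1) S)
    (hφ : IsPSH Ω φ) (hφc : ContinuousOn φ Ω) (hψ : IsPSH Ω ψ) (hψc : ContinuousOn ψ Ω)
    (hV : IsPSH Ω V) (hVb : IsLocallyBoundedOn Ω V) (hθ : IsTestFun Ω θ)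
    (hθ1 : ∀ x ∈ Ω, ψ x - φ x ≠ 0 → ∀ᶠ y in 𝓝 x, θ y = 1) :
    mulCurrent Ω V (QuatPluri.bastonWedge Ω ψ S) (fun x => θ x • omega ∅) -
      mulCurrent Ω V (QuatPluri.bastonWedge Ω φ S) (fun x => θ x • omega ∅) =
    mulCurrent Ω (fun x => ψ x - φ x) (QuatPluri.bastonWedge Ω V S) fun x => θ x • omega ∅ := by
  have hη : IsTestForm Ω fun x => θ x • (omega ∅ : Lam n) := hθ.real_smul_const _
  set η : QForm n := fun x => θ x • omega ∅ with hηdef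
  obtain ⟨L, hL, hKL, hLΩ⟩ := exists_compact_between hη.2.1 hΩ hη.2.2
  set U := interior L with hUdef
  have hU : IsOpen U := isOpen_interior
  have hUL : U ⊆ L := interior_subset
  have hUΩ : U ⊆ Ω := hUL.trans hLΩ
  have hηU : IsTestForm U η := ⟨hη.1, hη.2.1, hKL⟩
  obtain ⟨v, hv, hvpos, ⟨C, hC⟩, hlim⟩ := hV.exists_smooth_approx hΩ hVb hL hLΩ
  have hvb : ∀ j, IsLocBddBorel Ω (v j) := fun j =>
    isLocBddBorel_of_continuousOn hΩ (hv j).continuous.continuousOn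
  have hVB := hV.isLocBddBorel hΩ hVb
  have hφB := isLocBddBorel_of_continuousOn hΩ hφc
  have hψB := isLocBddBorel_of_continuousOn hΩ hψc
  have huB := hψB.sub hφB
  have hSφ := hS.bastonWedge hΩ hφ (isLocallyBoundedOn_of_continuousOn hφc)
  have hSψ := hS.bastonWedge hΩ hψ (isLocallyBoundedOn_of_continuousOn hψc)
  have hSV := hS.bastonWedge hΩ hV hVb
  have hSU : IsClosedPositive U (m + 1) S := hS.mono hUΩ
  have hlimη : ∀ ξ, IsTestForm U ξ → ∀ {k} {R : QCurrent n}, IsClosedPositive Ω k R →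
      Tendsto (fun j => mulCurrent Ω (v j) R ξ) atTop (𝓝 (mulCurrent Ω V R ξ)) :=
    fun ξ hξ k R hR => hR.tendsto_mulCurrent hΩ hvb hVB (hξ.mono hUΩ) (C := C)
      (fun j x _ => hC j x) fun x hx => hlim x (hUL (hξ.2.2 hx))
  have h1 := (hlimη η hηU hSψ).sub (hlimη η hηU hSφ)
  have h2 : Tendsto (fun j => mulCurrent U (fun x => ψ x - φ x)
      (QuatPluri.bastonWedge U (v j) S) η) atTop
      (𝓝 (mulCurrent U (fun x => ψ x - φ x) (QuatPluri.bastonWedge Ω V S) η)) := by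
    refine tendsto_mulCurrent_of_weak hU
      (fun j => hSU.bastonWedge_smooth hU (hv j) fun x hx => hvpos j x (hUL hx)) (hSV.mono hUΩ)
      (fun ξ hξ => ?_) (fun j => huB.mono hU hUΩ) ((hψc.sub hφc).mono hUΩ) (fun K _ _ => ?_) hηU
    · refine (hlimη _ hξ.baston hS).congr fun j => ?_
      rw [QuatPluri.bastonWedge, hS.mulCurrent_restrict hΩ hU hUΩ (hvb j) hξ.baston]
    · rw [Metric.tendstoUniformlyOn_iff]
      intro ε hε
      exact Eventually.of_forall fun _ x _ => by simpa using hε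
  rw [hSV.mulCurrent_restrict hΩ hU hUΩ huB hηU] at h2
  -- For smooth v_j in place of V, both sides are the current (ψ - φ) S, evaluated on △(v_j η) and
  -- on △v_j ∧ η respectively.
  refine tendsto_nhds_unique h1 (h2.congr fun j => ?_)
  have hvη : IsTestForm Ω fun x => v j x • η x := hη.smul (hv j)
  have hhess : IsTestForm Ω fun x => hessForm (hess (v j) x) (η x) :=
    IsTestForm.hessForm (contDiff_hess (hv j)) hη
  rw [hSU.mulCurrent_bastonWedge_of_contDiff hU (hv j) (huB.mono hU hUΩ) hηU,
    hS.mulCurrent_restrict hΩ hU hUΩ huB (IsTestForm.hessForm (contDiff_hess (hv j)) hηU),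
    hSψ.mulCurrent_of_contDiff hΩ (hv j) hη, hSφ.mulCurrent_of_contDiff hΩ (hv j) hη,
    QuatPluri.bastonWedge, QuatPluri.bastonWedge, ← hS.mulCurrent_sub hΩ hψB hφB hvη.baston]
  refine hS.mulCurrent_congr hΩ huB huB hhess hvη.baston fun x => ?_
  by_cases hxΩ : x ∉ Ω
  · rw [image_eq_zero_of_notMem_tsupport fun h => hxΩ (hhess.2.2 h),
      image_eq_zero_of_notMem_tsupport fun h => hxΩ (hvη.baston.2.2 h)]
  by_cases hx : ψ x - φ x = 0
  · rw [hx, zero_smul, zero_smul]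
  -- Where ψ ≠ φ the cutoff is 1 nearby, so △(v_j η) and △v_j ∧ η coincide at x; elsewhere the
  -- factor ψ - φ is zero.
  · congr 1
    have hev := hθ1 x (not_not.mp hxΩ) hx
    have hc : ContDiff ℝ ∞ (fun y => v j y • (omega ∅ : Lam n)) := (hv j).smul contDiff_const
    rw [baston_congr (G := fun y => v j y • (omega ∅ : Lam n)) hvη.1 hc
      (by filter_upwards [hev] with y hy; simp [hηdef, hy]),
      baston_smul_of_closed (hv j) (ζ := fun _ => omega ∅) contDiff_const (dOp_const 0 _)
        (dOp_const 1 _) x]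
    simp [hηdef, hev.self_of_nhds]

end IntegrationByParts

/-! ### Interchanging the factors -/

section Telescoping

variable {n : ℕ} {Ω : Set (HSpace n)} {φ ψ V θ : HSpace n → ℝ}

/-- The factor △φ moves past one △ψ at a time by `IsClosedPositive.bastonWedge_comm`, which applies
because ψ is continuous. -/
theorem bastonProduct_cons_replicate_append (hΩ : IsOpen Ω) (hφ : IsPSH Ω φ)
    (hφb : IsLocallyBoundedOn Ω φ) (hψ : IsPSH Ω ψ) (hψc : ContinuousOn ψ Ω) (j : ℕ)
    (l : List (HSpace n → ℝ)) (hl : ∀ u ∈ l, IsPSH Ω u ∧ IsLocallyBoundedOn Ω u)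
    (hlen : j + 1 + l.length ≤ n) {η : QForm n} (hη : IsTestForm Ω η) :
    bastonProduct Ω (φ :: (List.replicate j ψ ++ l)) η =
      bastonProduct Ω (List.replicate j ψ ++ φ :: l) η := by
  have hψb := isLocallyBoundedOn_of_continuousOn hψc
  induction j generalizing η with
  | zero => rfl
  | succ j ih =>
    have hmem : ∀ u ∈ List.replicate j ψ ++ l, IsPSH Ω u ∧ IsLocallyBoundedOn Ω u := by
      intro u hu
      rcases List.mem_append.mp hu with hu | hu
      · rw [List.eq_of_mem_replicate hu]; exact ⟨hψ, hψb⟩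
      · exact hl u hu
    have hT : IsClosedPositive Ω (n - (j + 2 + l.length) + 2)
        (bastonProduct Ω (List.replicate j ψ ++ l)) :=
      isClosedPositive_bastonProduct hΩ _ hmem (by simp; omega)
    calc bastonProduct Ω (φ :: (List.replicate (j + 1) ψ ++ l)) η =
        bastonWedge Ω φ (bastonWedge Ω ψ (bastonProduct Ω (List.replicate j ψ ++ l))) η := rfl
      _ = bastonWedge Ω ψ (bastonWedge Ω φ (bastonProduct Ω (List.replicate j ψ ++ l))) η :=
        hT.bastonWedge_comm hΩ hφ hφb hψ hψb hψc hη
      _ = bastonWedge Ω ψ (bastonProduct Ω (List.replicate j ψ ++ φ :: l)) η :=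
        mulCurrent_congr_current hΩ ((hT.bastonWedge hΩ hφ hφb).hasMeasureCoefficients hΩ)
          (fun ξ hξ => ih (by omega) hξ) (hψ.isLocBddBorel hΩ hψb) hη.baston

/-- If `ψ` is constant on the open set `B`, then the measure `△V ∧ △ψ ∧ …` vanishes on `B`. -/
theorem measure_eq_zero_of_const (hΩ : IsOpen Ω) {B : Set (HSpace n)} (hB : IsOpen B)
    (hBΩ : B ⊆ Ω) (hψ : IsPSH Ω ψ) (hψc : ContinuousOn ψ Ω) (hV : IsPSH Ω V)
    (hVb : IsLocallyBoundedOn Ω V) {r : ℝ} (hψB : ∀ x ∈ B, ψ x = r) {T : QCurrent n}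
    (hT : IsClosedPositive Ω 2 T) {μ : Measure (HSpace n)}
    (hμ : IsCoefficientMeasure Ω (bastonWedge Ω V (bastonWedge Ω ψ T)) μ) : μ B = 0 := by
  have hψb := isLocallyBoundedOn_of_continuousOn hψc
  have h0 : IsCoefficientMeasure Ω (fun _ => 0 : QCurrent n) 0 :=
    ⟨by simp, fun K _ _ => by simp, fun η _ => by simp⟩
  have hVT := hT.bastonWedge hΩ hV hVb
  have hle : μ.restrict B ≤ 0 := hμ.restrict_le h0 hB hBΩ fun η hη => by
    -- With △ψ outermost, only the values of ψ on the support of η matter. There ψ = r, and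
    -- constants contribute nothing.
    rw [hT.bastonWedge_comm hΩ hV hVb hψ hψb hψc (hη.mono hBΩ), bastonWedge]
    rw [← hVT.mulCurrent_const_baston hΩ r (hη.mono hBΩ)]
    refine hVT.mulCurrent_congr hΩ (hψ.isLocBddBorel hΩ hψb)
      (isLocBddBorel_of_continuousOn hΩ continuousOn_const) (hη.mono hBΩ).baston
      (hη.mono hBΩ).baston fun x => ?_
    by_cases hx : x ∈ B
    · rw [hψB x hx]
    · rw [image_eq_zero_of_notMem_tsupport fun h => hx (hη.baston.2.2 h), smul_zero, smul_zero]
  have := hle B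
  rw [Measure.restrict_apply_self] at this
  simpa using this

/-- The Lelong–Jensen formula, tested against a cutoff function. -/
theorem lelong_jensen_cutoff (hn : 1 ≤ n) (hΩ : IsOpen Ω) (hφ : IsPSH Ω φ)
    (hφc : ContinuousOn φ Ω) (hV : IsPSH Ω V) (hVb : IsLocallyBoundedOn Ω V) (r : ℝ)
    (hθ : IsTestFun Ω θ) (hθ1 : ∀ x ∈ sublevel Ω φ r, ∀ᶠ y in 𝓝 x, θ y = 1) :
    ∫ x, V x * θ x ∂(mongeAmpereSelf Ω (truncation φ r)) -
      ∫ x, V x * θ x ∂(mongeAmpereSelf Ω φ) =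
    ∫ x, (truncation φ r x - φ x) * θ x ∂(mongeAmpere Ω (V :: List.replicate (n - 1) φ)) := by
  have hφb := isLocallyBoundedOn_of_continuousOn hφc
  have hψ := hφ.truncation r
  have hψc := continuousOn_truncation hφc r
  have hψb := isLocallyBoundedOn_of_continuousOn hψc
  have hVB := hV.isLocBddBorel hΩ hVb
  set ψ := truncation φ r with hψdef
  have huB : IsLocBddBorel Ω fun x => ψ x - φ x :=
    (hψ.isLocBddBorel hΩ hψb).sub (hφ.isLocBddBorel hΩ hφb)
  have hB : IsOpen (sublevel Ω φ r) := hφc.isOpen_inter_preimage hΩ isOpen_Iio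
  have hBΩ : sublevel Ω φ r ⊆ Ω := fun x hx => hx.1
  have hψB : ∀ x ∈ sublevel Ω φ r, ψ x = r := fun x hx => max_eq_right hx.2.le
  have hu0 : ∀ x ∈ Ω, x ∉ sublevel Ω φ r → ψ x - φ x = 0 := by
    intro x hx hxB
    have h : r ≤ φ x := not_lt.mp fun h => hxB ⟨hx, h⟩
    simp [hψdef, truncation, h]
  have hη : IsTestForm Ω fun x => θ x • (omega ∅ : Lam n) := hθ.real_smul_const _
  have hmem : ∀ j k, ∀ u ∈ List.replicate j ψ ++ List.replicate k φ,
      IsPSH Ω u ∧ IsLocallyBoundedOn Ω u := by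
    intro j k u hu
    rcases List.mem_append.mp hu with hu | hu
    · rw [List.eq_of_mem_replicate hu]; exact ⟨hψ, hψb⟩
    · rw [List.eq_of_mem_replicate hu]; exact ⟨hφ, hφb⟩
  have hcp : ∀ j k m, j + k + m = n →
      IsClosedPositive Ω m (bastonProduct Ω (List.replicate j ψ ++ List.replicate k φ)) :=
    fun j k m h => isClosedPositive_bastonProduct hΩ _ (hmem j k) (by simpa using h)
  -- Telescoping quantities: V (△ψ)^j ∧ (△φ)^(n-j) tested on θ. The ends j = n and j = 0 are the two
  -- integrals of the left-hand side.
  let A : ℕ → ℂ := fun j => mulCurrent Ω V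
    (bastonProduct Ω (List.replicate j ψ ++ List.replicate (n - j) φ)) fun x => θ x • omega ∅
  have hstep : ∀ j < n, A (j + 1) - A j = mulCurrent Ω (fun x => ψ x - φ x)
      (bastonWedge Ω V (bastonProduct Ω (List.replicate j ψ ++ List.replicate (n - 1 - j) φ)))
      fun x => θ x • omega ∅ := by
    intro j hj
    have hS := hcp j (n - 1 - j) 1 (by omega)
    have hA1 : A (j + 1) = mulCurrent Ω V (bastonWedge Ω ψ
        (bastonProduct Ω (List.replicate j ψ ++ List.replicate (n - 1 - j) φ)))
        fun x => θ x • omega ∅ := by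
      have e : n - (j + 1) = n - 1 - j := by omega
      simp only [A, e]
      rfl
    have hA0 : A j = mulCurrent Ω V (bastonWedge Ω φ
        (bastonProduct Ω (List.replicate j ψ ++ List.replicate (n - 1 - j) φ)))
        fun x => θ x • omega ∅ := by
      have e : n - j = n - 1 - j + 1 := by omega
      simp only [A, e, List.replicate_succ]
      refine (mulCurrent_congr_current hΩ ((hS.bastonWedge hΩ hφ hφb).hasMeasureCoefficients hΩ)
        (fun ξ hξ => ?_) hVB hη).symm
      exact bastonProduct_cons_replicate_append hΩ hφ hφb hψ hψc j _
        (fun u hu => hmem 0 (n - 1 - j) u (by simpa using hu)) (by simp; omega) hξ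
    rw [hA1, hA0]
    refine hS.integration_by_parts (m := 0) hΩ hφ hφc hψ hψc hV hVb hθ fun x hx hux => ?_
    exact hθ1 x (by_contra fun h => hux (hu0 x hx h))
  -- For j ≥ 1 a factor △ψ remains next to △V, so the resulting measure does not charge B; off B the
  -- integrand ψ - φ vanishes.
  have hzero : ∀ j, 1 ≤ j → j < n → A (j + 1) = A j := by
    intro j hj1 hjn
    rw [← sub_eq_zero, hstep j hjn]
    obtain ⟨i, rfl⟩ : ∃ i, j = i + 1 := ⟨j - 1, by omega⟩
    have hT := hcp i (n - 1 - (i + 1)) 2 (by omega)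
    have hT1 := hcp (i + 1) (n - 1 - (i + 1)) 1 (by omega)
    obtain ⟨μ, hμ⟩ := (hT1.bastonWedge hΩ hV hVb).exists_coefficientMeasure hΩ
    have hμB : μ (sublevel Ω φ r) = 0 :=
      measure_eq_zero_of_const hΩ hB hBΩ hψ hψc hV hVb hψB hT hμ
    rw [hμ.mulCurrent_eq hΩ huB hθ]
    have hae : ∀ᵐ x ∂μ, (ψ x - φ x) * θ x = 0 := by
      have : ∀ᵐ x ∂μ, x ∉ sublevel Ω φ r := measure_eq_zero_iff_ae_notMem.mp hμB
      filter_upwards [this] with x hx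
      by_cases hxΩ : x ∈ Ω
      · rw [hu0 x hxΩ hx, zero_mul]
      · rw [hθ.eq_zero hxΩ, mul_zero]
    rw [integral_eq_zero_of_ae hae]
    simp
  have hconst : ∀ j, 1 ≤ j → j ≤ n → A j = A 1 := by
    intro j hj
    induction j, hj using Nat.le_induction with
    | base => exact fun _ => rfl
    | succ j hj ih => exact fun h => (hzero j hj h).trans (ih (by omega))
  have hmain := hstep 0 (by omega)
  rw [zero_add, ← hconst n hn le_rfl] at hmain
  have hMψ := mongeAmpereSelf_isCoefficientMeasure hΩ hψ hψb
  have hMφ := mongeAmpereSelf_isCoefficientMeasure hΩ hφ hφb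
  have hMV := mongeAmpere_isCoefficientMeasure hΩ (V :: List.replicate (n - 1) φ) (by
    intro u hu
    rcases List.mem_cons.mp hu with rfl | hu
    · exact ⟨hV, hVb⟩
    · rw [List.eq_of_mem_replicate hu]; exact ⟨hφ, hφb⟩) (by simp; omega)
  have e1 : A n = ((∫ x, V x * θ x ∂(mongeAmpereSelf Ω ψ) : ℝ) : ℂ) := by
    rw [← hMψ.mulCurrent_eq hΩ hVB hθ]
    simp [A]
  have e2 : A 0 = ((∫ x, V x * θ x ∂(mongeAmpereSelf Ω φ) : ℝ) : ℂ) := by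
    rw [← hMφ.mulCurrent_eq hΩ hVB hθ]
    simp [A]
  have e3 := hMV.mulCurrent_eq hΩ huB hθ
  rw [e1, e2] at hmain
  have h := hmain.trans e3
  exact_mod_cast h

end Telescoping

/-! ### Sublevel sets and the boundary measure -/

section Boundary

variable {n : ℕ} {Ω : Set (HSpace n)} {φ V : HSpace n → ℝ} {r : ℝ}

theorem IsLocBddBorel.integrableOn_compact {u : HSpace n → ℝ} (hu : IsLocBddBorel Ω u)
    {μ : Measure (HSpace n)} (hμ : IsRadonOn Ω μ) {K : Set (HSpace n)} (hK : IsCompact K)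
    (hKΩ : K ⊆ Ω) : IntegrableOn u K μ := by
  obtain ⟨C, hC⟩ := hu.bounded K hK hKΩ
  have h : IntegrableOn (Ω.indicator u) K μ := by
    refine Measure.integrableOn_of_bounded (M := C) (hμ K hK hKΩ).ne
      hu.measurable.aestronglyMeasurable ?_
    filter_upwards [ae_restrict_mem hK.measurableSet] with x hx
    rw [indicator_of_mem (hKΩ hx)]
    exact hC x hx
  exact h.congr_fun (fun x hx => indicator_of_mem (hKΩ hx) u) hK.measurableSet

theorem isOpen_sublevel (hΩ : IsOpen Ω) (hφc : ContinuousOn φ Ω) (t : ℝ) :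
    IsOpen (sublevel Ω φ t) := hφc.isOpen_inter_preimage hΩ isOpen_Iio

theorem sublevel_mono {s t : ℝ} (h : s ≤ t) : sublevel Ω φ s ⊆ sublevel Ω φ t :=
  fun _ hx => ⟨hx.1, hx.2.trans_le h⟩

/-- The layer cake formula for r - φ on the sublevel set, followed by the substitution t ↦ r - t. -/
theorem setIntegral_sub_eq_integral_measure_sublevel {μ : Measure (HSpace n)}
    (hB : MeasurableSet (sublevel Ω φ r))
    (hInt : IntegrableOn (fun q => r - φ q) (sublevel Ω φ r) μ) :
    ∫ q in sublevel Ω φ r, (r - φ q) ∂μ = ∫ t in Iic r, μ.real (sublevel Ω φ t) := by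
  have hnn : 0 ≤ᵐ[μ.restrict (sublevel Ω φ r)] fun q => r - φ q := by
    filter_upwards [ae_restrict_mem hB] with q hq
    exact sub_nonneg.mpr hq.2.le
  rw [Integrable.integral_eq_integral_meas_lt hInt hnn]
  have h1 : ∀ t ∈ Ioi (0 : ℝ), (μ.restrict (sublevel Ω φ r)).real {a | t < r - φ a} =
      μ.real (sublevel Ω φ (r - t)) := by
    intro t ht
    rw [measureReal_restrict_apply' hB]
    congr 1
    ext x
    have ht' : 0 < t := ht
    simp only [sublevel, mem_inter_iff, mem_ofPred_eq]
    constructor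
    · rintro ⟨h, hx, -⟩
      exact ⟨hx, by linarith⟩
    · rintro ⟨hx, h⟩
      exact ⟨by linarith, hx, by linarith⟩
  rw [setIntegral_congr_fun measurableSet_Ioi h1]
  have h2 := (volume.measurePreserving_sub_left r).setIntegral_preimage_emb
    (MeasurableEquiv.subLeft r).measurableEmbedding (fun t => μ.real (sublevel Ω φ t)) (Iio r)
  have h3 : (fun x => r - x) ⁻¹' Iio r = Ioi 0 := by
    ext x
    simp
  rw [h3] at h2
  rw [h2, integral_Iic_eq_integral_Iio]

/-- The function of t is monotone and finite on [-C, r], and vanishes for t < -C, where C bounds |φ|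
on the compact closure of the sublevel set. -/
theorem integrableOn_measure_sublevel {μ : Measure (HSpace n)} (hμ : IsRadonOn Ω μ)
    (hφc : ContinuousOn φ Ω) (hr : RelativelyCompactIn (sublevel Ω φ r) Ω) :
    IntegrableOn (fun t => μ.real (sublevel Ω φ t)) (Iic r) := by
  obtain ⟨C, hC⟩ := hr.1.exists_bound_of_continuousOn (hφc.mono hr.2)
  have hfin : μ (sublevel Ω φ r) ≠ ⊤ :=
    ((measure_mono subset_closure).trans_lt (hμ _ hr.1 hr.2)).ne
  have hmono : MonotoneOn (fun t => μ.real (sublevel Ω φ t)) (Icc (-C) r) := by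
    intro s _ t ht hst
    exact measureReal_mono (sublevel_mono hst)
      (ne_top_of_le_ne_top hfin (measure_mono (sublevel_mono ht.2)))
  refine (hmono.integrableOn_isCompact isCompact_Icc).of_forall_sdiff_eq_zero measurableSet_Iic
    fun t ht => ?_
  have htr : t ≤ r := ht.1
  have htC : t < -C := by
    by_contra h
    exact ht.2 ⟨not_lt.mp h, htr⟩
  have hemp : sublevel Ω φ t = ∅ := by
    refine eq_empty_of_forall_notMem fun x hx => ?_
    have h1 := hC x (subset_closure (sublevel_mono htr hx))
    have h2 := (abs_le.mp h1).1
    linarith [hx.2]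
  simp [hemp]

/-- Away from the closure of the sublevel set, the Monge–Ampère measures of `φ` and of its
truncation agree. -/
theorem restrict_compl_closure_eq (hΩ : IsOpen Ω) (hφ : IsPSH Ω φ) (hφc : ContinuousOn φ Ω) :
    (mongeAmpereSelf Ω (truncation φ r)).restrict (closure (sublevel Ω φ r))ᶜ =
      (mongeAmpereSelf Ω φ).restrict (closure (sublevel Ω φ r))ᶜ := by
  have hφb := isLocallyBoundedOn_of_continuousOn hφc
  have hψ := hφ.truncation r
  have hψb := isLocallyBoundedOn_of_continuousOn (continuousOn_truncation hφc r)
  have hMφ := mongeAmpereSelf_isCoefficientMeasure hΩ hφ hφb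
  have hMψ := mongeAmpereSelf_isCoefficientMeasure hΩ hψ hψb
  have hU : IsOpen ((closure (sublevel Ω φ r))ᶜ ∩ Ω) := isClosed_closure.isOpen_compl.inter hΩ
  have hcongr : ∀ η, IsTestForm ((closure (sublevel Ω φ r))ᶜ ∩ Ω) η →
      bastonProduct Ω (List.replicate n (truncation φ r)) η =
        bastonProduct Ω (List.replicate n φ) η := fun η hη =>
    bastonProduct_replicate_congr hΩ hU inter_subset_right hψ hψb hφ hφb (c := 0)
      (fun x hx => by
        have h : r ≤ φ x := not_lt.mp fun h => hx.1 (subset_closure ⟨hx.2, h⟩)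
        simp [truncation, h]) le_rfl hη
  have hrestr : ∀ {μ : Measure (HSpace n)}, μ Ωᶜ = 0 →
      μ.restrict (closure (sublevel Ω φ r))ᶜ =
        μ.restrict ((closure (sublevel Ω φ r))ᶜ ∩ Ω) := by
    intro μ h0
    conv_lhs => rw [← restrict_eq_self_of_null h0]
    rw [Measure.restrict_restrict isClosed_closure.isOpen_compl.measurableSet]
  have hle : ∀ {μ ν : Measure (HSpace n)} {U : Set (HSpace n)}, MeasurableSet U →
      μ.restrict U ≤ ν → μ.restrict U ≤ ν.restrict U := by
    intro μ ν U hU h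
    have := Measure.restrict_mono_measure h U
    rwa [Measure.restrict_restrict hU, inter_self] at this
  rw [hrestr hMψ.1, hrestr hMφ.1]
  exact le_antisymm
    (hle hU.measurableSet (hMψ.restrict_le hMφ hU inter_subset_right hcongr))
    (hle hU.measurableSet (hMφ.restrict_le hMψ hU inter_subset_right
      fun η hη => (hcongr η hη).symm))

/-- The boundary measure is carried by the closure of the sublevel set, and there it is the
difference of two finite measures. -/
theorem boundaryMeasure_add (hΩ : IsOpen Ω) (hφ : IsPSH Ω φ) (hφc : ContinuousOn φ Ω)
    (hr : RelativelyCompactIn (sublevel Ω φ r) Ω) :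
    boundaryMeasure Ω φ r +
        (mongeAmpereSelf Ω φ).restrict (closure (sublevel Ω φ r) \ sublevel Ω φ r) =
      (mongeAmpereSelf Ω (truncation φ r)).restrict (closure (sublevel Ω φ r)) := by
  have hMφ := mongeAmpereSelf_isCoefficientMeasure hΩ hφ (isLocallyBoundedOn_of_continuousOn hφc)
  have hMψ := mongeAmpereSelf_isCoefficientMeasure hΩ (hφ.truncation r)
    (isLocallyBoundedOn_of_continuousOn (continuousOn_truncation hφc r))
  have hK : MeasurableSet (closure (sublevel Ω φ r)) := isClosed_closure.measurableSet
  have hB : MeasurableSet (sublevel Ω φ r) := (isOpen_sublevel hΩ hφc r).measurableSet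
  have hΩB : MeasurableSet (Ω \ sublevel Ω φ r) := hΩ.measurableSet.diff hB
  have hle := restrict_mongeAmpereSelf_le hΩ hφ hφc r
  have hRK : ((mongeAmpereSelf Ω φ).restrict (Ω \ sublevel Ω φ r)).restrict
      (closure (sublevel Ω φ r)) =
        (mongeAmpereSelf Ω φ).restrict (closure (sublevel Ω φ r) \ sublevel Ω φ r) := by
    rw [Measure.restrict_restrict hK]
    congr 1
    ext x
    constructor
    · rintro ⟨h1, -, h2⟩
      exact ⟨h1, h2⟩
    · rintro ⟨h1, h2⟩
      exact ⟨h1, hr.2 h1, h2⟩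
  -- The measures may be infinite on Ω, so their difference is treated in two pieces. Off the
  -- closure they agree and the difference is zero; on the compact closure they are finite, and the
  -- subtraction can be undone.
  have hzero : boundaryMeasure Ω φ r (closure (sublevel Ω φ r))ᶜ = 0 := by
    have hset : (closure (sublevel Ω φ r))ᶜ ⊆
        ((closure (sublevel Ω φ r))ᶜ ∩ Ω) ∪ Ωᶜ := by
      intro x hx
      by_cases h : x ∈ Ω
      · exact Or.inl ⟨hx, h⟩
      · exact Or.inr h
    refine measure_mono_null hset (measure_union_null ?_ ?_)
    · refine Measure.sub_apply_eq_zero_of_restrict_le_restrict ?_ (hK.compl.inter hΩ.measurableSet)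
      have h1 : ((closure (sublevel Ω φ r))ᶜ ∩ Ω) ∩ (Ω \ sublevel Ω φ r) =
          Ω ∩ (closure (sublevel Ω φ r))ᶜ := by
        ext x
        constructor
        · rintro ⟨⟨h1, h2⟩, -⟩
          exact ⟨h2, h1⟩
        · rintro ⟨h1, h2⟩
          exact ⟨⟨h2, h1⟩, h1, fun h => h2 (subset_closure h)⟩
      rw [Measure.restrict_restrict (hK.compl.inter hΩ.measurableSet), h1, inter_comm,
        ← Measure.restrict_restrict hΩ.measurableSet, ← Measure.restrict_restrict hΩ.measurableSet,
        restrict_compl_closure_eq hΩ hφ hφc]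
    · exact le_antisymm ((Measure.sub_le (Ωᶜ)).trans hMψ.1.le) zero_le
  have hself : (boundaryMeasure Ω φ r).restrict (closure (sublevel Ω φ r)) =
      boundaryMeasure Ω φ r := restrict_eq_self_of_null hzero
  have hfin : IsFiniteMeasure
      ((mongeAmpereSelf Ω φ).restrict (closure (sublevel Ω φ r) \ sublevel Ω φ r)) :=
    ⟨by
      rw [Measure.restrict_apply_univ]
      exact (measure_mono sdiff_subset).trans_lt (hMφ.2.1 _ hr.1 hr.2)⟩
  rw [← hself, boundaryMeasure, Measure.restrict_sub_eq_restrict_sub_restrict hK, hRK]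
  refine Measure.sub_add_cancel_of_le ?_
  rw [← hRK]
  exact Measure.restrict_mono_measure hle _

end Boundary

end

end QuatPluri

open QuatPluri

/-! ### The Lelong–Jensen type formula -/

theorem theorem5p1 (n : ℕ) (hn : 1 ≤ n) (Ω : Set (HSpace n))
    (hΩ : IsStrictlyPseudoconvexDomain Ω)
    (φ V : HSpace n → ℝ)
    (hφ : IsPSH Ω φ) (hφc : ContinuousOn φ Ω)
    (hV : IsPSH Ω V) (hVb : IsLocallyBoundedOn Ω V)
    (r : ℝ) (hr : RelativelyCompactIn (sublevel Ω φ r) Ω) :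
    -- the Bedford–Taylor products and the boundary measure are well defined
    (MongeAmpereDefined Ω (List.replicate n φ) ∧
      MongeAmpereDefined Ω (List.replicate n (truncation φ r)) ∧
      MongeAmpereDefined Ω (V :: List.replicate (n - 1) φ) ∧
      (mongeAmpereSelf Ω φ).restrict (Ω \ sublevel Ω φ r) ≤
        mongeAmpereSelf Ω (truncation φ r)) ∧
    -- all integrals converge
    (Integrable V (boundaryMeasure Ω φ r) ∧
      IntegrableOn V (sublevel Ω φ r) (mongeAmpereSelf Ω φ) ∧
      IntegrableOn (fun q => r - φ q) (sublevel Ω φ r)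
        (mongeAmpere Ω (V :: List.replicate (n - 1) φ)) ∧
      (∀ t ≤ r, mongeAmpere Ω (V :: List.replicate (n - 1) φ) (sublevel Ω φ t) < ⊤) ∧
      IntegrableOn
        (fun t => (mongeAmpere Ω (V :: List.replicate (n - 1) φ)).real (sublevel Ω φ t))
        (Set.Iic r)) ∧
    -- the Lelong–Jensen formula
    ((∫ q, V q ∂(boundaryMeasure Ω φ r))
        - (∫ q in sublevel Ω φ r, V q ∂(mongeAmpereSelf Ω φ))
      = ∫ q in sublevel Ω φ r, (r - φ q) ∂(mongeAmpere Ω (V :: List.replicate (n - 1) φ))) ∧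
    (∫ q in sublevel Ω φ r, (r - φ q) ∂(mongeAmpere Ω (V :: List.replicate (n - 1) φ))
      = ∫ t in Set.Iic r,
          (mongeAmpere Ω (V :: List.replicate (n - 1) φ)).real (sublevel Ω φ t)) := by
  have hΩo : IsOpen Ω := hΩ.1
  have hφb := isLocallyBoundedOn_of_continuousOn hφc
  have hψ := hφ.truncation r
  have hψc := continuousOn_truncation hφc r
  have hψb := isLocallyBoundedOn_of_continuousOn hψc
  have hVB := hV.isLocBddBorel hΩo hVb
  have hφm : ∀ u ∈ List.replicate n φ, IsPSH Ω u ∧ IsLocallyBoundedOn Ω u := fun u hu => by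
    rw [List.eq_of_mem_replicate hu]; exact ⟨hφ, hφb⟩
  have hψm : ∀ u ∈ List.replicate n (truncation φ r), IsPSH Ω u ∧ IsLocallyBoundedOn Ω u :=
    fun u hu => by rw [List.eq_of_mem_replicate hu]; exact ⟨hψ, hψb⟩
  have hVm : ∀ u ∈ V :: List.replicate (n - 1) φ, IsPSH Ω u ∧ IsLocallyBoundedOn Ω u := by
    intro u hu
    rcases List.mem_cons.mp hu with rfl | hu
    · exact ⟨hV, hVb⟩
    · rw [List.eq_of_mem_replicate hu]; exact ⟨hφ, hφb⟩
  have hVlen : (V :: List.replicate (n - 1) φ).length = n := by simp; omega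
  have hMφ := mongeAmpereSelf_isCoefficientMeasure hΩo hφ hφb
  have hMψ := mongeAmpereSelf_isCoefficientMeasure hΩo hψ hψb
  have hMV := mongeAmpere_isCoefficientMeasure hΩo _ hVm hVlen
  have hB := (isOpen_sublevel hΩo hφc r).measurableSet
  have hBK : sublevel Ω φ r ⊆ closure (sublevel Ω φ r) := subset_closure
  have hKm : MeasurableSet (closure (sublevel Ω φ r)) := isClosed_closure.measurableSet
  have hadd := boundaryMeasure_add hΩo hφ hφc hr
  have hVψ : IntegrableOn V (closure (sublevel Ω φ r)) (mongeAmpereSelf Ω (truncation φ r)) :=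
    hVB.integrableOn_compact hMψ.2.1 hr.1 hr.2
  have hVφ : IntegrableOn V (closure (sublevel Ω φ r)) (mongeAmpereSelf Ω φ) :=
    hVB.integrableOn_compact hMφ.2.1 hr.1 hr.2
  have hVint : Integrable V (boundaryMeasure Ω φ r) :=
    Integrable.mono_measure (f := V) hVψ (by rw [← hadd]; exact Measure.le_add_right le_rfl)
  have hrφ : IntegrableOn (fun q => r - φ q) (sublevel Ω φ r)
      (mongeAmpere Ω (V :: List.replicate (n - 1) φ)) :=
    ((isLocBddBorel_of_continuousOn hΩo (continuousOn_const.sub hφc)).integrableOn_compact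
      hMV.2.1 hr.1 hr.2).mono_set hBK
  refine ⟨⟨mongeAmpereDefined hΩo _ hφm (by simp), mongeAmpereDefined hΩo _ hψm (by simp),
    mongeAmpereDefined hΩo _ hVm hVlen, restrict_mongeAmpereSelf_le hΩo hφ hφc r⟩,
    ⟨hVint, hVφ.mono_set hBK, hrφ, fun t ht => ?_, integrableOn_measure_sublevel hMV.2.1 hφc hr⟩,
    ?_, setIntegral_sub_eq_integral_measure_sublevel hB hrφ⟩
  · exact (measure_mono ((sublevel_mono ht).trans hBK)).trans_lt (hMV.2.1 _ hr.1 hr.2)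
  -- The cutoff equals 1 in a neighbourhood of the whole closure, so it changes nothing there and
  -- affects only the region where the two Monge–Ampère measures agree.
  obtain ⟨θ, hθ, -, hθ1⟩ := exists_cutoff hΩo hr.1 hr.2
  have hθK : ∀ x ∈ closure (sublevel Ω φ r), θ x = 1 := fun x hx => hθ1.self_of_nhdsSet x hx
  have hLJ := lelong_jensen_cutoff hn hΩo hφ hφc hV hVb r hθ fun x hx =>
    eventually_nhdsSet_iff_forall.mp hθ1 x (hBK hx)
  have hInt : ∀ {μ : Measure (HSpace n)}, IsRadonOn Ω μ → Integrable (fun x => V x * θ x) μ := by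
    intro μ hμ
    have := (hVB.integrable_mul' hΩo hμ hθ.ofReal.1.continuous hθ.ofReal.2.1 hθ.ofReal.2.2).re
    simpa using this
  have hsplit : ∀ {μ : Measure (HSpace n)}, IsRadonOn Ω μ → ∫ x, V x * θ x ∂μ =
      ∫ x in closure (sublevel Ω φ r), V x ∂μ +
        ∫ x in (closure (sublevel Ω φ r))ᶜ, V x * θ x ∂μ := by
    intro μ hμ
    rw [← integral_add_compl hKm (hInt hμ)]
    congr 1
    exact setIntegral_congr_fun hKm fun x hx => by simp [hθK x hx]
  have hright : ∫ x, (truncation φ r x - φ x) * θ x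
        ∂(mongeAmpere Ω (V :: List.replicate (n - 1) φ)) =
      ∫ q in sublevel Ω φ r, (r - φ q) ∂(mongeAmpere Ω (V :: List.replicate (n - 1) φ)) := by
    rw [← integral_indicator hB]
    congr 1
    funext x
    by_cases hx : x ∈ sublevel Ω φ r
    · rw [indicator_of_mem hx, hθK x (hBK hx), mul_one, truncation, max_eq_right hx.2.le]
    · rw [indicator_of_notMem hx]
      by_cases hxΩ : x ∈ Ω
      · have h : r ≤ φ x := not_lt.mp fun h => hx ⟨hxΩ, h⟩
        simp [truncation, h]
      · rw [hθ.eq_zero hxΩ, mul_zero]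
  have hbd : ∫ x in closure (sublevel Ω φ r), V x ∂(mongeAmpereSelf Ω (truncation φ r)) =
      ∫ x, V x ∂(boundaryMeasure Ω φ r) +
        ∫ x in closure (sublevel Ω φ r) \ sublevel Ω φ r, V x ∂(mongeAmpereSelf Ω φ) := by
    rw [← hadd, integral_add_measure hVint (hVφ.mono_set sdiff_subset)]
  have hinter : ∫ x in closure (sublevel Ω φ r), V x ∂(mongeAmpereSelf Ω φ) =
      ∫ x in sublevel Ω φ r, V x ∂(mongeAmpereSelf Ω φ) +
        ∫ x in closure (sublevel Ω φ r) \ sublevel Ω φ r, V x ∂(mongeAmpereSelf Ω φ) := by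
    rw [← integral_inter_add_sdiff hB hVφ, inter_eq_right.mpr hBK]
  -- The integrals over the complement of the closure cancel, and so do the two contributions of the
  -- measure of φ on the closure minus the sublevel set.
  rw [hsplit hMψ.2.1, hsplit hMφ.2.1, restrict_compl_closure_eq hΩo hφ hφc, hright, hbd,
    hinter] at hLJ
  linarith
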